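/- **Setting.** Let $N$ flows of packets share a queue with infinite buffer and $M$ servers, in continuous time $t\in[0,\infty)$. Packet $i$ of flow $n$ ($n=1,\dots,N$, $i=1,2,\dots$) is generated at time $S_{n,i}$ and arrives at the queue at time $A_{n,i}$, where $0\le S_{n,1}\le S_{n,2}\le\cdots$, $S_{n,i}\le A_{n,i}$, and only finitely many packets arrive in bounded time; out-of-order arrivals are allowed. Generation and arrival times are *synchronized*: $S_{n,i}=S_i$ and $A_{n,i}=A_i$ for all $n,i$. Write $\mathcal I=\{S_i,A_i:i\ge1\}$. The transmission times are i.i.d. exponential with rate $\mu>0$. Each transmission, at its end, independently fails with probability $q\in[0,1)$; the scheduler learns this at once, and the packet returns to the queue. Otherwise the packet is delivered. $\mathcal I$, the transmission times and the errors are mutually independent and not influenced by the scheduling. Each server transmits at most one packet at a time, and different servers may not transmit packets of the same flow simultaneously. A *causal policy* $\pi\in\Pi$ decides at every time, from the past and current state only (and possibly private randomization), which arrived, undelivered packets the servers transmit; it may preempt (a preempted packet goes back to the queue and its transmission may be resumed later) and may idle. The age of flow $n$ at time $t$ under $\pi$ is $\Delta_{n,\pi}(t)=t-U_n(t)$, where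 $U_n(t)$ is the largest generation time of a packet of flow $n$ delivered by time $t$; the ages $\boldsymbol\Delta(0^-)\in[0,\infty)^N$ right before time $0$ are the same for all policies (so $U_n$ starts from $-\Delta_n(0^-)$). Let $\mathcal P_{\rm sym}$ be the set of all (Borel) functions $p:[0,\infty)^N\to\mathbb R$ that are symmetric and non-decreasing in the componentwise order. **P-MAF-LGFS.** A causal policy is a P-MAF-LGFS policy if at all times the servers are assigned as follows, with preemption where necessary. Servers are assigned one after another to the most recently generated arrived packets of the flows, in decreasing order of the age of the flow (ties broken arbitrarily), skipping the flows whose most recently generated packet has been delivered, until all servers are busy or the most recently generated packet of every flow is in service or delivered. In the latter case the remaining servers transmit arbitrary remaining packets of flows that are not being served, and a server idles only if there are none. **Stochastic order.** Random vectors satisfy $\mathbf X\le_{\rm st}\mathbf Y$ if $\Pr(\mathbf X\in U)\le\Pr(\mathbf Y\in U)$ for every (Borel) upper set $U\subseteq\mathbb R^n$; processes satisfy $\{X(t)\}\le_{\rm st}\{Y(t)\}$ if $(X(t_1),\dots,X(t_n))\le_{\rm st}(Y(t_1),\dots,Y(t_n))$ for all $n$ and $0\le t_1<\dots<t_n$.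 A functional $\phi$ from functions $[0,\infty)\to\mathbb R$ to $\mathbb R$ is non-decreasing if $\phi(x)\le\phi(y)$ whenever $x(t)\le y(t)$ for all $t\ge 0$. **Theorem 1.** For all $\mathcal I$, all families $(p_t)_{t\ge0}$ in $\mathcal P_{\rm sym}$, every P-MAF-LGFS policy and all $\pi\in\Pi$, $$[\{p_t\circ\boldsymbol\Delta_{\text{P-MAF-LGFS}}(t),\,t\in[0,\infty)\}\mid\mathcal I]\ \le_{\rm st}\ [\{p_t\circ\boldsymbol\Delta_{\pi}(t),\,t\in[0,\infty)\}\mid\mathcal I],$$ and, equivalently, for all $\mathcal I$, all $(p_t)_{t\ge0}$ in $\mathcal P_{\rm sym}$ and all non-decreasing functionals $\phi$, $$\mathbb E[\phi(\{p_t\circ\boldsymbol\Delta_{\text{P-MAF-LGFS}}(t),\,t\in[0,\infty)\})\mid\mathcal I]=\min_{\pi\in\Pi}\mathbb E[\phi(\{p_t\circ\boldsymbol\Delta_\pi(t),\,t\in[0,\infty)\})\mid\mathcal I],$$ provided that the expectations exist (possibly as $\pm\infty$). -/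

import Mathlib

open MeasureTheory ProbabilityTheory
open scoped ENNReal NNReal

noncomputable section

namespace StatusUpdate

/-! ### Stochastic ordering and expectations -/

/-- Stochastic ordering of random vectors: `X ≤_st Y` if `Pr(X ∈ U) ≤ Pr(Y ∈ U)` for every (Borel)
upper set `U ⊆ ℝⁿ`. -/
def VectorStLE {Ω Ω' : Type*} [MeasurableSpace Ω] [MeasurableSpace Ω'] {n : ℕ}
    (ν : Measure Ω) (X : Ω → Fin n → ℝ) (ν' : Measure Ω') (Y : Ω' → Fin n → ℝ) : Prop :=
  ∀ U : Set (Fin n → ℝ), IsUpperSet U → MeasurableSet U → ν (X ⁻¹' U) ≤ ν' (Y ⁻¹' U)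

/-- Stochastic ordering of processes indexed by `[0, ∞)`: stochastic ordering of all
finite-dimensional vectors `(X(t₁), …, X(tₙ))`, `0 ≤ t₁ < ⋯ < tₙ`. -/
def ProcessStLE {Ω Ω' : Type*} [MeasurableSpace Ω] [MeasurableSpace Ω']
    (ν : Measure Ω) (X : ℝ≥0 → Ω → ℝ) (ν' : Measure Ω') (Y : ℝ≥0 → Ω' → ℝ) : Prop :=
  ∀ (n : ℕ) (t : Fin n → ℝ≥0), StrictMono t →
    VectorStLE ν (fun ω j => X (t j) ω) ν' (fun ω j => Y (t j) ω)

/-- The expectation of `f` exists, possibly as `±∞`: `f` is measurable up to null sets, and the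
expectations of its positive and of its negative part are not both infinite. -/
def ExpectationExists {Ω : Type*} [MeasurableSpace Ω] (ν : Measure Ω) (f : Ω → ℝ) : Prop :=
  AEMeasurable f ν ∧
    ((∫⁻ ω, ENNReal.ofReal (f ω) ∂ν) ≠ ⊤ ∨ (∫⁻ ω, ENNReal.ofReal (-f ω) ∂ν) ≠ ⊤)

/-- The extended expectation `E[f⁺] - E[f⁻]`. -/
def expectation {Ω : Type*} [MeasurableSpace Ω] (ν : Measure Ω) (f : Ω → ℝ) : EReal :=
  ((∫⁻ ω, ENNReal.ofReal (f ω) ∂ν : ℝ≥0∞) : EReal) -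
    ((∫⁻ ω, ENNReal.ofReal (-f ω) ∂ν : ℝ≥0∞) : EReal)

/-! ### Packets and arrivals -/

/-- The packet `(n, i)` is the `i`-th packet of flow `n` (counted from `0`). -/
abbrev Packet (N : ℕ) := Fin N × ℕ

/-- Packet generation times `S (n, i)` and arrival times `A (n, i)` of `N` flows. Only finitely
many packets of a flow arrive in bounded time. -/
structure Arrivals (N : ℕ) where
  S : Packet N → ℝ
  A : Packet N → ℝ
  gen_nonneg : ∀ n, 0 ≤ S (n, 0)
  gen_mono : ∀ n, Monotone fun i => S (n, i)
  gen_le_arr : ∀ p, S p ≤ A p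
  finite_arrived : ∀ n (t : ℝ), {i | A (n, i) ≤ t}.Finite

/-- Generation and arrival times are synchronized across the flows. -/
def Arrivals.Synchronized {N : ℕ} (I : Arrivals N) : Prop :=
  ∃ S A : ℕ → ℝ, ∀ n i, I.S (n, i) = S i ∧ I.A (n, i) = A i

/-- What the scheduler knows at time `t` about the arrivals: the generation and arrival time of
each packet that has arrived by time `t`, and nothing about the others. -/
def Arrivals.observed {N : ℕ} (I : Arrivals N) (t : ℝ) : Packet N → Option (ℝ × ℝ) :=
  open Classical in fun p => if I.A p ≤ t then some (I.S p, I.A p) else none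

/-! ### Causal scheduling policies -/

/-- What the scheduler has been told at an epoch (time `0`, or a time when transmissions end):
the time of the epoch, the number of failed transmissions of each packet so far, and which packets
have been delivered so far. -/
abbrev Snapshot (N : ℕ) := ℝ≥0∞ × (Packet N → ℕ) × (Packet N → Bool)

/-- The snapshots of epochs `0, …, k`. -/
abbrev History (N k : ℕ) := Fin (k + 1) → Snapshot N

/-- A causal (possibly randomized and preemptive, not necessarily work-conserving) scheduling
policy for `N` flows and `M` servers. `act r obs h t m` is the packet that server `m` transmits at
time `t` (`none` if the server idles), where `r` is the outcome of a private randomization,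
`obs` is the arrival information at time `t`, and `h` is the record of all epochs up to time `t`.
Only packets that have arrived and have not been delivered are transmitted, and two servers never
transmit packets of the same flow (in particular not the same packet). -/
structure Policy (N M : ℕ) where
  act : unitInterval → (Packet N → Option (ℝ × ℝ)) → {k : ℕ} → History N k → ℝ →
    Fin M → Option (Packet N)
  arrived : ∀ r obs {k : ℕ} (h : History N k) t m p, act r obs h t m = some p → obs p ≠ none
  undelivered : ∀ r obs {k : ℕ} (h : History N k) t m p, act r obs h t m = some p →
    (h (Fin.last k)).2.2 p = false
  flow_injective : ∀ r obs {k : ℕ} (h : History N k) t m m' p p', act r obs h t m = some p →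
    act r obs h t m' = some p' → p.1 = p'.1 → m = m'
  measurable_act : ∀ (I : Arrivals N) (k : ℕ) (m : Fin M) (p : Packet N),
    MeasurableSet {x : unitInterval × History N k × ℝ |
      act x.1 (I.observed x.2.2) x.2.1 x.2.2 m = some p}

/-! ### Randomness of the system -/

/-- Sample points `(X, err, r)`: `X (p, j)` is the transmission time of the `j`-th transmission of
packet `p`, `err (p, j)` says whether that transmission ends with an error, and `r` is the
randomization of the policy. -/
abbrev Outcome (N : ℕ) := (Packet N × ℕ → ℝ) × (Packet N × ℕ → Bool) × unitInterval

/-- I.i.d. exponential transmission times with rate `μ` (mean `1 / μ`), i.i.d. errors with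
probability `q` and the uniform randomization of the policy, mutually independent. -/
def law (N : ℕ) (μ : ℝ) (hμ : 0 < μ) (q : unitInterval) : Measure (Outcome N) :=
  haveI := isProbabilityMeasure_expMeasure hμ
  (Measure.infinitePi fun _ : Packet N × ℕ => expMeasure μ).prod
    ((Measure.infinitePi fun _ : Packet N × ℕ => bernoulliMeasure true false q).prod volume)

/-! ### Evolution of the system -/

section Dynamics

variable {N M : ℕ} (I : Arrivals N) (π : Policy N M)

/-- The times at which packet `p` is transmitted by some server as long as the epochs that have
occurred are those recorded in `h`. -/
def serviceTimes (r : unitInterval) {k : ℕ} (h : History N k) (p : Packet N) : Set ℝ :=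
  {s | 0 ≤ s ∧ ∃ m, π.act r (I.observed s) h s m = some p}

/-- The amount of transmission time that the current transmission of packet `p` has received by
time `t`, if no epoch occurs between the last epoch of `h` and `t`; here `g p` is the amount
received by the last epoch of `h`. (A preempted transmission is resumed later.) -/
def work (r : unitInterval) {k : ℕ} (h : History N k) (g : Packet N → ℝ≥0∞) (p : Packet N)
    (t : ℝ≥0∞) : ℝ≥0∞ :=
  g p + volume (serviceTimes I π r h p ∩
    {s | (h (Fin.last k)).1 ≤ ENNReal.ofReal s ∧ ENNReal.ofReal s < t})

/-- The current transmission of `p` has received its full transmission time by time `t`. -/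
def Finished (ω : Outcome N) {k : ℕ} (h : History N k) (g : Packet N → ℝ≥0∞) (p : Packet N)
    (t : ℝ≥0∞) : Prop :=
  0 < work I π ω.2.2 h g p t ∧
    ENNReal.ofReal (ω.1 (p, (h (Fin.last k)).2.1 p)) ≤ work I π ω.2.2 h g p t

/-- The time of the next epoch: the first time when a transmission ends (`∞` if there is none). -/
def nextTime (ω : Outcome N) {k : ℕ} (h : History N k) (g : Packet N → ℝ≥0∞) : ℝ≥0∞ :=
  sInf {t | (h (Fin.last k)).1 ≤ t ∧ ∃ p, Finished I π ω h g p t}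

open Classical in
/-- The snapshot at the next epoch. A transmission that ends with an error is counted as failed,
and its packet stays in the queue; otherwise the packet is delivered. -/
def nextSnapshot (ω : Outcome N) {k : ℕ} (h : History N k) (g : Packet N → ℝ≥0∞) : Snapshot N :=
  let T := nextTime I π ω h g
  let s := (h (Fin.last k)).2
  (T,
    fun p => if Finished I π ω h g p T ∧ ω.2.1 (p, s.1 p) = true then s.1 p + 1 else s.1 p,
    fun p => if Finished I π ω h g p T ∧ ω.2.1 (p, s.1 p) = false then true else s.2 p)

open Classical in
/-- The transmission times received at the next epoch by the transmissions that are under way. -/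
def nextWork (ω : Outcome N) {k : ℕ} (h : History N k) (g : Packet N → ℝ≥0∞) :
    Packet N → ℝ≥0∞ :=
  let T := nextTime I π ω h g
  fun p => if Finished I π ω h g p T then 0 else work I π ω.2.2 h g p T

/-- The system under policy `π` with arrivals `I`, at epoch `k`: the history, and the transmission
time received so far by the current transmission of each packet. -/
def run (ω : Outcome N) : (k : ℕ) → History N k × (Packet N → ℝ≥0∞)
  | 0 => (fun _ => (0, fun _ => 0, fun _ => false), fun _ => 0)
  | k + 1 =>
    (Fin.snoc (α := fun _ => Snapshot N) (run ω k).1 (nextSnapshot I π ω (run ω k).1 (run ω k).2),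
      nextWork I π ω (run ω k).1 (run ω k).2)

/-- The snapshot at epoch `k`. -/
def snapshot (ω : Outcome N) (k : ℕ) : Snapshot N := (run I π ω k).1 (Fin.last k)

/-- Packet `p` is delivered by time `t`. -/
def DeliveredBy (ω : Outcome N) (p : Packet N) (t : ℝ≥0) : Prop :=
  ∃ k, (snapshot I π ω k).1 ≤ t ∧ (snapshot I π ω k).2.2 p = true

/-- Server `m` transmits packet `p` at time `t`. -/
def InService (ω : Outcome N) (t : ℝ≥0) (m : Fin M) (p : Packet N) : Prop :=
  ∃ k, (snapshot I π ω k).1 ≤ t ∧ (t : ℝ≥0∞) < (snapshot I π ω (k + 1)).1 ∧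
    π.act ω.2.2 (I.observed t) (run I π ω k).1 t m = some p

/-- The age of flow `n` at time `t`, where `Δ₀ n` is the age of flow `n` right before time `0`. -/
def age (Δ₀ : Fin N → ℝ≥0) (ω : Outcome N) (t : ℝ≥0) (n : Fin N) : ℝ :=
  t - sSup (insert (-(Δ₀ n : ℝ)) {s | ∃ i, DeliveredBy I π ω (n, i) t ∧ s = I.S (n, i)})

theorem work_pos {r : unitInterval} {k : ℕ} {h : History N k} {g : Packet N → ℝ≥0∞}
    {p : Packet N} {t : ℝ≥0∞} (hw : 0 < work I π r h g p t) :
    0 < g p ∨ ENNReal.ofReal (I.A p) ≤ t := by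
  by_cases hg : 0 < g p
  · exact Or.inl hg
  right
  have h0 : g p = 0 := by simpa using hg
  unfold work at hw
  rw [h0, zero_add] at hw
  obtain ⟨s, ⟨_, m, hm⟩, _, hs⟩ := nonempty_of_measure_ne_zero hw.ne'
  have hobs := π.arrived _ _ _ _ _ _ hm
  have hA : I.A p ≤ s := by
    by_contra hA
    exact hobs (by simp [Arrivals.observed, hA])
  exact (ENNReal.ofReal_le_ofReal hA).trans hs.le

theorem arrived_of_delivered (ω : Outcome N) (k : ℕ) (p : Packet N)
    (hk : 0 < (run I π ω k).2 p ∨ (snapshot I π ω k).2.2 p = true) :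
    ENNReal.ofReal (I.A p) ≤ (snapshot I π ω k).1 := by
  induction k with
  | zero => simp [run, snapshot] at hk
  | succ k ih =>
    have e : snapshot I π ω (k + 1) = nextSnapshot I π ω (run I π ω k).1 (run I π ω k).2 := by
      simp [snapshot, run, -Fin.reduceLast]
    have hT : (snapshot I π ω k).1 ≤ nextTime I π ω (run I π ω k).1 (run I π ω k).2 :=
      le_sInf fun t ht => ht.1
    have key : 0 < work I π ω.2.2 (run I π ω k).1 (run I π ω k).2 p
        (nextTime I π ω (run I π ω k).1 (run I π ω k).2) →
        ENNReal.ofReal (I.A p) ≤ nextTime I π ω (run I π ω k).1 (run I π ω k).2 := fun hw =>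
      (work_pos I π hw).elim (fun hg => (ih (Or.inl hg)).trans hT) id
    rw [e] at hk ⊢
    rcases hk with hk | hk
    · simp only [run, nextWork] at hk
      split_ifs at hk with hf
      · simp at hk
      · exact key hk
    · simp only [nextSnapshot] at hk
      split_ifs at hk with hf
      · exact key hf.1.1
      · exact (ih (Or.inr hk)).trans hT

theorem age_nonneg (Δ₀ : Fin N → ℝ≥0) (ω : Outcome N) (t : ℝ≥0) (n : Fin N) :
    0 ≤ age I π Δ₀ ω t n := by
  unfold age
  rw [sub_nonneg]
  refine csSup_le (Set.insert_nonempty _ _) ?_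
  rintro s (rfl | ⟨i, ⟨k, hk, hd⟩, rfl⟩)
  · linarith [NNReal.coe_nonneg t, NNReal.coe_nonneg (Δ₀ n)]
  · have h := (arrived_of_delivered I π ω k _ (Or.inr hd)).trans hk
    rw [← ENNReal.ofReal_coe_nnreal] at h
    exact (I.gen_le_arr _).trans ((ENNReal.ofReal_le_ofReal_iff t.2).1 h)

/-- The age-penalty process `p_t ∘ Δ_π(t)`. (Ages are nonnegative, see `age_nonneg`.) -/
def agePenalty (Δ₀ : Fin N → ℝ≥0) (p : ℝ≥0 → (Fin N → ℝ≥0) → ℝ) (t : ℝ≥0) (ω : Outcome N) : ℝ :=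
  p t fun n => (age I π Δ₀ ω t n).toNNReal

end Dynamics

/-! ### The P-MAF-LGFS policy -/

section MAF

variable {N M : ℕ} (I : Arrivals N) (π : Policy N M)

/-- `p` is a most recently generated packet among the packets of its flow that have arrived. -/
def Freshest (t : ℝ≥0) (p : Packet N) : Prop :=
  I.A p ≤ t ∧ ∀ i, I.A (p.1, i) ≤ t → I.S (p.1, i) ≤ I.S p

/-- A packet of flow `n` has arrived by time `t`, and the most recently generated one has not been
delivered. -/
def FreshPending (ω : Outcome N) (t : ℝ≥0) (n : Fin N) : Prop :=
  (∃ i, Freshest I t (n, i)) ∧ ∀ i, Freshest I t (n, i) → ¬ DeliveredBy I π ω (n, i) t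

/-- The servers are assigned at time `t` according to the P-MAF-LGFS rule:
* servers are given to the most recently generated packets of the flows in decreasing order of age
  (ties broken arbitrarily) until each of these packets is in service or delivered, or all servers
  are used up: if the most recently generated packet of flow `n` is neither in service nor
  delivered, then every server transmits the most recently generated packet of a flow whose age is
  at least that of flow `n`;
* the remaining servers transmit arbitrary remaining packets: if a server idles, then every flow
  with packets in the queue is already being served. -/
def MAFRuleAt (Δ₀ : Fin N → ℝ≥0) (ω : Outcome N) (t : ℝ≥0) : Prop :=
  (∀ n, FreshPending I π ω t n →
    (¬ ∃ m i, InService I π ω t m (n, i) ∧ Freshest I t (n, i)) →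
    ∀ m, ∃ p, InService I π ω t m p ∧ Freshest I t p ∧ age I π Δ₀ ω t n ≤ age I π Δ₀ ω t p.1) ∧
  ((∃ m, ∀ p, ¬ InService I π ω t m p) →
    ∀ p, I.A p ≤ t → ¬ DeliveredBy I π ω p t →
      ∃ m p', InService I π ω t m p' ∧ p'.1 = p.1)

/-- In the system with arrivals `I`, initial ages `Δ₀` and randomness `ν`, the policy `π` is a
P-MAF-LGFS policy: almost surely, it follows the P-MAF-LGFS rule at all times. -/
def IsPMAFLGFS (ν : Measure (Outcome N)) (Δ₀ : Fin N → ℝ≥0) : Prop :=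
  ∀ᵐ ω ∂ν, ∀ t : ℝ≥0, MAFRuleAt I π Δ₀ ω t

end MAF

/-- `p : [0, ∞)^N → ℝ` is a (Borel) symmetric and non-decreasing age penalty function. -/
structure IsSymPenalty {N : ℕ} (p : (Fin N → ℝ≥0) → ℝ) : Prop where
  symm : ∀ (σ : Equiv.Perm (Fin N)) (x : Fin N → ℝ≥0), p (x ∘ σ) = p x
  mono : Monotone p
  measurable : Measurable p

end StatusUpdate

end

noncomputable section

namespace StatusUpdate

/-! ### Infinite product measures -/

section InfiniteProducts

/-! The proof is a coupling. An idle server is given a dummy clock, so that at every time the `M`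
servers work on `M` distinct items (packets or dummy clocks), all with independent exponential
clocks. The servers are ranked by the age of the flow they serve, oldest first and idle servers
last; the ranks are called slots. By memorylessness, whatever the causal assignment, the time to the
next completion is exponential with rate `M * μ`, the slot where it occurs is uniform, its error
mark is a fresh coin, and all three are independent of the past and of the residual clocks
(`map_step`, resting on the computation `clocksLaw_completesFirst`). Hence the sequence of events,
together with the private randomization, has a law that does not depend on the policy
(`IsCausal.measurePreserving_sourceOf`), and almost surely this sequence determines the ages
(`DrivenBy.age_eq`). Two systems under different policies can therefore be glued along a common
source of events (`exists_gluing`).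

On a common source, slot `k` completes in both systems at the same time and with the same error
mark. The invariant is that, for every `c`, the P-MAF-LGFS system has at most as many flows whose
freshest delivered packet was generated before `c` as the other system (`nextState_countBelow_le`).
Suppose that a delivery in slot `k` lowers this number for the other system. Slots being sorted,
that system had more than `k` such flows. Either P-MAF-LGFS had at most `k`, and the inequality was
strict with room for a loss of one; or its slot `k` holds a freshest packet of such a flow, which by
synchronization was generated at or after `c`, so its number drops as well. Dominance of all these
counts is dominance of the sorted vectors, hence of the ages up to a permutation, hence of symmetric
monotone penalties at all times (`agePenalty_le_of_drivenBy`). This pathwise inequality gives both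
the stochastic order and the minimality of the expectations.

One point is delicate. The policy is assumed to obey its rule in the states that occur, while the
invariant needs the rule at an event time with the history from before that event. That assignment
depends on the past only, and the gap is independent of the past; this carries the rule over
(`ae_freshRule`). -/

theorem measurable_of_countable_cases {ι α γ : Type*} [Countable ι] [MeasurableSpace α]
    [MeasurableSpace γ] {c : α → ι} (hc : ∀ i, MeasurableSet {x | c x = i}) {f : ι → α → γ}
    (hf : ∀ i, Measurable (f i)) : Measurable fun x => f (c x) x := by
  intro s hs
  have : (fun x => f (c x) x) ⁻¹' s = ⋃ i, {x | c x = i} ∩ f i ⁻¹' s := by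
    ext x; simp
  rw [this]
  exact MeasurableSet.iUnion fun i => (hc i).inter (hf i hs)

variable {ι : Type*} {X : ι → Type*} [∀ i, MeasurableSpace (X i)] {ν : ∀ i, Measure (X i)}
  [∀ i, IsProbabilityMeasure (ν i)]

/-- Resampling one coordinate of a family of independent random variables. -/
theorem measurePreserving_update [DecidableEq ι] (i : ι) :
    MeasurePreserving (fun z : X i × ∀ j, X j => Function.update z.2 i z.1)
      ((ν i).prod (Measure.infinitePi ν)) (Measure.infinitePi ν) := by
  have hm : Measurable (fun z : X i × ∀ j, X j => Function.update z.2 i z.1) := by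
    refine measurable_pi_iff.2 fun j => ?_
    by_cases h : j = i
    · subst h; simpa using measurable_fst
    · simp only [Function.update_of_ne h]; fun_prop
  refine ⟨hm, Measure.eq_infinitePi _ fun s t ht => ?_⟩
  rw [Measure.map_apply hm (.pi s.countable_toSet fun i _ => ht i)]
  have : (fun z : X i × ∀ j, X j => Function.update z.2 i z.1) ⁻¹' (s : Set ι).pi t =
      (if i ∈ s then t i else Set.univ) ×ˢ ((s.erase i : Finset ι) : Set ι).pi t := by
    ext ⟨z, f⟩
    simp only [Set.mem_preimage, Set.mem_pi, Set.mem_prod]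
    constructor
    · intro h
      refine ⟨?_, fun j hj => ?_⟩
      · split_ifs with hi
        · simpa using h i hi
        · trivial
      · have hj' := Finset.mem_erase.1 (Finset.mem_coe.1 hj)
        simpa [Function.update_of_ne hj'.1] using h j hj'.2
    · rintro ⟨h1, h2⟩ j hj
      by_cases hji : j = i
      · subst hji
        have : j ∈ s := hj
        simpa [this] using h1
      · simpa [Function.update_of_ne hji] using h2 j (by simpa [hji] using hj)
  rw [this, Measure.prod_prod, Measure.infinitePi_pi _ fun j _ => ht j]
  split_ifs with hi
  · rw [Finset.mul_prod_erase s (fun j => ν j (t j)) hi]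
  · rw [Finset.erase_eq_of_notMem hi, measure_univ, one_mul]

/-- The constant is the total mass, so dividing by it reduces to uniqueness of the product measure.
This is the tool for independence proofs: for a joint law `ν` and a fixed event `A`, the measure `B
↦ ν (A ×ˢ B)` only has to be computed on boxes. -/
theorem eq_smul_infinitePi {ν' : Measure (∀ i, X i)} {c : ℝ≥0∞} [IsFiniteMeasure ν']
    (h : ∀ (s : Finset ι) (t : ∀ i, Set (X i)), (∀ i, MeasurableSet (t i)) →
      ν' ((s : Set ι).pi t) = c * ∏ i ∈ s, ν i (t i)) : ν' = c • Measure.infinitePi ν := by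
  have hc : ν' Set.univ = c := by simpa using h ∅ (fun _ => Set.univ) (fun _ => MeasurableSet.univ)
  have hct : c ≠ ⊤ := hc ▸ measure_ne_top _ _
  rcases eq_or_ne c 0 with rfl | h0
  · simpa using hc
  · have : c⁻¹ • ν' = Measure.infinitePi ν := by
      refine Measure.eq_infinitePi _ fun s t ht => ?_
      rw [Measure.smul_apply, h s t ht, smul_eq_mul, ← mul_assoc, ENNReal.inv_mul_cancel h0 hct,
        one_mul]
    rw [← this, smul_smul, ENNReal.mul_inv_cancel h0 hct, one_smul]

/-- Over a countable index a box on finitely many coordinates is a full box with trivial remaining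
sides. Full boxes are the natural test sets when all clocks age simultaneously. -/
theorem eq_smul_infinitePi_of_univ [Countable ι] {ν' : Measure (∀ i, X i)} {c : ℝ≥0∞}
    [IsFiniteMeasure ν']
    (h : ∀ (t : ∀ i, Set (X i)), (∀ i, MeasurableSet (t i)) →
      ν' (Set.univ.pi t) = c * Measure.infinitePi ν (Set.univ.pi t)) :
    ν' = c • Measure.infinitePi ν := by
  classical
  refine eq_smul_infinitePi fun s t ht => ?_
  have e : (s : Set ι).pi t = Set.univ.pi (fun i => if i ∈ s then t i else Set.univ) := by
    ext f
    simp only [Set.mem_pi, Set.mem_univ, true_implies, Finset.mem_coe]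
    refine forall_congr' fun i => ?_
    split_ifs with hi <;> simp [hi]
  rw [e, h _ fun i => ?_, ← e, Measure.infinitePi_pi _ fun i _ => ht i]
  split_ifs
  exacts [ht i, .univ]

theorem infinitePi_univ_pi_split [DecidableEq ι] [Countable ι] (i : ι) {t : ∀ i, Set (X i)}
    (ht : ∀ i, MeasurableSet (t i)) :
    Measure.infinitePi ν (Set.univ.pi t) =
      ν i (t i) * Measure.infinitePi ν (Set.univ.pi (Function.update t i Set.univ)) := by
  have hms : MeasurableSet (Set.univ.pi t) := .univ_pi ht
  rw [← (measurePreserving_update (ν := ν) i).measure_preimage hms.nullMeasurableSet,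
    ← Measure.prod_prod]
  congr 1
  ext ⟨z, f⟩
  simp only [Set.mem_preimage, Set.mem_pi, Set.mem_univ, true_implies, Set.mem_prod]
  constructor
  · intro h
    refine ⟨by simpa using h i, fun j => ?_⟩
    by_cases hji : j = i
    · subst hji; simp
    · simpa [Function.update_of_ne hji] using h j
  · rintro ⟨h1, h2⟩ j
    by_cases hji : j = i
    · subst hji; simpa using h1
    · simpa [Function.update_of_ne hji] using h2 j

/-- A product of the measures of boxes with factors of exponential type. -/
theorem infinitePi_univ_pi_exp_mul [Countable ι] {t t' : ∀ i, Set (X i)}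
    (ht : ∀ i, MeasurableSet (t i)) (ht' : ∀ i, MeasurableSet (t' i)) {w : ι → ℝ} {W : ℝ}
    (hW : HasSum w W)
    (h : ∀ i, ν i (t' i) = ENNReal.ofReal (Real.exp (-w i)) * ν i (t i)) :
    Measure.infinitePi ν (Set.univ.pi t') =
      ENNReal.ofReal (Real.exp (-W)) * Measure.infinitePi ν (Set.univ.pi t) := by
  -- Finite products of probabilities decrease to the infinite product, so an identity between
  -- finite products passes to the limit.
  have key : ∀ {t : ∀ i, Set (X i)}, (∀ i, MeasurableSet (t i)) →
      Filter.Tendsto (fun s : Finset ι => ∏ i ∈ s, ν i (t i)) Filter.atTop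
        (nhds (Measure.infinitePi ν (Set.univ.pi t))) := fun {t} ht => by
    rw [Measure.infinitePi_pi_univ _ ht, ENNReal.tprod_eq_iInf_prod (by simp [prob_le_one])]
    exact tendsto_atTop_iInf (Finset.prod_anti_set_of_le_one' (by simp [prob_le_one]))
  refine tendsto_nhds_unique (key ht') ?_
  have e : (fun s : Finset ι => ∏ i ∈ s, ν i (t' i)) = fun s =>
      ENNReal.ofReal (Real.exp (-∑ i ∈ s, w i)) * ∏ i ∈ s, ν i (t i) := by
    funext s
    rw [Finset.prod_congr rfl fun i _ => h i, Finset.prod_mul_distrib, ← Finset.sum_neg_distrib,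
      Real.exp_sum, ENNReal.ofReal_prod_of_nonneg fun i _ => (Real.exp_pos _).le]
  rw [e]
  refine ENNReal.Tendsto.mul ?_ (Or.inr (measure_ne_top _ _)) (key ht) (Or.inr ENNReal.ofReal_ne_top)
  exact ENNReal.tendsto_ofReal ((Real.continuous_exp.tendsto _).comp (hW.neg.congr
    fun s => by simp))

end InfiniteProducts

/-! ### Exponential clocks -/

section Clocks

theorem lintegral_expMeasure {μ : ℝ} {f : ℝ → ℝ≥0∞} (hf : Measurable f) :
    ∫⁻ x, f x ∂expMeasure μ =
      ∫⁻ x in Set.Ioi 0, ENNReal.ofReal (μ * Real.exp (-(μ * x))) * f x := by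
  have hpdf : Measurable (exponentialPDF μ) :=
    (measurable_exponentialPDFReal μ).ennreal_ofReal
  have : expMeasure μ = volume.withDensity (exponentialPDF μ) := rfl
  rw [this, lintegral_withDensity_eq_lintegral_mul _ hpdf hf, ← lintegral_indicator measurableSet_Ioi]
  refine lintegral_congr_ae ?_
  filter_upwards [Measure.ae_ne volume (0 : ℝ)] with x hx
  rcases lt_or_gt_of_ne hx with h | h
  · simp [exponentialPDF_of_neg h, h.le]
  · simp [exponentialPDF_of_nonneg h.le, h]

/-- Translation by `c` in Lebesgue measure, and `exp (-μ (x + c)) = exp (-μ c) * exp (-μ x)`. The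
condition `c < x` becomes exactly the support `0 < x` of the density. -/
theorem expMeasure_memoryless {μ c : ℝ} (hc : 0 ≤ c) {A : Set ℝ} (hA : MeasurableSet A) :
    expMeasure μ {x | c < x ∧ x - c ∈ A} =
      ENNReal.ofReal (Real.exp (-(μ * c))) * expMeasure μ A := by
  have hB : MeasurableSet {x : ℝ | c < x ∧ x - c ∈ A} :=
    measurableSet_Ioi.inter ((measurable_id.sub_const c) hA)
  rw [← lintegral_indicator_one hB, ← lintegral_indicator_one hA,
    lintegral_expMeasure (measurable_one.indicator hB),
    lintegral_expMeasure (measurable_one.indicator hA),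
    ← lintegral_const_mul _ (by
      refine Measurable.mul (by fun_prop) (measurable_one.indicator hA)),
    ← lintegral_indicator measurableSet_Ioi, ← lintegral_indicator measurableSet_Ioi,
    ← lintegral_add_right_eq_self _ c]
  refine lintegral_congr fun x => ?_
  by_cases hx : 0 < x
  · have h1 : 0 < x + c := by linarith
    by_cases hxA : x ∈ A
    · simp only [Set.indicator, Set.mem_Ioi, h1, if_true, hx, Set.mem_ofPred_eq,
        lt_add_iff_pos_left, add_sub_cancel_right, hxA, and_self, Pi.one_apply, mul_one]
      rw [← ENNReal.ofReal_mul (Real.exp_pos _).le, mul_add, neg_add, Real.exp_add]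
      congr 1; ring
    · simp [Set.indicator, hxA]
  · simp [Set.indicator, hx]

theorem expMeasure_Iic_zero {μ : ℝ} : expMeasure μ (Set.Iic 0) = 0 := by
  rw [← lintegral_indicator_one measurableSet_Iic,
    lintegral_expMeasure (measurable_one.indicator measurableSet_Iic)]
  refine (setLIntegral_congr_fun measurableSet_Ioi (g := fun _ => 0) fun x hx => ?_).trans
    (by simp)
  have : ¬ x ≤ 0 := not_le.2 hx
  simp [this]

theorem expMeasure_Ioi {μ c : ℝ} (hμ : 0 < μ) (hc : 0 ≤ c) :
    expMeasure μ (Set.Ioi c) = ENNReal.ofReal (Real.exp (-(μ * c))) := by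
  have := isProbabilityMeasure_expMeasure hμ
  have := expMeasure_memoryless (μ := μ) hc MeasurableSet.univ
  simpa [Set.Ioi] using this

instance isProbabilityMeasure_expMeasure_of_fact {μ : ℝ} [hμ : Fact (0 < μ)] :
    IsProbabilityMeasure (expMeasure μ) :=
  isProbabilityMeasure_expMeasure hμ.out

/-- A sequence of transmission times and error marks. -/
abbrev Clock := ℕ → ℝ × Bool

/-- The current transmission time of a clock. -/
def Clock.head (y : Clock) : ℝ := (y 0).1

/-- The clock after the end of the current transmission. -/
def Clock.tail (y : Clock) : Clock := fun j => y (j + 1)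

/-- The clock after the current transmission has received an amount `c` of transmission time. -/
def Clock.resid (c : ℝ≥0∞) (y : Clock) : Clock :=
  Function.update y 0 ((y 0).1 - c.toReal, (y 0).2)

theorem Clock.measurable_head : Measurable Clock.head :=
  measurable_fst.comp (measurable_pi_apply 0)

theorem Clock.measurable_tail : Measurable Clock.tail :=
  measurable_pi_iff.2 fun j => measurable_pi_apply (j + 1)

theorem Clock.measurable_resid : Measurable fun z : ℝ≥0∞ × Clock => z.2.resid z.1 := by
  refine measurable_pi_iff.2 fun j => ?_
  unfold Clock.resid
  rcases j with _ | j
  · simp only [Function.update_self]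
    fun_prop
  · simp only [Function.update_of_ne (Nat.succ_ne_zero j)]
    fun_prop

variable (μ : ℝ) (β : Measure Bool)

/-- I.i.d. exponential transmission times and i.i.d. errors. -/
def clockLaw : Measure Clock := Measure.infinitePi fun _ : ℕ => (expMeasure μ).prod β

variable [Fact (0 < μ)] [IsProbabilityMeasure β]

instance : IsProbabilityMeasure (clockLaw μ β) := by unfold clockLaw; infer_instance

/-- When a transmission ends, the clock starts afresh: the remaining sequence is independent of what
has just been used and is a shift of an i.i.d. sequence. -/
theorem clockLaw_renewal :
    (clockLaw μ β).map (fun y => (y 0, y.tail)) = ((expMeasure μ).prod β).prod (clockLaw μ β) := by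
  symm
  have hm : Measurable fun y : Clock => (y 0, y.tail) :=
    (measurable_pi_apply 0).prodMk Clock.measurable_tail
  refine Measure.prod_eq fun A B hA hB => ?_
  set ν := (clockLaw μ β).map (fun y => (y 0, y.tail))
  set ν' : Measure Clock := (ν.restrict (A ×ˢ Set.univ)).map Prod.snd with hν'
  have hν : ∀ B, MeasurableSet B → ν' B = ν (A ×ˢ B) := fun B hB => by
    rw [hν', Measure.map_apply measurable_snd hB, Measure.restrict_apply (measurable_snd hB)]
    congr 1
    ext; simp [and_comm]
  have : IsProbabilityMeasure ν := Measure.isProbabilityMeasure_map hm.aemeasurable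
  rw [← hν B hB]
  suffices h : ν' = ((expMeasure μ).prod β) A • clockLaw μ β by rw [h]; simp
  refine eq_smul_infinitePi_of_univ fun t ht => ?_
  have hB := MeasurableSet.univ_pi ht
  rw [hν _ hB, Measure.map_apply hm (hA.prod hB)]
  let t' : ℕ → Set (ℝ × Bool) := fun j => Nat.casesOn j A t
  have ht' : ∀ j, MeasurableSet (t' j) := fun j => by
    rcases j with _ | j
    exacts [hA, ht j]
  have e : (fun y : Clock => (y 0, y.tail)) ⁻¹' A ×ˢ Set.univ.pi t = Set.univ.pi t' := by
    ext y
    simp only [Set.mem_preimage, Set.mem_prod, Set.mem_pi, Set.mem_univ, true_implies]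
    constructor
    · rintro ⟨h0, h1⟩ (_ | j)
      exacts [h0, h1 j]
    · exact fun h => ⟨h 0, fun j => h (j + 1)⟩
  rw [e, clockLaw, infinitePi_univ_pi_split 0 ht']
  congr 1
  have hshift := Measure.map_infinitePi_infinitePi_of_inj
    (P := fun _ : ℕ => (expMeasure μ).prod β) Nat.succ_injective
  conv_rhs => rw [← hshift]
  rw [show (fun (ω : Clock) i => ω (Nat.succ i)) = Clock.tail from rfl,
    Measure.map_apply Clock.measurable_tail hB]
  congr 1
  ext y
  simp only [Set.mem_pi, Set.mem_univ, true_implies, Set.mem_preimage]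
  constructor
  · intro h j
    simpa [t', Function.update_of_ne, Clock.tail] using h (j + 1)
  · rintro h (_ | j)
    · simp
    · simpa [t', Function.update_of_ne, Clock.tail] using h j

/-- Only coordinate `0` of the clock is affected by ageing, and there it is `expMeasure_memoryless`
for each value of the error mark. Service amounts are extended nonnegative numbers, whence the type
of `c`. -/
theorem clockLaw_memoryless {c : ℝ≥0∞} (hc : c ≠ ⊤) {B : Set Clock} (hB : MeasurableSet B) :
    clockLaw μ β {y | c < ENNReal.ofReal y.head ∧ y.resid c ∈ B} =
      ENNReal.ofReal (Real.exp (-(μ * c.toReal))) * clockLaw μ β B := by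
  have hmr : Measurable (Clock.resid c) := Clock.measurable_resid.comp (measurable_const.prodMk measurable_id)
  have hC : MeasurableSet {y : Clock | c < ENNReal.ofReal y.head} :=
    measurableSet_lt measurable_const Clock.measurable_head.ennreal_ofReal
  set ν' : Measure Clock := ((clockLaw μ β).restrict {y | c < ENNReal.ofReal y.head}).map
    (Clock.resid c) with hν'
  have hν : ∀ B, MeasurableSet B → ν' B =
      clockLaw μ β {y | c < ENNReal.ofReal y.head ∧ y.resid c ∈ B} := fun B hB => by
    rw [hν', Measure.map_apply hmr hB, Measure.restrict_apply (hmr hB)]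
    congr 1
    ext; simp [and_comm]
  rw [← hν B hB]
  suffices h : ν' = ENNReal.ofReal (Real.exp (-(μ * c.toReal))) • clockLaw μ β by rw [h]; simp
  refine eq_smul_infinitePi_of_univ fun t ht => ?_
  rw [hν _ (MeasurableSet.univ_pi ht)]
  let A : Set (ℝ × Bool) := {z | c.toReal < z.1 ∧ (z.1 - c.toReal, z.2) ∈ t 0}
  have hA : MeasurableSet A :=
    (measurableSet_lt measurable_const measurable_fst).inter
      (((measurable_fst.sub_const _).prodMk measurable_snd) (ht 0))
  have hA' : MeasurableSet A := hA
  have ht' : ∀ j, MeasurableSet (Function.update t 0 A j) := fun j => by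
    rcases j with _ | j
    · simpa using hA
    · simpa using ht (j + 1)
  have e : {y : Clock | c < ENNReal.ofReal y.head ∧ y.resid c ∈ Set.univ.pi t} =
      Set.univ.pi (Function.update t 0 A) := by
    ext y
    simp only [Set.mem_ofPred_eq, Set.mem_pi, Set.mem_univ, true_implies,
      ENNReal.lt_ofReal_iff_toReal_lt hc]
    constructor
    · rintro ⟨h0, h1⟩ (_ | j)
      · simpa [A] using ⟨h0, by simpa [Clock.resid] using h1 0⟩
      · simpa [Clock.resid] using h1 (j + 1)
    · intro h
      have h0 : y 0 ∈ A := by simpa using h 0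
      refine ⟨h0.1, ?_⟩
      rintro (_ | j)
      · simpa [Clock.resid] using h0.2
      · simpa [Clock.resid] using h (j + 1)
  rw [e, clockLaw, infinitePi_univ_pi_split 0 ht', infinitePi_univ_pi_split 0 ht, ← mul_assoc]
  congr 1
  · simp only [Function.update_self]
    rw [Measure.prod_apply_symm hA', Measure.prod_apply_symm (ht 0), ← lintegral_const_mul _ (measurable_measure_prodMk_right (ht 0))]
    refine lintegral_congr fun b => ?_
    rw [← expMeasure_memoryless ENNReal.toReal_nonneg (measurable_prodMk_right (ht 0))]
    rfl
  · simp

theorem clockLaw_head_pos : ∀ᵐ y ∂clockLaw μ β, 0 < y.head := by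
  have h : (clockLaw μ β).map Clock.head = expMeasure μ := by
    have h1 := (measurePreserving_eval_infinitePi (fun _ : ℕ => (expMeasure μ).prod β) (0 : ℕ)).map_eq
    have : Clock.head = Prod.fst ∘ (Function.eval 0 : Clock → ℝ × Bool) := rfl
    rw [this, ← Measure.map_map measurable_fst (measurable_pi_apply 0), clockLaw, h1,
      Measure.map_fst_prod, measure_univ, one_smul]
  rw [ae_iff]
  have : {y : Clock | ¬ 0 < y.head} = Clock.head ⁻¹' Set.Iic 0 := by ext; simp
  rw [this, ← Measure.map_apply Clock.measurable_head measurableSet_Iic, h,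
    expMeasure_Iic_zero]

end Clocks

/-! ### Service received under an assignment of the servers -/

section Service

variable {ι : Type*} {M : ℕ}

/-- The amount of service that item `i` has received by time `t`, if server `m` serves item
`a s m` at time `s`. -/
def serviceAmount (a : ℝ → Fin M → ι) (i : ι) (t : ℝ) : ℝ≥0∞ :=
  volume {s | 0 ≤ s ∧ s < t ∧ ∃ m, a s m = i}

/-- The first time when item `i` has received the amount `x` of service. -/
def completion (a : ℝ → Fin M → ι) (i : ι) (x : ℝ) : ℝ :=
  sInf {t | 0 ≤ t ∧ ENNReal.ofReal x ≤ serviceAmount a i t}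

variable {a : ℝ → Fin M → ι} {i : ι} {x t u v : ℝ}

theorem serviceAmount_mono (h : u ≤ v) : serviceAmount a i u ≤ serviceAmount a i v :=
  measure_mono fun _ hs => ⟨hs.1, hs.2.1.trans_le h, hs.2.2⟩

theorem serviceAmount_add (h : u ≤ v) :
    serviceAmount a i v =
      serviceAmount a i u + volume {s | 0 ≤ s ∧ u ≤ s ∧ s < v ∧ ∃ m, a s m = i} := by
  unfold serviceAmount
  rw [← measure_inter_add_sdiff {s | 0 ≤ s ∧ s < v ∧ ∃ m, a s m = i} (measurableSet_Iio (a := u))]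
  congr 2
  · ext s
    simp only [Set.mem_inter_iff, Set.mem_ofPred_eq, Set.mem_Iio]
    constructor
    · rintro ⟨⟨h0, _, h2⟩, h3⟩
      exact ⟨h0, h3, h2⟩
    · rintro ⟨h0, h1, h2⟩
      exact ⟨⟨h0, h1.trans_le h, h2⟩, h1⟩
  · ext s
    simp only [Set.mem_sdiff, Set.mem_ofPred_eq, Set.mem_Iio, not_lt]
    tauto

/-- An item accrues service at rate at most one, so its service is a continuous function of time. -/
theorem serviceAmount_le_add (h : u ≤ v) :
    serviceAmount a i v ≤ serviceAmount a i u + ENNReal.ofReal (v - u) := by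
  rw [serviceAmount_add h, ← Real.volume_Ico]
  gcongr
  exact fun s hs => ⟨hs.2.1, hs.2.2.1⟩

theorem serviceAmount_of_nonpos (h : t ≤ 0) : serviceAmount a i t = 0 := by
  have : {s | 0 ≤ s ∧ s < t ∧ ∃ m, a s m = i} = ∅ := by
    ext s; simp only [Set.mem_ofPred_eq, Set.mem_empty_iff_false, iff_false]; rintro ⟨h0, h1, _⟩
    linarith
  rw [serviceAmount, this, measure_empty]

theorem serviceAmount_ne_top : serviceAmount a i t ≠ ⊤ := by
  refine ((measure_mono (t := Set.Ico 0 t) fun s hs => ⟨hs.1, hs.2.1⟩).trans_lt ?_).ne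
  exact measure_Ico_lt_top

theorem completion_nonneg : 0 ≤ completion a i x :=
  Real.sInf_nonneg fun _ h => h.1

theorem completion_le (h0 : 0 ≤ t) (h : ENNReal.ofReal x ≤ serviceAmount a i t) :
    completion a i x ≤ t :=
  csInf_le ⟨0, fun _ h => h.1⟩ ⟨h0, h⟩

theorem lt_of_lt_completion (h : t < completion a i x) (h0 : 0 ≤ t) :
    serviceAmount a i t < ENNReal.ofReal x := by
  by_contra hh
  exact absurd (completion_le h0 (not_lt.1 hh)) (not_le.2 h)

/-- By continuity of the amount of service, the infimum in `completion` is attained, and with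
equality. The hypothesis at `t` guarantees that the infimum is over a nonempty set. -/
theorem serviceAmount_completion (h0 : 0 ≤ t) (h : ENNReal.ofReal x ≤ serviceAmount a i t) :
    serviceAmount a i (completion a i x) = ENNReal.ofReal x := by
  refine le_antisymm ?_ ?_
  · rcases completion_nonneg (a := a) (i := i) (x := x) |>.eq_or_lt with hq | hq
    · rw [← hq, serviceAmount_of_nonpos le_rfl]; exact zero_le
    · refine ENNReal.le_of_forall_pos_le_add fun ε hε _ => ?_
      set u := max 0 (completion a i x - ε)
      have hu : u < completion a i x := max_lt hq (by simpa using hε)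
      refine (serviceAmount_le_add hu.le).trans
        (add_le_add (lt_of_lt_completion hu (le_max_left _ _)).le ?_)
      refine ENNReal.ofReal_le_of_le_toReal ?_
      have := le_max_right 0 (completion a i x - ε)
      simp only [ENNReal.coe_toReal]; linarith
  · refine ENNReal.le_of_forall_pos_le_add fun ε hε _ => ?_
    obtain ⟨v, hv, hvε⟩ := exists_lt_of_csInf_lt (s := {t | 0 ≤ t ∧ ENNReal.ofReal x ≤
      serviceAmount a i t}) ⟨t, h0, h⟩ (b := completion a i x + ε)
      (lt_add_of_pos_right (completion a i x) (by exact_mod_cast hε))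
    refine hv.2.trans ((serviceAmount_le_add (completion_le hv.1 hv.2)).trans ?_)
    gcongr
    refine ENNReal.ofReal_le_of_le_toReal ?_
    simp only [ENNReal.coe_toReal]; linarith

/-- The hypothesis `h` encodes that the amount `x` is ever received. Otherwise `completion` is the
infimum of the empty set, which is `0`, and at time `0` no service has been received. -/
theorem completion_le_iff (hx : 0 < x)
    (h : serviceAmount a i (completion a i x) = ENNReal.ofReal x) :
    completion a i x ≤ t ↔ ENNReal.ofReal x ≤ serviceAmount a i t := by
  refine ⟨fun ht => h ▸ serviceAmount_mono ht, fun ht => ?_⟩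
  rcases le_or_gt 0 t with h0 | h0
  · exact completion_le h0 ht
  · rw [serviceAmount_of_nonpos h0.le] at ht
    simp [hx.not_ge] at ht

section Measurability

variable {X : Type*} [MeasurableSpace X] {a : X → ℝ → Fin M → ι}

theorem measurable_serviceAmount (ha : ∀ m i, MeasurableSet {z : X × ℝ | a z.1 z.2 m = i})
    (i : ι) : Measurable fun z : X × ℝ => serviceAmount (a z.1) i z.2 := by
  have hs : MeasurableSet {z : (X × ℝ) × ℝ | 0 ≤ z.2 ∧ z.2 < z.1.2 ∧ ∃ m, a z.1.1 z.2 m = i} := by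
    refine (measurableSet_le measurable_const measurable_snd).inter
      ((measurableSet_lt measurable_snd (measurable_snd.comp measurable_fst)).inter ?_)
    have : {z : (X × ℝ) × ℝ | ∃ m, a z.1.1 z.2 m = i} =
        ⋃ m, (fun z : (X × ℝ) × ℝ => (z.1.1, z.2)) ⁻¹' {z : X × ℝ | a z.1 z.2 m = i} := by
      ext; simp
    show MeasurableSet {z : (X × ℝ) × ℝ | ∃ m, a z.1.1 z.2 m = i}
    rw [this]
    exact MeasurableSet.iUnion fun m => (by fun_prop :
      Measurable fun z : (X × ℝ) × ℝ => (z.1.1, z.2)) (ha m i)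
  exact measurable_measure_prodMk_left hs

theorem measurable_completion (ha : ∀ m i, MeasurableSet {z : X × ℝ | a z.1 z.2 m = i})
    (i : ι) : Measurable fun z : X × ℝ => completion (a z.1) i z.2 := by
  refine measurable_of_Iic fun t => ?_
  rcases lt_or_ge t 0 with h0 | h0
  · have : (fun z : X × ℝ => completion (a z.1) i z.2) ⁻¹' Set.Iic t = ∅ := by
      ext z
      simpa using h0.trans_le completion_nonneg
    simp [this]
  · have hw : ∀ t : ℝ, Measurable fun z : X × ℝ => serviceAmount (a z.1) i t := fun t =>
      (measurable_serviceAmount ha i).comp (measurable_fst.prodMk measurable_const)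
    -- Either the amount is received by time `t`, or it is never received and `completion` has its
    -- default value `0`.
    have : (fun z : X × ℝ => completion (a z.1) i z.2) ⁻¹' Set.Iic t =
        {z | ENNReal.ofReal z.2 ≤ serviceAmount (a z.1) i t} ∪
          ⋂ n : ℕ, {z | serviceAmount (a z.1) i n < ENNReal.ofReal z.2} := by
      ext z
      simp only [Set.mem_preimage, Set.mem_Iic, Set.mem_union, Set.mem_ofPred_eq, Set.mem_iInter]
      constructor
      · intro h
        by_contra! hh
        obtain ⟨hh1, n, hn⟩ := hh
        have := serviceAmount_completion n.cast_nonneg hn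
        exact (this ▸ serviceAmount_mono h).not_gt hh1
      · rintro (h | h)
        · exact completion_le h0 h
        · have : {t | 0 ≤ t ∧ ENNReal.ofReal z.2 ≤ serviceAmount (a z.1) i t} = ∅ := by
            ext s
            simp only [Set.mem_ofPred_eq, Set.mem_empty_iff_false, iff_false, not_and, not_le]
            intro _
            obtain ⟨n, hn⟩ := exists_nat_ge s
            exact (serviceAmount_mono hn).trans_lt (h n)
          rw [completion, this, Real.sInf_empty]
          exact h0
    rw [this]
    exact (measurableSet_le measurable_snd.ennreal_ofReal (hw t)).union
      (MeasurableSet.iInter fun n => measurableSet_lt (hw n) measurable_snd.ennreal_ofReal)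

end Measurability

theorem measurable_serviceAmount' (ha : ∀ m i, MeasurableSet {s | a s m = i}) (i : ι) :
    Measurable fun t => serviceAmount a i t :=
  (measurable_serviceAmount (X := Unit) (a := fun _ => a)
    (fun m i => measurable_snd (ha m i)) i).comp (measurable_prodMk_left (x := ()))

theorem measurable_completion' (ha : ∀ m i, MeasurableSet {s | a s m = i}) (i : ι) :
    Measurable fun t => completion a i t :=
  (measurable_completion (X := Unit) (a := fun _ => a)
    (fun m i => measurable_snd (ha m i)) i).comp (measurable_prodMk_left (x := ()))

/-- The change of variables from the amount of service to time. -/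
theorem map_completion (ha : ∀ m i, MeasurableSet {s | a s m = i}) (i : ι) :
    (volume.restrict {x | 0 < x ∧ serviceAmount a i (completion a i x) = ENNReal.ofReal x}).map
      (completion a i) = volume.restrict {s | 0 ≤ s ∧ ∃ m, a s m = i} := by
  symm
  have hQ := measurable_completion' ha i
  refine Measure.ext_of_Ioc _ _ fun u v huv => ?_
  rw [Measure.map_apply hQ measurableSet_Ioc, Measure.restrict_apply measurableSet_Ioc,
    Measure.restrict_apply (hQ measurableSet_Ioc)]
  -- `completion` is the generalized inverse of `serviceAmount`, so the preimage is the interval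
  -- between the amounts at `u` and at `v`; its length is the time spent serving `i` between `u` and
  -- `v`.
  have e : completion a i ⁻¹' Set.Ioc u v ∩
      {x | 0 < x ∧ serviceAmount a i (completion a i x) = ENNReal.ofReal x} =
      Set.Ioc (serviceAmount a i u).toReal (serviceAmount a i v).toReal := by
    ext x
    simp only [Set.mem_inter_iff, Set.mem_preimage, Set.mem_Ioc, Set.mem_ofPred_eq]
    constructor
    · rintro ⟨⟨h1, h2⟩, hx, hc⟩
      rw [completion_le_iff hx hc, ENNReal.ofReal_le_iff_le_toReal serviceAmount_ne_top] at h2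
      rw [← not_le, completion_le_iff hx hc,
        ENNReal.ofReal_le_iff_le_toReal serviceAmount_ne_top] at h1
      exact ⟨not_le.1 h1, h2⟩
    · rintro ⟨h1, h2⟩
      have hx : 0 < x := ENNReal.toReal_nonneg.trans_lt h1
      have h2' := (ENNReal.ofReal_le_iff_le_toReal (serviceAmount_ne_top (a := a) (i := i))).2 h2
      have hv : 0 ≤ v := by
        by_contra! hv
        rw [serviceAmount_of_nonpos hv.le] at h2'
        simp [hx.not_ge] at h2'
      have hc := serviceAmount_completion hv h2'
      refine ⟨⟨?_, (completion_le_iff hx hc).2 h2'⟩, hx, hc⟩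
      rw [← not_le, completion_le_iff hx hc,
        ENNReal.ofReal_le_iff_le_toReal serviceAmount_ne_top]
      exact not_le.2 h1
  rw [e, Real.volume_Ioc, ENNReal.ofReal_sub _ ENNReal.toReal_nonneg,
    ENNReal.ofReal_toReal serviceAmount_ne_top, ENNReal.ofReal_toReal serviceAmount_ne_top,
    serviceAmount_add huv.le, ENNReal.add_sub_cancel_left serviceAmount_ne_top]
  have : {s | 0 ≤ s ∧ u ≤ s ∧ s < v ∧ ∃ m, a s m = i} =
      {s | 0 ≤ s ∧ ∃ m, a s m = i} ∩ Set.Ico u v := by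
    ext; simp only [Set.mem_ofPred_eq, Set.mem_inter_iff, Set.mem_Ico]; tauto
  rw [this, Set.inter_comm]
  exact measure_congr ((Filter.EventuallyEq.refl _ _).inter Ico_ae_eq_Ioc.symm)

/-- At every time exactly `M` distinct items are in service. This identity is the source of the
total rate `M * μ`. -/
theorem tsum_serviceAmount [Countable ι] (ha : ∀ m i, MeasurableSet {s | a s m = i})
    (hinj : ∀ s, Function.Injective (a s)) :
    ∑' i, serviceAmount a i t = ENNReal.ofReal (M * t) := by
  have h1 : ∀ i, serviceAmount a i t = ∑ m, volume (Set.Ico 0 t ∩ {s | a s m = i}) := fun i => by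
    rw [← measure_biUnion_finset]
    · unfold serviceAmount; congr 1; ext s; simp [and_assoc]
    · intro m _ m' _ hmm
      refine Set.disjoint_left.2 fun s hs hs' => hmm (hinj s ?_)
      exact hs.2.trans hs'.2.symm
    · exact fun m _ => measurableSet_Ico.inter (ha m i)
  have h2 : ∀ m, ∑' i, volume (Set.Ico 0 t ∩ {s | a s m = i}) = ENNReal.ofReal t := fun m => by
    rw [← measure_iUnion]
    · rw [← Set.inter_iUnion]
      have : ⋃ i, {s | a s m = i} = Set.univ := by ext; simp
      rw [this, Set.inter_univ, Real.volume_Ico, sub_zero]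
    · intro i j hij
      exact Set.disjoint_left.2 fun s hs hs' => hij (hs.2.symm.trans hs'.2)
    · exact fun i => measurableSet_Ico.inter (ha m i)
  simp_rw [h1]
  rw [Summable.tsum_finsetSum fun _ _ => ENNReal.summable]
  simp_rw [h2]
  simp [ENNReal.ofReal_mul]

end Service

/-! ### The first completion under a fixed assignment of the servers -/

section OneStep

variable {ι : Type*} {M : ℕ}

/-- At the first completion, server `m` completes item `i`. -/
def CompletesFirst (a : ℝ → Fin M → ι) (ξ : ι → Clock) (i : ι) (m : Fin M) : Prop :=
  0 < (ξ i).head ∧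
    serviceAmount a i (completion a i (ξ i).head) = ENNReal.ofReal (ξ i).head ∧
    a (completion a i (ξ i).head) m = i ∧
    ∀ j ≠ i, serviceAmount a j (completion a i (ξ i).head) < ENNReal.ofReal (ξ j).head

open Classical in
/-- The clocks just after item `i` has been completed at time `t`. -/
def residualClocks (a : ℝ → Fin M → ι) (i : ι) (t : ℝ) (ξ : ι → Clock) : ι → Clock :=
  fun j => if j = i then (ξ i).tail else (ξ j).resid (serviceAmount a j t)

/-- The law of the time until the next event, its server, and its error mark. -/
def eventLaw (μ : ℝ) (β : Measure Bool) (M : ℕ) : Measure (ℝ × Fin M × Bool) :=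
  (expMeasure (M * μ)).prod (((M : ℝ≥0∞)⁻¹ • Measure.count).prod β)

/-- The law of the clocks of all items. -/
def clocksLaw (ι : Type*) (μ : ℝ) (β : Measure Bool) : Measure (ι → Clock) :=
  Measure.infinitePi fun _ : ι => clockLaw μ β

variable {μ : ℝ} {β : Measure Bool} [Fact (0 < μ)] [IsProbabilityMeasure β]

instance : IsProbabilityMeasure (clocksLaw ι μ β) := by unfold clocksLaw; infer_instance

instance [NeZero M] : Fact (0 < (M : ℝ) * μ) :=
  ⟨mul_pos (Nat.cast_pos.2 (NeZero.pos M)) Fact.out⟩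

instance [NeZero M] : IsProbabilityMeasure ((M : ℝ≥0∞)⁻¹ • (Measure.count : Measure (Fin M))) :=
  ⟨by simp [Measure.count_univ, ENNReal.inv_mul_cancel, NeZero.ne]⟩

instance [NeZero M] : IsProbabilityMeasure (eventLaw μ β M) := by unfold eventLaw; infer_instance

section Measurability

variable {X : Type*} [MeasurableSpace X] {a : X → ℝ → Fin M → ι}

theorem measurable_head_apply (i : ι) : Measurable fun z : X × (ι → Clock) => (z.2 i).head :=
  Clock.measurable_head.comp (by fun_prop)

theorem measurable_completion_head (ha : ∀ m i, MeasurableSet {z : X × ℝ | a z.1 z.2 m = i})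
    (i : ι) :
    Measurable fun z : X × (ι → Clock) => completion (a z.1) i (z.2 i).head :=
  have h := (measurable_completion ha i).comp (measurable_fst.prodMk (measurable_head_apply i))
  h

theorem measurableSet_completesFirst [Countable ι]
    (ha : ∀ m i, MeasurableSet {z : X × ℝ | a z.1 z.2 m = i}) (i : ι) (m : Fin M) :
    MeasurableSet {z : X × (ι → Clock) | CompletesFirst (a z.1) z.2 i m} := by
  have hQ := measurable_completion_head ha i
  have hh := measurable_head_apply (X := X) (ι := ι)
  have hw : ∀ j, Measurable fun z : X × (ι → Clock) =>
      serviceAmount (a z.1) j (completion (a z.1) i (z.2 i).head) := fun j => by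
    have h := (measurable_serviceAmount ha j).comp (measurable_fst.prodMk hQ)
    exact h
  refine (measurableSet_lt measurable_const (hh i)).inter
    ((measurableSet_eq_fun (hw i) (hh i).ennreal_ofReal).inter
      (((measurable_fst.prodMk hQ) (ha m i)).inter ?_))
  have : {z : X × (ι → Clock) | ∀ j ≠ i, serviceAmount (a z.1) j
      (completion (a z.1) i (z.2 i).head) < ENNReal.ofReal (z.2 j).head} =
      ⋂ j, ⋂ (_ : j ≠ i), {z | serviceAmount (a z.1) j
      (completion (a z.1) i (z.2 i).head) < ENNReal.ofReal (z.2 j).head} := by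
    ext; simp
  change MeasurableSet {z : X × (ι → Clock) | ∀ j ≠ i, serviceAmount (a z.1) j
      (completion (a z.1) i (z.2 i).head) < ENNReal.ofReal (z.2 j).head}
  rw [this]
  exact MeasurableSet.iInter fun j => MeasurableSet.iInter fun _ =>
    measurableSet_lt (hw j) (hh j).ennreal_ofReal

theorem measurable_residualClocks
    (ha : ∀ m i, MeasurableSet {z : X × ℝ | a z.1 z.2 m = i}) (i : ι) :
    Measurable fun z : X × (ι → Clock) =>
      residualClocks (a z.1) i (completion (a z.1) i (z.2 i).head) z.2 := by
  refine measurable_pi_iff.2 fun j => ?_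
  unfold residualClocks
  split_ifs with h
  · exact Clock.measurable_tail.comp (by fun_prop)
  · have h := (measurable_serviceAmount ha j).comp
      (measurable_fst.prodMk (measurable_completion_head ha i))
    exact Clock.measurable_resid.comp (h.prodMk (by fun_prop))

end Measurability

variable {a : ℝ → Fin M → ι}

/-- The strict inequalities in `CompletesFirst` would make each of two such items complete strictly
before the other. -/
theorem CompletesFirst.unique (hinj : ∀ s, Function.Injective (a s)) {ξ : ι → Clock} {i i' : ι}
    {m m' : Fin M} (h : CompletesFirst a ξ i m) (h' : CompletesFirst a ξ i' m') :
    i = i' ∧ m = m' := by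
  have hi : i = i' := by
    by_contra hne
    have h1 := h.2.2.2 i' (Ne.symm hne)
    have h2 := h'.2.2.2 i hne
    rw [← h'.2.1] at h1
    rw [← h.2.1] at h2
    rcases le_total (completion a i (ξ i).head) (completion a i' (ξ i').head) with hle | hle
    · exact h2.not_ge (serviceAmount_mono hle)
    · exact h1.not_ge (serviceAmount_mono hle)
  subst hi
  exact ⟨rfl, hinj _ (h.2.2.1.trans h'.2.2.1.symm)⟩

theorem lintegral_completion {ha : ∀ m i, MeasurableSet {s | a s m = i}} (i : ι)
    {f : ℝ → ℝ≥0∞} (hf : Measurable f) :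
    ∫⁻ x in {x | 0 < x ∧ serviceAmount a i (completion a i x) = ENNReal.ofReal x},
      f (completion a i x) = ∫⁻ s in {s | 0 ≤ s ∧ ∃ m, a s m = i}, f s := by
  rw [← map_completion ha i, lintegral_map hf (measurable_completion' ha i)]

variable [Countable ι]

/-- The probability that server `m` completes item `i` first, with a given event and residual
clocks in a given box. -/
theorem clocksLaw_completesFirst (ha : ∀ m i, MeasurableSet {s | a s m = i})
    (hinj : ∀ s, Function.Injective (a s)) (i : ι) (m : Fin M)
    {S : Set (ℝ × Fin M × Bool)} (hS : MeasurableSet S) {t : ι → Set Clock}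
    (ht : ∀ j, MeasurableSet (t j)) :
    clocksLaw ι μ β {ξ | CompletesFirst a ξ i m ∧
        (completion a i (ξ i).head, m, (ξ i 0).2) ∈ S ∧
        residualClocks a i (completion a i (ξ i).head) ξ ∈ Set.univ.pi t} =
      (∫⁻ s in {s | 0 ≤ s ∧ a s m = i}, ENNReal.ofReal (μ * Real.exp (-(M * μ * s))) *
        β {b | (s, m, b) ∈ S}) * clocksLaw ι μ β (Set.univ.pi t) := by
  classical
  have hQ := measurable_completion' ha i
  have hw := measurable_serviceAmount' ha
  set D := {ξ : ι → Clock | CompletesFirst a ξ i m ∧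
        (completion a i (ξ i).head, m, (ξ i 0).2) ∈ S ∧
        residualClocks a i (completion a i (ξ i).head) ξ ∈ Set.univ.pi t} with hD
  have ha' : ∀ m i, MeasurableSet {z : Unit × ℝ | a z.2 m = i} := fun m i =>
    measurable_snd (ha m i)
  have hpr : Measurable fun ξ : ι → Clock => ((), ξ) := by fun_prop
  have hQ' : Measurable fun ξ : ι → Clock => completion a i (ξ i).head := by
    have h := (measurable_completion_head (X := Unit) (a := fun _ => a) ha' i).comp hpr
    exact h
  have hDm : MeasurableSet D := by
    refine ((hpr (measurableSet_completesFirst (X := Unit) (a := fun _ => a) ha' i m))).inter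
      (MeasurableSet.inter ?_ ?_)
    · exact (hQ'.prodMk (measurable_const.prodMk (by fun_prop))) hS
    · have h := (measurable_residualClocks (X := Unit) (a := fun _ => a) ha' i).comp hpr
      exact h (MeasurableSet.univ_pi ht)
  -- Resampling the clock of `i` separates it from the other clocks, which can then be integrated
  -- out first.
  have hupd := measurePreserving_update (ν := fun _ : ι => clockLaw μ β) i
  have hC : ∀ x : ℝ × Bool, MeasurableSet {b : Bool | (x.1, m, b) ∈ S} := fun x => .of_discrete
  let c : ℝ → Prop := fun x => 0 < x ∧ serviceAmount a i (completion a i x) = ENNReal.ofReal x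
  have hc : MeasurableSet {x | c x} := (measurableSet_lt measurable_const measurable_id).inter
    (measurableSet_eq_fun ((hw i).comp hQ) ENNReal.measurable_ofReal)
  -- If `i` needs the amount `x` and completes at time `Q`, the other items have received `M * Q -
  -- x` in total, and the exponential is the probability that none of them has completed.
  let G : ℝ × Bool → ℝ≥0∞ := fun z =>
    {z : ℝ × Bool | c z.1 ∧ a (completion a i z.1) m = i ∧
      (completion a i z.1, m, z.2) ∈ S}.indicator
      (fun z => ENNReal.ofReal (Real.exp (-(μ * (M * completion a i z.1 - z.1))))) z
  have hGm : Measurable G := by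
    refine Measurable.indicator (by fun_prop) ?_
    refine (measurable_fst hc).inter (MeasurableSet.inter ((hQ.comp measurable_fst) (ha m i)) ?_)
    exact (((hQ.comp measurable_fst).prodMk (measurable_const.prodMk measurable_snd)) hS)
  set C := clocksLaw ι μ β (Set.univ.pi (Function.update t i Set.univ)) with hCdef
  -- For a fixed clock `y` of item `i` the event is a box in the other clocks. Each side is a
  -- memorylessness event, so it contributes its survival probability times the measure of the
  -- target side.
  have inner : ∀ y : Clock, clocksLaw ι μ β {ξ | Function.update ξ i y ∈ D} =
      G (y 0) * (t i).indicator 1 y.tail * C := by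
    intro y
    have hresid : ∀ ξ : ι → Clock, residualClocks a i (completion a i y.head)
        (Function.update ξ i y) ∈ Set.univ.pi t ↔
        y.tail ∈ t i ∧ ∀ j ≠ i, (ξ j).resid (serviceAmount a j (completion a i y.head)) ∈ t j := by
      intro ξ
      simp only [residualClocks, Set.mem_pi, Set.mem_univ, true_implies, Function.update_self]
      constructor
      · intro h
        refine ⟨by simpa using h i, fun j hj => by simpa [hj] using h j⟩
      · rintro ⟨h1, h2⟩ j
        by_cases hj : j = i
        · subst hj; simpa using h1
        · simpa [hj] using h2 j hj
    by_cases hy : c y.head ∧ a (completion a i y.head) m = i ∧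
        (completion a i y.head, m, (y 0).2) ∈ S
    · by_cases hyt : y.tail ∈ t i
      · have e : {ξ : ι → Clock | Function.update ξ i y ∈ D} = Set.univ.pi fun j =>
            if j = i then Set.univ else {z : Clock |
              serviceAmount a j (completion a i y.head) < ENNReal.ofReal z.head ∧
              z.resid (serviceAmount a j (completion a i y.head)) ∈ t j} := by
          ext ξ
          rw [Set.mem_univ_pi]
          simp only [hD, Set.mem_ofPred_eq, Function.update_self, hresid, CompletesFirst]
          constructor
          · rintro ⟨⟨_, _, _, h1⟩, _, _, h2⟩ j
            split_ifs with hj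
            · trivial
            · exact ⟨by simpa [hj] using h1 j hj, h2 j hj⟩
          · intro h
            have h' : ∀ j, j ≠ i → (serviceAmount a j (completion a i y.head) <
              ENNReal.ofReal (ξ j).head ∧
              (ξ j).resid (serviceAmount a j (completion a i y.head)) ∈ t j) := fun j hj => by
              simpa [hj] using h j
            exact ⟨⟨hy.1.1, hy.1.2, hy.2.1, fun j hj => by simpa [hj] using (h' j hj).1⟩, hy.2.2,
              hyt, fun j hj => (h' j hj).2⟩
        have hG : G (y 0) = ENNReal.ofReal (Real.exp
            (-(μ * (M * completion a i y.head - y.head)))) :=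
          Set.indicator_of_mem (by exact hy) _
        -- All items together have received `M` times the elapsed time; the share of item `i` is
        -- exactly its head.
        have hsum : HasSum (fun j => if j = i then 0 else
            μ * (serviceAmount a j (completion a i y.head)).toReal)
            (μ * (M * completion a i y.head - y.head)) := by
          have h1 := ENNReal.hasSum_toReal (f := fun j => serviceAmount a j
            (completion a i y.head)) (by
              rw [tsum_serviceAmount ha hinj]; exact ENNReal.ofReal_ne_top)
          rw [← ENNReal.tsum_toReal_eq (fun _ => serviceAmount_ne_top), tsum_serviceAmount ha hinj,
            ENNReal.toReal_ofReal (mul_nonneg M.cast_nonneg completion_nonneg)] at h1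
          have h2 := (h1.sub (hasSum_ite_eq i y.head)).mul_left μ
          have h3 : (fun j => if j = i then 0 else
              μ * (serviceAmount a j (completion a i y.head)).toReal) = fun j => μ *
              ((serviceAmount a j (completion a i y.head)).toReal -
                if j = i then y.head else 0) := by
            funext j
            split_ifs with hj
            · subst hj
              rw [hy.1.2, ENNReal.toReal_ofReal hy.1.1.le]; ring
            · ring
          rw [h3]
          exact h2
        rw [e, hG, Set.indicator_of_mem hyt, Pi.one_apply, mul_one, hCdef, clocksLaw]
        refine infinitePi_univ_pi_exp_mul (fun j => ?_) (fun j => ?_) hsum fun j => ?_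
        · by_cases hj : j = i
          · subst hj; simp
          · simpa [hj] using ht j
        · split_ifs with hj
          · exact .univ
          · exact (measurableSet_lt measurable_const Clock.measurable_head.ennreal_ofReal).inter
              ((Clock.measurable_resid.comp (measurable_const.prodMk measurable_id)) (ht j))
        · by_cases hj : j = i
          · subst hj; simp
          · simp only [hj, if_false, Function.update_of_ne, ne_eq, not_false_eq_true]
            exact clockLaw_memoryless μ β serviceAmount_ne_top (ht j)
      · rw [Set.indicator_of_notMem hyt, mul_zero, zero_mul]
        convert measure_empty (μ := clocksLaw ι μ β)
        ext ξ
        simp only [hD, Set.mem_ofPred_eq, Function.update_self, hresid, hyt, false_and, and_false,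
          Set.mem_empty_iff_false]
    · have hG : G (y 0) = 0 := Set.indicator_of_notMem (by exact hy) _
      rw [hG, zero_mul, zero_mul]
      convert measure_empty (μ := clocksLaw ι μ β)
      ext ξ
      simp only [hD, Set.mem_ofPred_eq, Function.update_self, CompletesFirst,
          Set.mem_empty_iff_false, iff_false]
      rintro ⟨⟨h1, h2, h3, _⟩, h4, _⟩
      exact hy ⟨⟨h1, h2⟩, h3, h4⟩
  -- The density `μ * exp (-μ x)` times the survival factor is `μ * exp (-M μ Q)`, which involves
  -- `x` only through the completion time `Q`. The change of variables from service to time then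
  -- applies.
  have hGint : ∫⁻ z, G z ∂(expMeasure μ).prod β =
      ∫⁻ s in {s | 0 ≤ s ∧ a s m = i}, ENNReal.ofReal (μ * Real.exp (-(M * μ * s))) *
        β {b | (s, m, b) ∈ S} := by
    have hbm : Measurable fun s => β {b | (s, m, b) ∈ S} :=
      measurable_measure_prodMk_left (ν := β) (s := {z : ℝ × Bool | (z.1, m, z.2) ∈ S})
        ((by fun_prop : Measurable fun z : ℝ × Bool => (z.1, m, z.2)) hS)
    have hHm : Measurable ({s | a s m = i}.indicator fun s =>
        ENNReal.ofReal (μ * Real.exp (-(M * μ * s))) * β {b | (s, m, b) ∈ S}) :=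
      (Measurable.mul (by fun_prop) hbm).indicator (ha m i)
    rw [lintegral_prod _ hGm.aemeasurable, lintegral_expMeasure hGm.lintegral_prod_right']
    have h1 : ∀ x ∈ Set.Ioi (0 : ℝ), ENNReal.ofReal (μ * Real.exp (-(μ * x))) *
        ∫⁻ b, G (x, b) ∂β = {x | c x}.indicator (fun x => ({s | a s m = i}.indicator fun s =>
        ENNReal.ofReal (μ * Real.exp (-(M * μ * s))) * β {b | (s, m, b) ∈ S})
        (completion a i x)) x := by
      intro x _
      by_cases hx : c x ∧ a (completion a i x) m = i
      · have : (fun b => G (x, b)) = {b | (completion a i x, m, b) ∈ S}.indicator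
            fun _ => ENNReal.ofReal (Real.exp (-(μ * (M * completion a i x - x)))) := by
          funext b
          simp only [G, Set.indicator, Set.mem_ofPred_eq, hx, true_and]
        rw [this, lintegral_indicator_const .of_discrete, Set.indicator_of_mem (by exact hx.1),
          Set.indicator_of_mem (by exact hx.2), ← mul_assoc, ← ENNReal.ofReal_mul
          (mul_nonneg (Fact.out : 0 < μ).le (Real.exp_pos _).le), mul_assoc, ← Real.exp_add]
        congr 4; ring
      · have : (fun b => G (x, b)) = fun _ => 0 := by
          funext b
          refine Set.indicator_of_notMem ?_ _
          exact fun h => hx ⟨h.1, h.2.1⟩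
        rw [this]
        simp only [lintegral_zero, mul_zero]
        by_cases hx' : c x
        · rw [Set.indicator_of_mem (by exact hx'), Set.indicator_of_notMem]
          exact fun h => hx ⟨hx', h⟩
        · rw [Set.indicator_of_notMem (by exact hx')]
    rw [setLIntegral_congr_fun measurableSet_Ioi h1, setLIntegral_indicator hc]
    have h2 : {x | c x} ∩ Set.Ioi 0 = {x | c x} := by
      ext x; exact ⟨fun h => h.1, fun h => ⟨h, h.1⟩⟩
    rw [h2, lintegral_completion (ha := ha) i hHm, setLIntegral_indicator (ha m i)]
    congr 2
    ext s
    simp only [Set.mem_inter_iff, Set.mem_ofPred_eq]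
    exact ⟨fun h => ⟨h.2.1, h.1⟩, fun h => ⟨h.2, h.1, m, h.2⟩⟩
  calc clocksLaw ι μ β D
      = ∫⁻ y, clocksLaw ι μ β {ξ | Function.update ξ i y ∈ D} ∂clockLaw μ β := by
        conv_lhs => rw [clocksLaw, ← hupd.measure_preimage hDm.nullMeasurableSet]
        rw [Measure.prod_apply (hupd.measurable hDm)]
        rfl
    _ = (∫⁻ y : Clock, G (y 0) * (t i).indicator 1 y.tail ∂clockLaw μ β) * C := by
        simp_rw [inner]
        refine lintegral_mul_const _ ?_
        exact (hGm.comp (measurable_pi_apply 0)).mul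
          ((measurable_one.indicator (ht i)).comp Clock.measurable_tail)
    _ = (∫⁻ z, G z ∂(expMeasure μ).prod β) * clockLaw μ β (t i) * C := by
        have hF : Measurable fun z : (ℝ × Bool) × Clock => G z.1 * (t i).indicator 1 z.2 :=
          (hGm.comp measurable_fst).mul ((measurable_one.indicator (ht i)).comp measurable_snd)
        have := lintegral_map (μ := clockLaw μ β) hF
          ((measurable_pi_apply 0).prodMk Clock.measurable_tail)
        rw [← this, clockLaw_renewal, lintegral_prod_mul hGm.aemeasurable
          (measurable_one.indicator (ht i)).aemeasurable, lintegral_indicator_one (ht i)]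
    _ = _ := by
        rw [hGint, mul_assoc, hCdef, clocksLaw, infinitePi_univ_pi_split i ht]

end OneStep

/-! ### The law of the next event -/

section Step

variable {ι : Type*} {M : ℕ}

open Classical in
/-- The item that is completed first, and the server that completes it. -/
def firstCompletion (a : ℝ → Fin M → ι) (ξ : ι → Clock) : Option (ι × Fin M) :=
  if h : ∃ im : ι × Fin M, CompletesFirst a ξ im.1 im.2 then some h.choose else none

/-- The event at the completion of an item by a server, and the clocks just after it. -/
def stepAt [NeZero M] (a : ℝ → Fin M → ι) (ξ : ι → Clock) :
    Option (ι × Fin M) → (ℝ × Fin M × Bool) × (ι → Clock)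
  | none => ((0, 0, false), ξ)
  | some (i, m) => ((completion a i (ξ i).head, m, (ξ i 0).2),
      residualClocks a i (completion a i (ξ i).head) ξ)

/-- The event at the first completion, and the clocks just after it. -/
def step [NeZero M] (a : ℝ → Fin M → ι) (ξ : ι → Clock) :
    (ℝ × Fin M × Bool) × (ι → Clock) :=
  stepAt a ξ (firstCompletion a ξ)

theorem firstCompletion_eq_some_iff {a : ℝ → Fin M → ι} (hinj : ∀ s, Function.Injective (a s))
    {ξ : ι → Clock} {i : ι} {m : Fin M} :
    firstCompletion a ξ = some (i, m) ↔ CompletesFirst a ξ i m := by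
  unfold firstCompletion
  constructor
  · intro h
    split_ifs at h with hex
    have := hex.choose_spec
    rw [Option.some.inj h] at this
    exact this
  · intro h
    have hex : ∃ im : ι × Fin M, CompletesFirst a ξ im.1 im.2 := ⟨(i, m), h⟩
    rw [dif_pos hex]
    have := hex.choose_spec.unique hinj h
    exact congrArg some (Prod.ext this.1 this.2)

theorem step_of_completesFirst [NeZero M] {a : ℝ → Fin M → ι}
    (hinj : ∀ s, Function.Injective (a s)) {ξ : ι → Clock} {i : ι} {m : Fin M}
    (h : CompletesFirst a ξ i m) :
    step a ξ = ((completion a i (ξ i).head, m, (ξ i 0).2),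
      residualClocks a i (completion a i (ξ i).head) ξ) := by
  rw [step, (firstCompletion_eq_some_iff hinj).2 h, stepAt]

variable [Countable ι]

theorem measurable_step [NeZero M] {X : Type*} [MeasurableSpace X] {a : X → ℝ → Fin M → ι}
    (ha : ∀ m i, MeasurableSet {z : X × ℝ | a z.1 z.2 m = i})
    (hinj : ∀ x s, Function.Injective (a x s)) :
    Measurable fun z : X × (ι → Clock) => step (a z.1) z.2 := by
  have hsome : ∀ im : ι × Fin M, MeasurableSet {z : X × (ι → Clock) |
      firstCompletion (a z.1) z.2 = some im} := fun im => by
    have := measurableSet_completesFirst ha im.1 im.2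
    convert this using 2 with z
    ext z
    exact firstCompletion_eq_some_iff (hinj z.1)
  refine measurable_of_countable_cases (c := fun z : X × (ι → Clock) =>
    firstCompletion (a z.1) z.2) (fun im => ?_) (f := fun im z => stepAt (a z.1) z.2 im)
    (fun im => ?_)
  · rcases im with _ | im
    · have : {z : X × (ι → Clock) | firstCompletion (a z.1) z.2 = none} =
          (⋃ im, {z : X × (ι → Clock) | firstCompletion (a z.1) z.2 = some im})ᶜ := by
        ext z
        simp only [Set.mem_ofPred_eq, Set.mem_compl_iff, Set.mem_iUnion]
        rw [← Option.ne_none_iff_exists']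
        simp
      rw [this]
      exact (MeasurableSet.iUnion hsome).compl
    · exact hsome im
  · rcases im with _ | ⟨i, m⟩
    · simp only [stepAt]; fun_prop
    · have h1 := measurable_completion_head ha i
      have h2 := measurable_residualClocks ha i
      simp only [stepAt]
      exact (h1.prodMk (measurable_const.prodMk (by fun_prop))).prodMk h2

/-- The factor `M` in the exponential density of rate `M * μ` cancels the probability `1 / M` of a
slot, which leaves the integrand of `clocksLaw_completesFirst`. -/
theorem eventLaw_apply {μ : ℝ} {β : Measure Bool} [SFinite β] [NeZero M]
    {S : Set (ℝ × Fin M × Bool)} (hS : MeasurableSet S) :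
    eventLaw μ β M S = ∑ m, ∫⁻ s in Set.Ici 0, ENNReal.ofReal (μ * Real.exp (-(M * μ * s))) *
        β {b | (s, m, b) ∈ S} := by
  have hb : ∀ m, Measurable fun s => β {b | (s, m, b) ∈ S} := fun m =>
    measurable_measure_prodMk_left (ν := β) (s := {z : ℝ × Bool | (z.1, m, z.2) ∈ S})
      ((by fun_prop : Measurable fun z : ℝ × Bool => (z.1, m, z.2)) hS)
  have h1 : ∀ s, (((M : ℝ≥0∞)⁻¹ • (Measure.count : Measure (Fin M))).prod β) (Prod.mk s ⁻¹' S) =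
      (M : ℝ≥0∞)⁻¹ * ∑ m, β {b | (s, m, b) ∈ S} := fun s => by
    rw [Measure.prod_apply (measurable_prodMk_left hS), lintegral_smul_measure, lintegral_count,
      tsum_fintype, smul_eq_mul]
    rfl
  have hM : (M : ℝ≥0∞) ≠ 0 := by simpa using NeZero.ne M
  rw [eventLaw, Measure.prod_apply hS]
  simp_rw [h1]
  rw [lintegral_expMeasure ((Finset.measurable_fun_sum _ fun m _ => hb m).const_mul _),
    Measure.restrict_congr_set Ioi_ae_eq_Ici, ← lintegral_finsetSum _ (f := fun m s =>
      ENNReal.ofReal (μ * Real.exp (-(M * μ * s))) * β {b | (s, m, b) ∈ S})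
      fun m _ => Measurable.mul (by fun_prop) (hb m)]
  refine lintegral_congr fun s => ?_
  rw [← Finset.mul_sum, ← mul_assoc]
  congr 1
  rw [mul_assoc, ENNReal.ofReal_mul (Nat.cast_nonneg M), ENNReal.ofReal_natCast, mul_comm, ← mul_assoc,
    ENNReal.inv_mul_cancel hM (ENNReal.natCast_ne_top M), one_mul]

variable {μ : ℝ} {β : Measure Bool} [Fact (0 < μ)] [IsProbabilityMeasure β] [NeZero M]
  {a : ℝ → Fin M → ι}

/-- For each slot, the times at which it serves the various items partition the half-line. Summing
over the items therefore removes every trace of the assignment. -/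
theorem clocksLaw_iUnion_completesFirst (ha : ∀ m i, MeasurableSet {s | a s m = i})
    (hinj : ∀ s, Function.Injective (a s)) {S : Set (ℝ × Fin M × Bool)} (hS : MeasurableSet S)
    {t : ι → Set Clock} (ht : ∀ j, MeasurableSet (t j)) :
    clocksLaw ι μ β (⋃ im : Fin M × ι, {ξ | CompletesFirst a ξ im.2 im.1 ∧
        (completion a im.2 (ξ im.2).head, im.1, (ξ im.2 0).2) ∈ S ∧
        residualClocks a im.2 (completion a im.2 (ξ im.2).head) ξ ∈ Set.univ.pi t}) =
      eventLaw μ β M S * clocksLaw ι μ β (Set.univ.pi t) := by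
  have ha' : ∀ m i, MeasurableSet {z : Unit × ℝ | a z.2 m = i} := fun m i =>
    measurable_snd (ha m i)
  have hpr : Measurable fun ξ : ι → Clock => ((), ξ) := by fun_prop
  rw [measure_iUnion]
  · simp_rw [clocksLaw_completesFirst ha hinj _ _ hS ht]
    rw [ENNReal.tsum_mul_right, ENNReal.tsum_prod (f := fun m i => ∫⁻ s in {s | 0 ≤ s ∧ a s m = i},
      ENNReal.ofReal (μ * Real.exp (-(M * μ * s))) * β {b | (s, m, b) ∈ S}), tsum_fintype,
      eventLaw_apply hS]
    congr 2
    funext m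
    rw [← lintegral_iUnion]
    · congr 2
      ext s; simp
    · intro i
      exact measurableSet_Ici.inter (ha m i)
    · intro i j hij
      exact Set.disjoint_left.2 fun s hs hs' => hij (hs.2.symm.trans hs'.2)
  · rintro ⟨m, i⟩ ⟨m', i'⟩ hne
    refine Set.disjoint_left.2 fun ξ hξ hξ' => hne ?_
    have := hξ.1.unique hinj hξ'.1
    exact Prod.ext this.2 this.1
  · rintro ⟨m, i⟩
    have hQ' : Measurable fun ξ : ι → Clock => completion a i (ξ i).head := by
      have h := (measurable_completion_head (X := Unit) (a := fun _ => a) ha' i).comp hpr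
      exact h
    refine ((hpr (measurableSet_completesFirst (X := Unit) (a := fun _ => a) ha' i m))).inter
      (MeasurableSet.inter ?_ ?_)
    · exact (hQ'.prodMk (measurable_const.prodMk (by fun_prop))) hS
    · have h := (measurable_residualClocks (X := Unit) (a := fun _ => a) ha' i).comp hpr
      exact h (MeasurableSet.univ_pi ht)

/-- With trivial test sets the formula of `clocksLaw_iUnion_completesFirst` gives total mass one. -/
theorem ae_exists_completesFirst (ha : ∀ m i, MeasurableSet {s | a s m = i})
    (hinj : ∀ s, Function.Injective (a s)) :
    ∀ᵐ ξ ∂clocksLaw ι μ β, ∃ i m, CompletesFirst a ξ i m := by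
  have h := clocksLaw_iUnion_completesFirst (μ := μ) (β := β) ha hinj .univ (t := fun _ => .univ)
    (fun _ => .univ)
  rw [measure_univ, Set.pi_univ, measure_univ, one_mul] at h
  have h' := (prob_compl_eq_zero_iff₀ ?_).2 h
  · rw [ae_iff]
    refine measure_mono_null (fun ξ hξ => ?_) h'
    simp only [Set.mem_compl_iff, Set.mem_iUnion, not_exists]
    rintro ⟨m, i⟩ hh
    exact hξ ⟨i, m, hh.1⟩
  · have ha' : ∀ m i, MeasurableSet {z : Unit × ℝ | a z.2 m = i} := fun m i =>
      measurable_snd (ha m i)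
    have hpr : Measurable fun ξ : ι → Clock => ((), ξ) := by fun_prop
    refine MeasurableSet.nullMeasurableSet (MeasurableSet.iUnion fun im => ?_)
    simp only [Set.mem_univ, and_true]
    exact hpr (measurableSet_completesFirst (X := Unit) (a := fun _ => a) ha' im.2 im.1)

/-- The first event is independent of the residual clocks, and the residual clocks have the law
of the original clocks. -/
theorem map_step (ha : ∀ m i, MeasurableSet {s | a s m = i})
    (hinj : ∀ s, Function.Injective (a s)) :
    (clocksLaw ι μ β).map (step a) = (eventLaw μ β M).prod (clocksLaw ι μ β) := by
  symm
  have ha' : ∀ m i, MeasurableSet {z : Unit × ℝ | a z.2 m = i} := fun m i =>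
    measurable_snd (ha m i)
  have hm : Measurable fun ξ : ι → Clock => step a ξ := by
    have h := (measurable_step (X := Unit) (a := fun _ => a) ha' fun _ => hinj).comp
      (by fun_prop : Measurable fun ξ : ι → Clock => ((), ξ))
    exact h
  refine Measure.prod_eq fun A B hA hB => ?_
  set ν := (clocksLaw ι μ β).map (step a) with hνdef
  set ν' : Measure (ι → Clock) := (ν.restrict (A ×ˢ Set.univ)).map Prod.snd with hν'
  have hν : ∀ B, MeasurableSet B → ν' B = ν (A ×ˢ B) := fun B hB => by
    rw [hν', Measure.map_apply measurable_snd hB, Measure.restrict_apply (measurable_snd hB)]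
    congr 1
    ext; simp [and_comm]
  have : IsProbabilityMeasure ν := Measure.isProbabilityMeasure_map hm.aemeasurable
  rw [← hν B hB]
  suffices h : ν' = eventLaw μ β M A • clocksLaw ι μ β by rw [h]; simp
  refine eq_smul_infinitePi_of_univ fun t ht => ?_
  have hB := MeasurableSet.univ_pi ht
  rw [hν _ hB, hνdef, Measure.map_apply hm (hA.prod hB)]
  -- Off the null event that nothing completes, `step` takes the values described by the union over
  -- slots and items.
  refine Eq.trans ?_ (clocksLaw_iUnion_completesFirst ha hinj hA ht)
  refine measure_congr ?_
  filter_upwards [ae_exists_completesFirst ha hinj] with ξ hξ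
  obtain ⟨i, m, hc⟩ := hξ
  refine propext ?_
  change step a ξ ∈ A ×ˢ Set.univ.pi t ↔ ξ ∈ (⋃ im : Fin M × ι, _ : Set (ι → Clock))
  rw [step_of_completesFirst hinj hc, Set.mem_iUnion, Set.mem_prod]
  constructor
  · rintro ⟨h1, h2⟩
    exact ⟨(m, i), hc, h1, h2⟩
  · rintro ⟨⟨m', i'⟩, hc', h1, h2⟩
    obtain ⟨rfl, rfl⟩ := hc.unique hinj hc'
    exact ⟨h1, h2⟩

end Step

/-! ### The sequence of events is i.i.d. -/

section Iterate

variable {ι R : Type*} {M : ℕ}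

/-- A private randomization and a sequence of events: time since the previous event, server, and
error mark. -/
abbrev Source (R : Type*) (M : ℕ) := R × (ℕ → ℝ × Fin M × Bool)

/-- The law of the randomization and of the i.i.d. sequence of events. -/
def sourceLaw [MeasurableSpace R] (ρ : Measure R) (μ : ℝ) (β : Measure Bool) (M : ℕ) :
    Measure (Source R M) :=
  ρ.prod (Measure.infinitePi fun _ : ℕ => eventLaw μ β M)

/-- The source with the first `l` events replaced by those of the system in which, after `l`
events, items are assigned to servers according to `α l`, and the clocks after these events. -/
def iter [NeZero M] (α : ℕ → Source R M → ℝ → Fin M → ι) :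
    ℕ → Source R M × (ι → Clock) → Source R M × (ι → Clock)
  | 0, z => z
  | l + 1, z =>
    let y := iter α l z
    ((y.1.1, Function.update y.1.2 l (step (α l y.1) y.2).1), (step (α l y.1) y.2).2)

/-- The source that consists of the events of the system. -/
def sourceOf [NeZero M] (α : ℕ → Source R M → ℝ → Fin M → ι) (z : Source R M × (ι → Clock)) :
    Source R M :=
  (z.1.1, fun l => (iter α (l + 1) z).1.2 l)

/-- Assignments of items to servers that are measurable and depend on past events only. -/
structure IsCausal [MeasurableSpace R] (α : ℕ → Source R M → ℝ → Fin M → ι) : Prop where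
  measurable : ∀ l m i, MeasurableSet {z : Source R M × ℝ | α l z.1 z.2 m = i}
  injective : ∀ l x s, Function.Injective (α l x s)
  adapted : ∀ l (x x' : Source R M), x.1 = x'.1 → (∀ j < l, x.2 j = x'.2 j) → α l x = α l x'

variable [NeZero M] {α : ℕ → Source R M → ℝ → Fin M → ι}

theorem iter_succ_snd (l : ℕ) (z : Source R M × (ι → Clock)) :
    (iter α (l + 1) z).2 = (step (α l (iter α l z).1) (iter α l z).2).2 := rfl

theorem sourceOf_snd (l : ℕ) (z : Source R M × (ι → Clock)) :
    (sourceOf α z).2 l = (step (α l (iter α l z).1) (iter α l z).2).1 := by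
  simp only [sourceOf, iter, Function.update_self]

theorem iter_fst_fst (l : ℕ) (z : Source R M × (ι → Clock)) : (iter α l z).1.1 = z.1.1 := by
  induction l with
  | zero => rfl
  | succ l ih => exact ih

theorem iter_fst_snd {j l : ℕ} (h : j < l) (z : Source R M × (ι → Clock)) :
    (iter α l z).1.2 j = (sourceOf α z).2 j := by
  induction l with
  | zero => omega
  | succ l ih =>
    rcases (Nat.lt_succ_iff.1 h).eq_or_lt with rfl | h'
    · rfl
    · rw [← ih h']
      exact Function.update_of_ne h'.ne _ _

variable [MeasurableSpace R]

/-- The placeholder events from `l` on still differ between the two sources, but by causality the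
assignment does not look at them. -/
theorem IsCausal.iter_eq (hα : IsCausal α) (l : ℕ) (z : Source R M × (ι → Clock)) :
    α l (iter α l z).1 = α l (sourceOf α z) :=
  hα.adapted l _ _ (iter_fst_fst l z) fun _ hj => iter_fst_snd hj z

variable (ρ : Measure R) [IsProbabilityMeasure ρ] (μ : ℝ) (β : Measure Bool) [Fact (0 < μ)]
  [IsProbabilityMeasure β]

instance : IsProbabilityMeasure (sourceLaw ρ μ β M) := by unfold sourceLaw; infer_instance

/-- Resampling one event of the source. -/
theorem measurePreserving_source_update (l : ℕ) :
    MeasurePreserving (fun z : Source R M × (ℝ × Fin M × Bool) =>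
      ((z.1.1, Function.update z.1.2 l z.2) : Source R M))
      ((sourceLaw ρ μ β M).prod (eventLaw μ β M)) (sourceLaw ρ μ β M) := by
  have h1 := (measurePreserving_update (ν := fun _ : ℕ => eventLaw μ β M) l).comp
    Measure.measurePreserving_swap
  exact ((MeasurePreserving.id ρ).prod h1).comp (measurePreserving_prodAssoc _ _ _)

variable {ρ μ β} [Countable ι]

/-- By `map_step`, the next event and the residual clocks are fresh given the source, and writing a
fresh event into coordinate `l` preserves the law of the source. The placeholder events turn the
evolution into measure-preserving self-maps of one space, so that no conditional laws appear. -/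
theorem IsCausal.measurePreserving_iter (hα : IsCausal α) (l : ℕ) :
    MeasurePreserving (iter α l) ((sourceLaw ρ μ β M).prod (clocksLaw ι μ β))
      ((sourceLaw ρ μ β M).prod (clocksLaw ι μ β)) := by
  induction l with
  | zero => exact MeasurePreserving.id _
  | succ l ih =>
    have h1 : MeasurePreserving (fun z : Source R M × (ι → Clock) => (z.1, step (α l z.1) z.2))
        ((sourceLaw ρ μ β M).prod (clocksLaw ι μ β))
        ((sourceLaw ρ μ β M).prod ((eventLaw μ β M).prod (clocksLaw ι μ β))) := by
      refine (MeasurePreserving.id _).skew_product (g := fun x ξ => step (α l x) ξ)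
        (measurable_step (hα.measurable l) (hα.injective l)) (ae_of_all _ fun x => ?_)
      exact map_step (fun m i => measurable_prodMk_left (hα.measurable l m i)) (hα.injective l x)
    have h2 := ((measurePreserving_source_update ρ μ β (M := M) l).prod
      (MeasurePreserving.id (clocksLaw ι μ β))).comp
      ((measurePreserving_prodAssoc (sourceLaw ρ μ β M) (eventLaw μ β M)
        (clocksLaw ι μ β)).symm MeasurableEquiv.prodAssoc)
    exact (h2.comp h1).comp ih

/-- The randomization and the events of the system have the law of the source. -/
theorem IsCausal.measurePreserving_sourceOf (hα : IsCausal α) :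
    MeasurePreserving (sourceOf α) ((sourceLaw ρ μ β M).prod (clocksLaw ι μ β))
      (sourceLaw ρ μ β M) := by
  have hm : Measurable (sourceOf α) := by
    refine (measurable_fst.comp measurable_fst).prodMk (measurable_pi_iff.2 fun l => ?_)
    exact (measurable_pi_apply l).comp (measurable_snd.comp (measurable_fst.comp
      (hα.measurePreserving_iter (ρ := ρ) (μ := μ) (β := β) (l + 1)).measurable))
  refine ⟨hm, ?_⟩
  symm
  refine Measure.prod_eq fun A B hA hB => ?_
  set P := (sourceLaw ρ μ β M).prod (clocksLaw ι μ β)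
  set ν := P.map (sourceOf α) with hνdef
  set ν' : Measure (ℕ → ℝ × Fin M × Bool) := (ν.restrict (A ×ˢ Set.univ)).map Prod.snd with hν'
  have hν : ∀ B, MeasurableSet B → ν' B = ν (A ×ˢ B) := fun B hB => by
    rw [hν', Measure.map_apply measurable_snd hB, Measure.restrict_apply (measurable_snd hB)]
    congr 1
    ext; simp [and_comm]
  have : IsProbabilityMeasure ν := Measure.isProbabilityMeasure_map hm.aemeasurable
  rw [← hν B hB]
  suffices h : ν' = ρ A • Measure.infinitePi fun _ : ℕ => eventLaw μ β M by rw [h]; simp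
  refine eq_smul_infinitePi fun s t ht => ?_
  have hB : MeasurableSet ((s : Set ℕ).pi t) := .pi s.countable_toSet fun i _ => ht i
  -- After `L` steps all coordinates tested by the box have their final values, and `iter α L`
  -- preserves the measure.
  obtain ⟨L, hL⟩ : ∃ L, ∀ j ∈ s, j < L := ⟨s.sup id + 1, fun j hj =>
    Nat.lt_succ_iff.2 (Finset.le_sup (f := id) hj)⟩
  have e : sourceOf α ⁻¹' A ×ˢ (s : Set ℕ).pi t =
      iter α L ⁻¹' ((A ×ˢ (s : Set ℕ).pi t) ×ˢ Set.univ) := by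
    ext z
    simp only [Set.mem_preimage, Set.mem_prod, iter_fst_fst, Set.mem_univ, and_true, Set.mem_pi]
    refine and_congr Iff.rfl (forall₂_congr fun j hj => ?_)
    rw [iter_fst_snd (hL j hj)]
  rw [hν _ hB, hνdef, Measure.map_apply hm (hA.prod hB), e,
    (hα.measurePreserving_iter L).measure_preimage
      ((hA.prod hB).prod .univ).nullMeasurableSet, Measure.prod_prod, sourceLaw,
    Measure.prod_prod, measure_univ, mul_one, Measure.infinitePi_pi _ fun i _ => ht i]

/-- Almost surely, every event of the source is the first completion after the previous event. -/
theorem IsCausal.ae_path (hα : IsCausal α) :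
    ∀ᵐ z ∂(sourceLaw ρ μ β M).prod (clocksLaw ι μ β), ∀ l,
      (∀ i, 0 < ((iter α l z).2 i).head) ∧
      ∃ i, CompletesFirst (α l (sourceOf α z)) (iter α l z).2 i ((sourceOf α z).2 l).2.1 ∧
        ((sourceOf α z).2 l).1 =
          completion (α l (sourceOf α z)) i ((iter α l z).2 i).head ∧
        ((sourceOf α z).2 l).2.2 = ((iter α l z).2 i 0).2 ∧
        (iter α (l + 1) z).2 = residualClocks (α l (sourceOf α z)) i
          ((sourceOf α z).2 l).1 (iter α l z).2 := by
  rw [ae_all_iff]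
  intro l
  -- It is enough to consider fresh clocks: the statement after `l` events is the pullback along the
  -- measure-preserving map `iter α l`.
  have h1 : ∀ᵐ z ∂(sourceLaw ρ μ β M).prod (clocksLaw ι μ β),
      (∀ i, 0 < (z.2 i).head) ∧ ∃ i m, CompletesFirst (α l z.1) z.2 i m := by
    refine Filter.Eventually.and ?_ ?_
    · rw [ae_all_iff]
      intro i
      have h2 : MeasurePreserving (fun z : Source R M × (ι → Clock) => z.2 i)
          ((sourceLaw ρ μ β M).prod (clocksLaw ι μ β)) (clockLaw μ β) :=
        (measurePreserving_eval_infinitePi (fun _ : ι => clockLaw μ β) i).comp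
          measurePreserving_snd
      exact h2.quasiMeasurePreserving.ae (clockLaw_head_pos μ β)
    · have hms : MeasurableSet {z : Source R M × (ι → Clock) |
          ∃ i m, CompletesFirst (α l z.1) z.2 i m} := by
        have : {z : Source R M × (ι → Clock) | ∃ i m, CompletesFirst (α l z.1) z.2 i m} =
            ⋃ i, ⋃ m, {z | CompletesFirst (α l z.1) z.2 i m} := by ext; simp
        rw [this]
        exact MeasurableSet.iUnion fun i => MeasurableSet.iUnion fun m =>
          measurableSet_completesFirst (hα.measurable l) i m
      refine (Measure.ae_prod_iff_ae_ae hms).2 (ae_of_all _ fun x => ?_)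
      have ha : ∀ m i, MeasurableSet {s | α l x s m = i} := fun m i =>
        measurable_prodMk_left (hα.measurable l m i)
      exact ae_exists_completesFirst (a := α l x) ha (hα.injective l x)
  filter_upwards [(hα.measurePreserving_iter (ρ := ρ) (μ := μ) (β := β)
    l).quasiMeasurePreserving.ae h1] with z hz
  refine ⟨hz.1, ?_⟩
  obtain ⟨i, m, hc⟩ := hz.2
  have hs := step_of_completesFirst (hα.injective l _) hc
  have he : (sourceOf α z).2 l = (step (α l (iter α l z).1) (iter α l z).2).1 :=
    sourceOf_snd l z
  have hr : (iter α (l + 1) z).2 = (step (α l (iter α l z).1) (iter α l z).2).2 :=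
    iter_succ_snd l z
  rw [he, hr, hs, ← hα.iter_eq]
  exact ⟨i, hc, rfl, rfl, rfl⟩

end Iterate

/-! ### The system driven by a source of events -/

section System

variable {N M : ℕ}

/-- The state of a system driven by a source: the time of the last event, the number of epochs so
far, the snapshots at the epochs, and the generation time of the freshest delivered packet of each
flow (or minus the initial age). -/
abbrev SysState (N : ℕ) := ℝ × ℕ × (ℕ → Snapshot N) × (Fin N → ℝ)

namespace SysState

/-- The time of the last event. -/
def time (s : SysState N) : ℝ := s.1

/-- The number of epochs so far. -/
def count (s : SysState N) : ℕ := s.2.1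

/-- The snapshots at the epochs. -/
def snaps (s : SysState N) : ℕ → Snapshot N := s.2.2.1

/-- The generation times of the freshest delivered packets. -/
def latest (s : SysState N) : Fin N → ℝ := s.2.2.2

/-- The record of all epochs. -/
def hist (s : SysState N) : History N s.count := fun j => s.snaps j

/-- The numbers of failed transmissions. -/
def fails (s : SysState N) : Packet N → ℕ := (s.snaps s.count).2.1

/-- The delivered packets. -/
def delivered (s : SysState N) : Packet N → Bool := (s.snaps s.count).2.2

theorem measurable_time : Measurable (time : SysState N → ℝ) := measurable_fst

theorem measurable_count : Measurable (count : SysState N → ℕ) :=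
  measurable_fst.comp measurable_snd

theorem measurable_snaps : Measurable (snaps : SysState N → _) :=
  measurable_fst.comp (measurable_snd.comp measurable_snd)

theorem measurable_latest : Measurable (latest : SysState N → _) :=
  measurable_snd.comp (measurable_snd.comp measurable_snd)

/-- The state after an event at time `t` with error mark `b` that ends a transmission of the given
packet (`Sum.inl`) or no transmission (`Sum.inr`), if there have been `κ` epochs so far. -/
def advanceAt (I : Arrivals N) (κ : ℕ) (t : ℝ) (b : Bool) (s : SysState N) :
    Packet N ⊕ Fin M → SysState N
  | Sum.inr _ => (t, κ, s.snaps, s.latest)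
  | Sum.inl p => (t, κ + 1,
      Function.update s.snaps (κ + 1) (ENNReal.ofReal t,
        (if b then Function.update (s.snaps κ).2.1 p ((s.snaps κ).2.1 p + 1)
          else (s.snaps κ).2.1),
        (if b then (s.snaps κ).2.2 else Function.update (s.snaps κ).2.2 p true)),
      if b then s.latest else Function.update s.latest p.1 (max (s.latest p.1) (I.S p)))

end SysState

variable (I : Arrivals N) (π : Policy N M) (Δ₀ : Fin N → ℝ≥0)

/-- The packet that server `m` transmits at time `t` if there is no event in between. -/
def server (r : unitInterval) (s : SysState N) (t : ℝ) (m : Fin M) : Option (Packet N) :=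
  π.act r (I.observed t) s.hist t m

/-- The freshness of the flow that server `m` serves; idle servers come last. -/
def serverKey (r : unitInterval) (s : SysState N) (t : ℝ) (m : Fin M) : EReal :=
  match server I π r s t m with
  | some p => (s.latest p.1 : EReal)
  | none => ⊤

/-- The servers in decreasing order of the age of the flow that they serve. -/
def slotServer (r : unitInterval) (s : SysState N) (t : ℝ) : Equiv.Perm (Fin M) :=
  Tuple.sort (serverKey I π r s t)

/-- The packet transmitted by the `k`-th server in the order of ages, or its dummy clock if it
idles. -/
def slotItem (r : unitInterval) (s : SysState N) (t : ℝ) (k : Fin M) : Packet N ⊕ Fin M :=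
  match server I π r s t (slotServer I π r s t k) with
  | some p => Sum.inl p
  | none => Sum.inr (slotServer I π r s t k)

/-- The state after the next event. -/
def nextState (r : unitInterval) (s : SysState N) (e : ℝ × Fin M × Bool) : SysState N :=
  SysState.advanceAt I s.count (s.time + e.1) e.2.2 s
    (slotItem I π r s (s.time + e.1) e.2.1)

/-- The state after `l` events of the source. -/
def sysState (x : Source unitInterval M) : ℕ → SysState N
  | 0 => (0, 0, fun _ => (0, fun _ => 0, fun _ => false), fun n => -(Δ₀ n : ℝ))
  | l + 1 => nextState I π x.1 (sysState x l) (x.2 l)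

/-- The assignment of packets and dummy clocks to the slots after `l` events. -/
def sysAssignment (l : ℕ) (x : Source unitInterval M) (t : ℝ) (k : Fin M) : Packet N ⊕ Fin M :=
  slotItem I π x.1 (sysState I π Δ₀ x l) ((sysState I π Δ₀ x l).time + t) k

variable {I π Δ₀}

theorem slotItem_eq_inl_iff {r : unitInterval} {s : SysState N} {t : ℝ} {k : Fin M}
    {p : Packet N} :
    slotItem I π r s t k = Sum.inl p ↔ server I π r s t (slotServer I π r s t k) = some p := by
  unfold slotItem
  split <;> simp_all

theorem slotItem_eq_inr_iff {r : unitInterval} {s : SysState N} {t : ℝ} {k m : Fin M} :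
    slotItem I π r s t k = Sum.inr m ↔
      server I π r s t (slotServer I π r s t k) = none ∧ slotServer I π r s t k = m := by
  unfold slotItem
  split <;> simp_all

/-- Two servers never share a flow, and dummy clocks are labelled by their servers. So the slots
always hold `M` distinct items, as `IsCausal` requires. -/
theorem slotItem_injective (r : unitInterval) (s : SysState N) (t : ℝ) :
    Function.Injective (slotItem I π r s t) := by
  intro k k' h
  apply (slotServer I π r s t).injective
  rcases hk : slotItem I π r s t k with p | m
  · have h1 := slotItem_eq_inl_iff.1 hk
    have h2 := slotItem_eq_inl_iff.1 (h ▸ hk)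
    exact π.flow_injective _ _ _ _ _ _ _ _ h1 h2 rfl
  · rw [(slotItem_eq_inr_iff.1 hk).2, (slotItem_eq_inr_iff.1 (h ▸ hk)).2]

theorem measurableSet_server (m : Fin M) (o : Option (Packet N)) :
    MeasurableSet {z : unitInterval × SysState N × ℝ | server I π z.1 z.2.1 z.2.2 m = o} := by
  have hsome : ∀ p, MeasurableSet {z : unitInterval × SysState N × ℝ |
      server I π z.1 z.2.1 z.2.2 m = some p} := by
    intro p
    have : {z : unitInterval × SysState N × ℝ | server I π z.1 z.2.1 z.2.2 m = some p} =
        ⋃ κ, {z | z.2.1.count = κ} ∩ (fun z : unitInterval × SysState N × ℝ =>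
          (z.1, ((fun j => z.2.1.snaps j : History N κ)), z.2.2)) ⁻¹'
          {x | π.act x.1 (I.observed x.2.2) x.2.1 x.2.2 m = some p} := by
      ext ⟨r, s, t⟩
      simp only [Set.mem_ofPred_eq, Set.mem_iUnion, Set.mem_inter_iff, Set.mem_preimage]
      constructor
      · exact fun h => ⟨s.count, rfl, h⟩
      · rintro ⟨κ, rfl, h⟩
        exact h
    rw [this]
    refine MeasurableSet.iUnion fun κ => MeasurableSet.inter ?_ ?_
    · exact (SysState.measurable_count.comp (measurable_fst.comp measurable_snd))
        (measurableSet_singleton κ)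
    · refine Measurable.prodMk measurable_fst (Measurable.prodMk ?_
        (measurable_snd.comp measurable_snd)) (π.measurable_act I κ m p)
      exact measurable_pi_iff.2 fun j => (measurable_pi_apply (j : ℕ)).comp
        (SysState.measurable_snaps.comp (measurable_fst.comp measurable_snd))
  rcases o with _ | p
  · have : {z : unitInterval × SysState N × ℝ | server I π z.1 z.2.1 z.2.2 m = none} =
        (⋃ p, {z : unitInterval × SysState N × ℝ |
          server I π z.1 z.2.1 z.2.2 m = some p})ᶜ := by
      ext z
      simp only [Set.mem_ofPred_eq, Set.mem_compl_iff, Set.mem_iUnion]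
      rw [← Option.ne_none_iff_exists']
      simp
    rw [this]
    exact (MeasurableSet.iUnion hsome).compl
  · exact hsome p

theorem measurable_serverKey (m : Fin M) :
    Measurable fun z : unitInterval × SysState N × ℝ => serverKey I π z.1 z.2.1 z.2.2 m := by
  refine measurable_of_countable_cases (c := fun z : unitInterval × SysState N × ℝ =>
    server I π z.1 z.2.1 z.2.2 m) (measurableSet_server m) (f := fun o z =>
      match o with
      | some p => (z.2.1.latest p.1 : EReal)
      | none => ⊤) ?_
  rintro (_ | p)
  · exact measurable_const
  · exact measurable_coe_real_ereal.comp ((measurable_pi_apply p.1).comp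
      (SysState.measurable_latest.comp (measurable_fst.comp measurable_snd)))

theorem measurableSet_slotServer (σ : Equiv.Perm (Fin M)) :
    MeasurableSet {z : unitInterval × SysState N × ℝ |
      slotServer I π z.1 z.2.1 z.2.2 = σ} := by
  have hk := measurable_serverKey (I := I) (π := π)
  have : {z : unitInterval × SysState N × ℝ | slotServer I π z.1 z.2.1 z.2.2 = σ} =
      (⋂ i, ⋂ j, ⋂ (_ : i ≤ j), {z | serverKey I π z.1 z.2.1 z.2.2 (σ i) ≤
        serverKey I π z.1 z.2.1 z.2.2 (σ j)}) ∩
      ⋂ i, ⋂ j, ⋂ (_ : i < j), ({z | serverKey I π z.1 z.2.1 z.2.2 (σ i) =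
        serverKey I π z.1 z.2.1 z.2.2 (σ j)}ᶜ ∪ {_z | σ i < σ j}) := by
    ext z
    simp only [Set.mem_ofPred_eq, slotServer, eq_comm (b := σ), Tuple.eq_sort_iff, Monotone,
      Set.mem_inter_iff, Set.mem_iInter, Set.mem_union, Set.mem_compl_iff, Function.comp]
    refine and_congr Iff.rfl (forall₃_congr fun i j _ => ?_)
    tauto
  rw [this]
  refine MeasurableSet.inter ?_ ?_
  · exact MeasurableSet.iInter fun i => MeasurableSet.iInter fun j => MeasurableSet.iInter fun _ =>
      measurableSet_le (hk _) (hk _)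
  · exact MeasurableSet.iInter fun i => MeasurableSet.iInter fun j => MeasurableSet.iInter fun _ =>
      (measurableSet_eq_fun (hk _) (hk _)).compl.union (.const _)

theorem measurableSet_slotItem (k : Fin M) (i : Packet N ⊕ Fin M) :
    MeasurableSet {z : unitInterval × SysState N × ℝ |
      slotItem I π z.1 z.2.1 z.2.2 k = i} := by
  rcases i with p | m
  · have : {z : unitInterval × SysState N × ℝ | slotItem I π z.1 z.2.1 z.2.2 k = Sum.inl p} =
        ⋃ σ, {z | slotServer I π z.1 z.2.1 z.2.2 = σ} ∩
          {z | server I π z.1 z.2.1 z.2.2 (σ k) = some p} := by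
      ext z; simp [slotItem_eq_inl_iff]
    rw [this]
    exact MeasurableSet.iUnion fun σ =>
      (measurableSet_slotServer σ).inter (measurableSet_server _ _)
  · have : {z : unitInterval × SysState N × ℝ | slotItem I π z.1 z.2.1 z.2.2 k = Sum.inr m} =
        ⋃ σ, {z | slotServer I π z.1 z.2.1 z.2.2 = σ} ∩
          ({z | server I π z.1 z.2.1 z.2.2 (σ k) = none} ∩ {_z | σ k = m}) := by
      ext z; simp [slotItem_eq_inr_iff]
    rw [this]
    exact MeasurableSet.iUnion fun σ =>
      (measurableSet_slotServer σ).inter ((measurableSet_server _ _).inter (.const _))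

theorem SysState.measurable_advanceAt (κ : ℕ) (b : Bool) (i : Packet N ⊕ Fin M) :
    Measurable fun z : ℝ × SysState N => advanceAt I κ z.1 b z.2 i := by
  have hs : Measurable fun z : ℝ × SysState N => z.2.snaps :=
    measurable_snaps.comp measurable_snd
  have hl : Measurable fun z : ℝ × SysState N => z.2.latest :=
    measurable_latest.comp measurable_snd
  rcases i with p | m
  · have hκ : Measurable fun z : ℝ × SysState N => z.2.snaps κ := (measurable_pi_apply κ).comp hs
    have hf : Measurable fun z : ℝ × SysState N => (z.2.snaps κ).2.1 :=
      measurable_fst.comp (measurable_snd.comp hκ)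
    have hd : Measurable fun z : ℝ × SysState N => (z.2.snaps κ).2.2 :=
      measurable_snd.comp (measurable_snd.comp hκ)
    have hl' : Measurable fun z : ℝ × SysState N => max (z.2.latest p.1) (I.S p) :=
      ((measurable_pi_apply p.1).comp hl).max measurable_const
    have hf' : Measurable fun z : ℝ × SysState N => (z.2.snaps κ).2.1 p + 1 :=
      ((measurable_pi_apply p).comp hf).add_const 1
    refine measurable_fst.prodMk (measurable_const.prodMk (Measurable.prodMk ?_ ?_))
    · refine measurable_update'.comp (hs.prodMk (measurable_fst.ennreal_ofReal.prodMk
        (Measurable.prodMk ?_ ?_)))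
      · cases b
        · exact hf
        · exact measurable_update'.comp (hf.prodMk hf')
      · cases b
        · exact measurable_update'.comp (hd.prodMk measurable_const)
        · exact hd
    · cases b
      · exact measurable_update'.comp (hl.prodMk hl')
      · exact hl
  · exact measurable_fst.prodMk (measurable_const.prodMk (hs.prodMk hl))

theorem measurable_nextState :
    Measurable fun z : unitInterval × SysState N × (ℝ × Fin M × Bool) =>
      nextState I π z.1 z.2.1 z.2.2 := by
  have ht : Measurable fun z : unitInterval × SysState N × (ℝ × Fin M × Bool) =>
      z.2.1.time + z.2.2.1 :=
    (SysState.measurable_time.comp (measurable_fst.comp measurable_snd)).add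
      (measurable_fst.comp (measurable_snd.comp measurable_snd))
  refine measurable_of_countable_cases (ι := (Packet N ⊕ Fin M) × Bool × ℕ)
    (c := fun z : unitInterval × SysState N × (ℝ × Fin M × Bool) =>
      (slotItem I π z.1 z.2.1 (z.2.1.time + z.2.2.1) z.2.2.2.1, z.2.2.2.2, z.2.1.count))
    (fun i => ?_) (f := fun i z =>
      SysState.advanceAt I i.2.2 (z.2.1.time + z.2.2.1) i.2.1 z.2.1 i.1) fun i => ?_
  · obtain ⟨i, b, κ⟩ := i
    have : {z : unitInterval × SysState N × (ℝ × Fin M × Bool) |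
        (slotItem I π z.1 z.2.1 (z.2.1.time + z.2.2.1) z.2.2.2.1, z.2.2.2.2, z.2.1.count) =
          (i, b, κ)} =
        (⋃ k, {z | z.2.2.2.1 = k} ∩
          {z | slotItem I π z.1 z.2.1 (z.2.1.time + z.2.2.1) k = i}) ∩
        ({z | z.2.2.2.2 = b} ∩ {z | z.2.1.count = κ}) := by
      ext z; simp
    rw [this]
    refine (MeasurableSet.iUnion fun k => MeasurableSet.inter ?_ ?_).inter
      (MeasurableSet.inter ?_ ?_)
    · exact (by fun_prop : Measurable fun z : unitInterval × SysState N × (ℝ × Fin M × Bool) =>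
        z.2.2.2.1) (measurableSet_singleton k)
    · exact (Measurable.prodMk measurable_fst (Measurable.prodMk
        (measurable_fst.comp measurable_snd) ht)) (measurableSet_slotItem k i)
    · exact (by fun_prop : Measurable fun z : unitInterval × SysState N × (ℝ × Fin M × Bool) =>
        z.2.2.2.2) (measurableSet_singleton b)
    · exact (SysState.measurable_count.comp (measurable_fst.comp measurable_snd))
        (measurableSet_singleton κ)
  · have h := (SysState.measurable_advanceAt (I := I) i.2.2 i.2.1 i.1).comp
      (ht.prodMk (measurable_fst.comp measurable_snd))
    exact h

theorem measurable_sysState (l : ℕ) : Measurable fun x => sysState I π Δ₀ x l := by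
  induction l with
  | zero => exact measurable_const
  | succ l ih =>
    have h := (measurable_nextState (I := I) (π := π)).comp (measurable_fst.prodMk
      (ih.prodMk ((measurable_pi_apply l).comp measurable_snd)))
    exact h

theorem sysState_congr {x x' : Source unitInterval M} {l : ℕ} (h1 : x.1 = x'.1)
    (h2 : ∀ j < l, x.2 j = x'.2 j) : sysState I π Δ₀ x l = sysState I π Δ₀ x' l := by
  induction l with
  | zero => rfl
  | succ l ih =>
    rw [sysState, sysState, ih fun j hj => h2 j (hj.trans l.lt_succ_self), h1,
      h2 l l.lt_succ_self]

theorem isCausal_sysAssignment : IsCausal (sysAssignment I π Δ₀) where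
  measurable l m i := by
    have hs : Measurable fun z : Source unitInterval M × ℝ => sysState I π Δ₀ z.1 l :=
      (measurable_sysState l).comp measurable_fst
    exact ((measurable_fst.comp measurable_fst).prodMk (hs.prodMk
      ((SysState.measurable_time.comp hs).add measurable_snd))) (measurableSet_slotItem m i)
  injective l x s := slotItem_injective _ _ _
  adapted l x x' h1 h2 := by
    funext t k
    rw [sysAssignment, sysAssignment, sysState_congr h1 h2, h1]

end System

/-! ### The system with given transmission times is driven by its own events -/

section Link

variable {N M : ℕ} {I : Arrivals N} {π : Policy N M} {Δ₀ : Fin N → ℝ≥0}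

theorem run_succ_fst (ω : Outcome N) (k : ℕ) :
    (run I π ω (k + 1)).1 = Fin.snoc (α := fun _ => Snapshot N) (run I π ω k).1
      (nextSnapshot I π ω (run I π ω k).1 (run I π ω k).2) := rfl

theorem snapshot_succ (ω : Outcome N) (k : ℕ) :
    snapshot I π ω (k + 1) = nextSnapshot I π ω (run I π ω k).1 (run I π ω k).2 := by
  rw [snapshot, run_succ_fst, Fin.snoc_last]

theorem run_fst (ω : Outcome N) (k : ℕ) :
    (run I π ω k).1 = fun j : Fin (k + 1) => snapshot I π ω j := by
  induction k with
  | zero =>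
    funext j
    rw [show j = Fin.last 0 from Fin.ext (by omega)]
    rfl
  | succ k ih =>
    funext j
    refine Fin.lastCases ?_ (fun j => ?_) j
    · rfl
    · rw [run_succ_fst, Fin.snoc_castSucc, ih]
      rfl

theorem snapshot_time_le_succ (ω : Outcome N) (k : ℕ) :
    (snapshot I π ω k).1 ≤ (snapshot I π ω (k + 1)).1 := by
  rw [snapshot_succ]
  exact le_sInf fun t ht => ht.1

theorem snapshot_time_mono (ω : Outcome N) : Monotone fun k => (snapshot I π ω k).1 :=
  monotone_nat_of_le_succ (snapshot_time_le_succ ω)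

theorem snapshot_delivered_mono (ω : Outcome N) (p : Packet N) {k k' : ℕ} (h : k ≤ k')
    (hk : (snapshot I π ω k).2.2 p = true) : (snapshot I π ω k').2.2 p = true := by
  induction k', h using Nat.le_induction with
  | base => exact hk
  | succ k' _ ih =>
    rw [snapshot_succ]
    simp only [nextSnapshot]
    split_ifs
    · rfl
    · exact ih

theorem work_mono (r : unitInterval) {k : ℕ} (h : History N k) (g : Packet N → ℝ≥0∞)
    (p : Packet N) {t t' : ℝ≥0∞} (htt : t ≤ t') : work I π r h g p t ≤ work I π r h g p t' := by
  unfold work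
  gcongr

theorem serviceTimes_of_delivered (r : unitInterval) {k : ℕ} (h : History N k) {p : Packet N}
    (hp : (h (Fin.last k)).2.2 p = true) : serviceTimes I π r h p = ∅ := by
  ext s
  simp only [serviceTimes, Set.mem_ofPred_eq, Set.mem_empty_iff_false, iff_false]
  rintro ⟨_, m, hm⟩
  have := π.undelivered _ _ _ _ _ _ hm
  simp [hp] at this

theorem work_of_delivered (r : unitInterval) {k : ℕ} (h : History N k) (g : Packet N → ℝ≥0∞)
    {p : Packet N} (hp : (h (Fin.last k)).2.2 p = true) (t : ℝ≥0∞) :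
    work I π r h g p t = g p := by
  rw [work, serviceTimes_of_delivered r h hp]; simp

theorem work_epoch (r : unitInterval) {k : ℕ} (h : History N k) (g : Packet N → ℝ≥0∞)
    (p : Packet N) : work I π r h g p (h (Fin.last k)).1 = g p := by
  have : {s | (h (Fin.last k)).1 ≤ ENNReal.ofReal s ∧
      ENNReal.ofReal s < (h (Fin.last k)).1} = ∅ := by
    ext s
    simp only [Set.mem_ofPred_eq, Set.mem_empty_iff_false, iff_false, not_and, not_lt]
    exact fun h => h
  rw [work, this]; simp

/-- `work` counts from the last epoch, but the end of a dummy clock is an event without being an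
epoch, so `s.time` can be later. Splitting at `s.time` matches the two ways of measuring service. -/
theorem work_add (r : unitInterval) (s : SysState N) (g : Packet N → ℝ≥0∞) (p : Packet N)
    (h0 : 0 ≤ s.time) (hle : (s.snaps s.count).1 ≤ ENNReal.ofReal s.time) {t : ℝ} (ht : 0 ≤ t) :
    work I π r s.hist g p (ENNReal.ofReal (s.time + t)) =
      work I π r s.hist g p (ENNReal.ofReal s.time) +
        serviceAmount (fun t => slotItem I π r s (s.time + t)) (Sum.inl p) t := by
  have hlast : (s.hist (Fin.last s.count)).1 = (s.snaps s.count).1 := rfl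
  unfold work
  rw [add_assoc, hlast]
  congr 1
  rw [← measure_inter_add_sdiff (serviceTimes I π r s.hist p ∩ {u |
    (s.snaps s.count).1 ≤ ENNReal.ofReal u ∧ ENNReal.ofReal u < ENNReal.ofReal (s.time + t)})
    (measurableSet_Iio (a := s.time))]
  congr 1
  · congr 1
    ext u
    simp only [serviceTimes, Set.mem_inter_iff, Set.mem_ofPred_eq, Set.mem_Iio]
    constructor
    · rintro ⟨⟨⟨hu, h1⟩, h2, _⟩, h3⟩
      exact ⟨⟨hu, h1⟩, h2, (ENNReal.ofReal_lt_ofReal_iff_of_nonneg hu).2 h3⟩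
    · rintro ⟨⟨hu, h1⟩, h2, h3⟩
      have h3' := (ENNReal.ofReal_lt_ofReal_iff_of_nonneg hu).1 h3
      exact ⟨⟨⟨hu, h1⟩, h2, (ENNReal.ofReal_lt_ofReal_iff_of_nonneg hu).2 (by linarith)⟩, h3'⟩
  · rw [serviceAmount, ← measure_preimage_add volume s.time]
    congr 1
    ext u
    simp only [serviceTimes, Set.mem_sdiff, Set.mem_inter_iff, Set.mem_ofPred_eq, Set.mem_Iio,
      Set.mem_preimage, not_lt]
    -- Slots are a permutation of the servers, so being served by some server and occupying some
    -- slot are the same.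
    have hex : (∃ m, π.act r (I.observed (s.time + u)) s.hist (s.time + u) m = some p) ↔
        ∃ k, slotItem I π r s (s.time + u) k = Sum.inl p := by
      simp only [slotItem_eq_inl_iff]
      exact ((slotServer I π r s (s.time + u)).surjective.exists
        (p := fun m => server I π r s (s.time + u) m = some p))
    rw [hex]
    constructor
    · rintro ⟨⟨⟨hu, h1⟩, h2, h3⟩, h4⟩
      have h3' := (ENNReal.ofReal_lt_ofReal_iff_of_nonneg hu).1 h3
      exact ⟨by linarith, by linarith, h1⟩
    · rintro ⟨h1, h2, h3⟩
      refine ⟨⟨⟨by linarith, h3⟩, hle.trans (ENNReal.ofReal_le_ofReal (by linarith)), ?_⟩,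
        by linarith⟩
      exact (ENNReal.ofReal_lt_ofReal_iff_of_nonneg (by linarith)).2 (by linarith)

/-- The system with outcome `ω` is in state `s`, and `ξ` are the residual clocks. -/
structure Linked (I : Arrivals N) (π : Policy N M) (ω : Outcome N) (s : SysState N)
    (ξ : Packet N ⊕ Fin M → Clock) : Prop where
  snaps : ∀ j ≤ s.count, snapshot I π ω j = s.snaps j
  time_nonneg : 0 ≤ s.time
  epoch_le : (s.snaps s.count).1 ≤ ENNReal.ofReal s.time
  head : ∀ p, s.delivered p = false → ENNReal.ofReal (ξ (Sum.inl p)).head +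
    work I π ω.2.2 s.hist (run I π ω s.count).2 p (ENNReal.ofReal s.time) =
      ENNReal.ofReal (ω.1 (p, s.fails p))
  mark : ∀ p, s.delivered p = false → (ξ (Sum.inl p) 0).2 = ω.2.1 (p, s.fails p)
  later : ∀ p, s.delivered p = false → ∀ j, ξ (Sum.inl p) (j + 1) =
    (ω.1 (p, s.fails p + (j + 1)), ω.2.1 (p, s.fails p + (j + 1)))
  idle : ∀ p, s.delivered p = true → (run I π ω s.count).2 p = 0

/-- The event `e` is the first completion in state `s` with residual clocks `ξ`, and `ξ'` are the
clocks after it. -/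
structure IsNextEvent (I : Arrivals N) (π : Policy N M) (r : unitInterval) (s : SysState N)
    (ξ : Packet N ⊕ Fin M → Clock) (e : ℝ × Fin M × Bool) (ξ' : Packet N ⊕ Fin M → Clock)
    (i : Packet N ⊕ Fin M) : Prop where
  completes : CompletesFirst (fun t => slotItem I π r s (s.time + t)) ξ i e.2.1
  time_eq : e.1 = completion (fun t => slotItem I π r s (s.time + t)) i (ξ i).head
  mark_eq : e.2.2 = (ξ i 0).2
  clocks_eq : ξ' = residualClocks (fun t => slotItem I π r s (s.time + t)) i e.1 ξ

variable {ω : Outcome N} {s : SysState N} {ξ ξ' : Packet N ⊕ Fin M → Clock}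
  {e : ℝ × Fin M × Bool} {i : Packet N ⊕ Fin M}

theorem Linked.hist_eq (h : Linked I π ω s ξ) : (run I π ω s.count).1 = s.hist := by
  rw [run_fst]
  funext j
  exact h.snaps j (Nat.lt_succ_iff.1 j.2)

theorem Linked.work_of_delivered (h : Linked I π ω s ξ) {p : Packet N}
    (hp : s.delivered p = true) (t : ℝ≥0∞) :
    work I π ω.2.2 s.hist (run I π ω s.count).2 p t = 0 := by
  rw [StatusUpdate.work_of_delivered _ _ _ hp, h.idle p hp]

namespace IsNextEvent

variable {r : unitInterval} (h : IsNextEvent I π r s ξ e ξ' i)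

include h

theorem gap_nonneg : 0 ≤ e.1 := h.time_eq ▸ completion_nonneg

theorem item_eq : slotItem I π r s (s.time + e.1) e.2.1 = i := by
  have := h.completes.2.2.1
  rwa [← h.time_eq] at this

theorem serviceAmount_eq :
    serviceAmount (fun t => slotItem I π r s (s.time + t)) i e.1 =
      ENNReal.ofReal (ξ i).head := by
  rw [h.time_eq]; exact h.completes.2.1

theorem serviceAmount_lt {j : Packet N ⊕ Fin M} (hj : j ≠ i) :
    serviceAmount (fun t => slotItem I π r s (s.time + t)) j e.1 <
      ENNReal.ofReal (ξ j).head := by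
  rw [h.time_eq]; exact h.completes.2.2.2 j hj

theorem gap_pos : 0 < e.1 := by
  by_contra hle
  have h1 := h.serviceAmount_eq
  rw [serviceAmount_of_nonpos (not_lt.1 hle)] at h1
  exact (ENNReal.ofReal_pos.2 h.completes.1).ne h1

theorem serviceAmount_lt_of_lt {d : ℝ} (h0 : 0 ≤ d) (hd : d < e.1) (j : Packet N ⊕ Fin M) :
    serviceAmount (fun t => slotItem I π r s (s.time + t)) j d < ENNReal.ofReal (ξ j).head := by
  by_cases hj : j = i
  · subst hj
    rw [h.time_eq] at hd
    exact lt_of_lt_completion hd h0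
  · exact (serviceAmount_mono hd.le).trans_lt (h.serviceAmount_lt hj)

end IsNextEvent

/-- By the field `head`, an undelivered packet finishes when the service since `s.time` reaches its
residual clock, which happens for no item before the first completion. A delivered packet has work
zero and fails the positivity in `Finished`. -/
theorem Linked.not_finished (hl : Linked I π ω s ξ) (he : IsNextEvent I π ω.2.2 s ξ e ξ' i)
    (p : Packet N) {t : ℝ≥0∞} (ht : t < ENNReal.ofReal (s.time + e.1)) :
    ¬ Finished I π ω s.hist (run I π ω s.count).2 p t := by
  rintro ⟨h1, h2⟩
  cases hp : s.delivered p
  · set d := max (t.toReal - s.time) 0 with hd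
    have hd0 : 0 ≤ d := le_max_right _ _
    have htr : t.toReal < s.time + e.1 := ENNReal.toReal_lt_of_lt_ofReal ht
    have hde : d < e.1 := max_lt (by linarith) he.gap_pos
    have htd : t ≤ ENNReal.ofReal (s.time + d) := by
      rw [← ENNReal.ofReal_toReal ht.ne_top]
      refine ENNReal.ofReal_le_ofReal ?_
      have := le_max_left (t.toReal - s.time) 0
      linarith
    have h3 := h2.trans (work_mono _ _ _ p htd)
    have hf : (s.hist (Fin.last s.count)).2.1 p = s.fails p := rfl
    rw [work_add _ _ _ _ hl.time_nonneg hl.epoch_le hd0, hf, ← hl.head p hp, add_comm] at h3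
    have h4 : work I π ω.2.2 s.hist (run I π ω s.count).2 p (ENNReal.ofReal s.time) ≠ ⊤ :=
      ne_top_of_le_ne_top ENNReal.ofReal_ne_top (le_add_self.trans_eq (hl.head p hp))
    exact ((ENNReal.add_le_add_iff_left h4).1 h3).not_gt (he.serviceAmount_lt_of_lt hd0 hde _)
  · rw [hl.work_of_delivered hp] at h1
    exact lt_irrefl _ h1

theorem Linked.finished_iff (hl : Linked I π ω s ξ) (he : IsNextEvent I π ω.2.2 s ξ e ξ' i)
    (p : Packet N) :
    Finished I π ω s.hist (run I π ω s.count).2 p (ENNReal.ofReal (s.time + e.1)) ↔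
      i = Sum.inl p := by
  have hf : (s.hist (Fin.last s.count)).2.1 p = s.fails p := rfl
  cases hp : s.delivered p
  · have h4 : work I π ω.2.2 s.hist (run I π ω s.count).2 p (ENNReal.ofReal s.time) ≠ ⊤ :=
      ne_top_of_le_ne_top ENNReal.ofReal_ne_top (le_add_self.trans_eq (hl.head p hp))
    rw [Finished, work_add _ _ _ _ hl.time_nonneg hl.epoch_le he.gap_nonneg, hf, ← hl.head p hp]
    constructor
    · rintro ⟨_, h2⟩
      by_contra hi
      rw [add_comm] at h2
      exact ((ENNReal.add_le_add_iff_left h4).1 h2).not_gt (he.serviceAmount_lt (Ne.symm hi))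
    · rintro rfl
      rw [he.serviceAmount_eq]
      exact ⟨(ENNReal.ofReal_pos.2 he.completes.1).trans_le le_add_self, (add_comm _ _).le⟩
  · refine iff_of_false (fun h => ?_) ?_
    · have := h.1
      rw [hl.work_of_delivered hp] at this
      exact lt_irrefl _ this
    · rintro rfl
      have := π.undelivered _ _ _ _ _ _ (slotItem_eq_inl_iff.1 he.item_eq)
      have hd : (s.hist (Fin.last s.count)).2.2 p = s.delivered p := rfl
      simp [hd, hp] at this

/-- Only an inequality, because the event may end a dummy clock; for packets it is an equality
(`Linked.nextTime_eq`). -/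
theorem Linked.le_nextTime (hl : Linked I π ω s ξ) (he : IsNextEvent I π ω.2.2 s ξ e ξ' i) :
    ENNReal.ofReal (s.time + e.1) ≤ (snapshot I π ω (s.count + 1)).1 := by
  rw [snapshot_succ]
  refine le_sInf ?_
  rintro t ⟨_, p, hp⟩
  by_contra ht
  rw [hl.hist_eq] at hp
  exact hl.not_finished he p (not_le.1 ht) hp

theorem Linked.nextTime_eq (hl : Linked I π ω s ξ) {p : Packet N}
    (he : IsNextEvent I π ω.2.2 s ξ e ξ' (Sum.inl p)) :
    nextTime I π ω s.hist (run I π ω s.count).2 = ENNReal.ofReal (s.time + e.1) := by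
  refine le_antisymm (sInf_le ⟨?_, p, (hl.finished_iff he p).2 rfl⟩) ?_
  · exact hl.epoch_le.trans (ENNReal.ofReal_le_ofReal (by linarith [he.gap_nonneg]))
  · have := hl.le_nextTime he
    rw [snapshot_succ, hl.hist_eq] at this
    exact this

/-- Service moves from the residual clock to the work done, so the sum in `head` is conserved. A
completed packet opens a new epoch and proceeds to the next entry of its clock, which matters only
after an error. A dummy completion leaves all snapshots unchanged and only moves the time. -/
theorem Linked.next (hl : Linked I π ω s ξ) (he : IsNextEvent I π ω.2.2 s ξ e ξ' i) :
    Linked I π ω (nextState I π ω.2.2 s e) ξ' := by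
  have hg := he.gap_nonneg
  have hresid : ∀ p, Sum.inl p ≠ i → s.delivered p = false →
      ENNReal.ofReal (ξ' (Sum.inl p)).head +
        work I π ω.2.2 s.hist (run I π ω s.count).2 p (ENNReal.ofReal (s.time + e.1)) =
      ENNReal.ofReal (ω.1 (p, s.fails p)) := by
    intro p hpi hp
    have hlt := he.serviceAmount_lt hpi
    rw [← hl.head p hp, work_add _ _ _ _ hl.time_nonneg hl.epoch_le hg, he.clocks_eq,
      residualClocks, if_neg hpi]
    simp only [Clock.head, Clock.resid, Function.update_self] at hlt ⊢
    rw [ENNReal.ofReal_sub _ ENNReal.toReal_nonneg, ENNReal.ofReal_toReal serviceAmount_ne_top,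
      add_comm (work _ _ _ _ _ _ _), ← add_assoc, tsub_add_cancel_of_le hlt.le]
  have hmark : ∀ p, Sum.inl p ≠ i → (ξ' (Sum.inl p) 0).2 = (ξ (Sum.inl p) 0).2 ∧
      ∀ j, ξ' (Sum.inl p) (j + 1) = ξ (Sum.inl p) (j + 1) := by
    intro p hpi
    rw [he.clocks_eq, residualClocks, if_neg hpi]
    simp [Clock.resid]
  have htime : 0 ≤ s.time + e.1 := add_nonneg hl.time_nonneg hg
  rw [nextState, he.item_eq]
  rcases i with p₀ | m
  · have hTime := hl.nextTime_eq he
    have hp₀ : s.delivered p₀ = false :=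
      π.undelivered _ _ _ _ _ _ (slotItem_eq_inl_iff.1 he.item_eq)
    have hmark₀ : e.2.2 = ω.2.1 (p₀, s.fails p₀) := he.mark_eq.trans (hl.mark _ hp₀)
    set s' : SysState N := SysState.advanceAt I s.count (s.time + e.1) e.2.2 s
      (Sum.inl p₀ : Packet N ⊕ Fin M) with hs'
    have hcount : s'.count = s.count + 1 := rfl
    have hs'time : s'.time = s.time + e.1 := rfl
    have hsnap : snapshot I π ω (s.count + 1) = s'.snaps (s.count + 1) := by
      rw [snapshot_succ, hl.hist_eq]
      have hs'snap : s'.snaps (s.count + 1) = (ENNReal.ofReal (s.time + e.1),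
        (if e.2.2 then Function.update s.fails p₀ (s.fails p₀ + 1) else s.fails),
        (if e.2.2 then s.delivered else Function.update s.delivered p₀ true)) :=
        Function.update_self (f := s.snaps) _ _
      rw [hs'snap, nextSnapshot, hTime]
      refine Prod.ext rfl (Prod.ext (funext fun p => ?_) (funext fun p => ?_))
      · have hf : (s.hist (Fin.last s.count)).2.1 = s.fails := rfl
        simp only [hl.finished_iff he, hf]
        by_cases hp : p = p₀
        · subst hp
          cases hb : e.2.2 <;> simp [← hmark₀, hb]
        · have : p₀ ≠ p := Ne.symm hp
          cases e.2.2 <;> simp [this, Function.update_of_ne hp]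
      · have hf : (s.hist (Fin.last s.count)).2.1 = s.fails := rfl
        have hd : (s.hist (Fin.last s.count)).2.2 = s.delivered := rfl
        simp only [hl.finished_iff he, hf, hd]
        by_cases hp : p = p₀
        · subst hp
          cases hb : e.2.2 <;> simp [← hmark₀, hb]
        · have : p₀ ≠ p := Ne.symm hp
          cases e.2.2 <;> simp [this, Function.update_of_ne hp]
    have hsnaps : ∀ j ≤ s'.count, snapshot I π ω j = s'.snaps j := by
      intro j hj
      rcases hj.eq_or_lt with rfl | hj
      · exact hsnap
      · rw [hl.snaps j (Nat.lt_succ_iff.1 hj)]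
        exact (Function.update_of_ne (Nat.ne_of_lt hj) _ _).symm
    -- The new state is exactly at an epoch, so no work has accrued since that epoch.
    have hepoch : (s'.snaps s'.count).1 = ENNReal.ofReal s'.time := by
      rw [hcount, ← hsnap, snapshot_succ, hl.hist_eq, nextSnapshot, hTime, hs'time]
    have hdel : s'.delivered = if e.2.2 then s.delivered
        else Function.update s.delivered p₀ true := by
      rw [SysState.delivered, hcount, hs']
      simp only [SysState.snaps, SysState.advanceAt, Function.update_self]
      rfl
    have hfail : s'.fails = if e.2.2 then Function.update s.fails p₀ (s.fails p₀ + 1)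
        else s.fails := by
      rw [SysState.fails, hcount, hs']
      simp only [SysState.snaps, SysState.advanceAt, Function.update_self]
      rfl
    have hg' : ∀ p, (run I π ω (s.count + 1)).2 p = if p = p₀ then 0 else
        work I π ω.2.2 s.hist (run I π ω s.count).2 p (ENNReal.ofReal (s.time + e.1)) := by
      intro p
      rw [run, hl.hist_eq]
      simp only [nextWork, hTime, hl.finished_iff he, Sum.inl.injEq, eq_comm (a := p₀)]
    have hwork : ∀ p, work I π ω.2.2 s'.hist (run I π ω s'.count).2 p (ENNReal.ofReal s'.time) =
        (run I π ω (s.count + 1)).2 p := by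
      intro p
      rw [← hepoch]
      exact work_epoch ω.2.2 s'.hist (run I π ω s'.count).2 p
    have hdel' : ∀ p, s'.delivered p = false → s.delivered p = false := by
      intro p hp
      rw [hdel] at hp
      by_cases hpp : p = p₀
      · rw [hpp]; exact hp₀
      · cases hb : e.2.2 <;> simpa [hb, Function.update_of_ne hpp] using hp
    have hfail' : ∀ p, p ≠ p₀ → s'.fails p = s.fails p := by
      intro p hp
      rw [hfail]
      cases e.2.2 <;> simp [Function.update_of_ne hp]
    have hpp₀ : s'.delivered p₀ = false → e.2.2 = true := by
      intro hp
      rw [hdel] at hp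
      cases hb : e.2.2
      · simp [hb] at hp
      · rfl
    have hclock : ξ' (Sum.inl p₀) = (ξ (Sum.inl p₀)).tail := by
      rw [he.clocks_eq, residualClocks, if_pos rfl]
    have hfail₀ : s'.delivered p₀ = false → s'.fails p₀ = s.fails p₀ + 1 := by
      intro hp
      rw [hfail, hpp₀ hp]
      simp
    refine ⟨hsnaps, htime, hepoch.le, fun p hp => ?_, fun p hp => ?_, fun p hp j => ?_,
      fun p hp => ?_⟩
    · rw [hwork, hg']
      by_cases hpp : p = p₀
      · subst hpp
        rw [if_pos rfl, add_zero, hfail₀ hp, hclock]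
        have := hl.later p hp₀ 0
        simp only [Clock.head, Clock.tail, this, zero_add]
      · rw [if_neg hpp, hfail' p hpp]
        exact hresid p (by simpa using hpp) (hdel' p hp)
    · by_cases hpp : p = p₀
      · subst hpp
        rw [hfail₀ hp, hclock]
        have := hl.later p hp₀ 0
        simp only [Clock.tail, this, zero_add]
      · rw [hfail' p hpp, (hmark p (by simpa using hpp)).1]
        exact hl.mark p (hdel' p hp)
    · by_cases hpp : p = p₀
      · subst hpp
        rw [hfail₀ hp, hclock, Clock.tail, hl.later p hp₀ (j + 1)]
        have : s.fails p + (j + 1 + 1) = s.fails p + 1 + (j + 1) := by ring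
        rw [this]
      · rw [hfail' p hpp, (hmark p (by simpa using hpp)).2]
        exact hl.later p (hdel' p hp) j
    · rw [hcount, hg']
      by_cases hpp : p = p₀
      · rw [if_pos hpp]
      · rw [if_neg hpp]
        refine hl.work_of_delivered ?_ _
        rw [hdel] at hp
        cases hb : e.2.2 <;> simpa [hb, Function.update_of_ne hpp] using hp
  · refine ⟨hl.snaps, htime, hl.epoch_le.trans (ENNReal.ofReal_le_ofReal ?_), fun p hp => ?_,
      fun p hp => ?_, fun p hp j => ?_, hl.idle⟩
    · change s.time ≤ s.time + e.1
      linarith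
    · exact hresid p (by simp) hp
    · exact (hmark p (by simp)).1.trans (hl.mark p hp)
    · exact ((hmark p (by simp)).2 j).trans (hl.later p hp j)

end Link

/-! ### Reading ages and service between two events -/

section Window

variable {N M : ℕ} {I : Arrivals N} {π : Policy N M} {Δ₀ : Fin N → ℝ≥0}
  {ω : Outcome N} {s : SysState N} {ξ ξ' : Packet N ⊕ Fin M → Clock}
  {e : ℝ × Fin M × Bool} {i : Packet N ⊕ Fin M}

theorem Linked.snapshot_count (hl : Linked I π ω s ξ) :
    snapshot I π ω s.count = s.snaps s.count := hl.snaps _ le_rfl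

/-- Between two events, an epoch has occurred if and only if it is recorded in the state. -/
theorem Linked.snapshot_time_le_iff (hl : Linked I π ω s ξ)
    (he : IsNextEvent I π ω.2.2 s ξ e ξ' i) {t : ℝ≥0} (h1 : s.time ≤ t)
    (h2 : (t : ℝ) < s.time + e.1) {k : ℕ} : (snapshot I π ω k).1 ≤ t ↔ k ≤ s.count := by
  constructor
  · intro hk
    by_contra! hc
    have h3 := (hl.le_nextTime he).trans ((snapshot_time_mono (I := I) (π := π) ω hc).trans hk)
    rw [← ENNReal.ofReal_coe_nnreal] at h3
    exact h2.not_ge ((ENNReal.ofReal_le_ofReal_iff t.2).1 h3)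
  · intro hk
    refine (snapshot_time_mono (I := I) (π := π) ω hk).trans ?_
    simp only [hl.snapshot_count]
    refine hl.epoch_le.trans ?_
    rw [← ENNReal.ofReal_coe_nnreal]
    exact ENNReal.ofReal_le_ofReal h1

theorem Linked.deliveredBy_iff (hl : Linked I π ω s ξ)
    (he : IsNextEvent I π ω.2.2 s ξ e ξ' i) {t : ℝ≥0} (h1 : s.time ≤ t)
    (h2 : (t : ℝ) < s.time + e.1) {p : Packet N} :
    DeliveredBy I π ω p t ↔ s.delivered p = true := by
  simp only [DeliveredBy, hl.snapshot_time_le_iff he h1 h2]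
  rw [SysState.delivered, ← hl.snapshot_count]
  exact ⟨fun ⟨k, hk, hd⟩ => snapshot_delivered_mono ω p hk hd, fun h => ⟨_, le_rfl, h⟩⟩

theorem Linked.inService_iff (hl : Linked I π ω s ξ)
    (he : IsNextEvent I π ω.2.2 s ξ e ξ' i) {t : ℝ≥0} (h1 : s.time ≤ t)
    (h2 : (t : ℝ) < s.time + e.1) {m : Fin M} {p : Packet N} :
    InService I π ω t m p ↔ server I π ω.2.2 s t m = some p := by
  have hiff : ∀ k, ((snapshot I π ω k).1 ≤ t ∧ (t : ℝ≥0∞) < (snapshot I π ω (k + 1)).1) ↔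
      k = s.count := fun k => by
    rw [← not_le, hl.snapshot_time_le_iff he h1 h2, hl.snapshot_time_le_iff he h1 h2]
    omega
  have hserver : π.act ω.2.2 (I.observed t) (run I π ω s.count).1 t m =
      server I π ω.2.2 s t m := by rw [hl.hist_eq]; rfl
  unfold InService
  constructor
  · rintro ⟨k, hk1, hk2, hk⟩
    obtain rfl := (hiff k).1 ⟨hk1, hk2⟩
    rwa [hserver] at hk
  · intro h
    have := (hiff s.count).2 rfl
    exact ⟨_, this.1, this.2, by rwa [hserver]⟩

theorem delivered_advanceAt_inl (t : ℝ) (b : Bool) (s : SysState N) (p : Packet N) :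
    (SysState.advanceAt I s.count t b s (Sum.inl p : Packet N ⊕ Fin M)).delivered =
      if b then s.delivered else Function.update s.delivered p true := by
  simp only [SysState.delivered, SysState.count, SysState.snaps, SysState.advanceAt,
    Function.update_self]

theorem latest_advanceAt_inl (κ : ℕ) (t : ℝ) (b : Bool) (s : SysState N) (p : Packet N) :
    (SysState.advanceAt I κ t b s (Sum.inl p : Packet N ⊕ Fin M)).latest =
      if b then s.latest else Function.update s.latest p.1 (max (s.latest p.1) (I.S p)) := rfl

/-- The component `latest` is the largest generation time of a delivered packet. -/
theorem isGreatest_latest (x : Source unitInterval M) (l : ℕ) (n : Fin N) :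
    IsGreatest (insert (-(Δ₀ n : ℝ))
      {z | ∃ i, (sysState I π Δ₀ x l).delivered (n, i) = true ∧ z = I.S (n, i)})
      ((sysState I π Δ₀ x l).latest n) := by
  induction l with
  | zero =>
    refine ⟨Or.inl rfl, ?_⟩
    rintro z (rfl | ⟨i, hi, _⟩)
    · exact le_rfl
    · simp [sysState, SysState.delivered, SysState.snaps] at hi
  | succ l ih =>
    rw [sysState]
    set s := sysState I π Δ₀ x l
    rw [nextState]
    rcases slotItem I π x.1 s (s.time + (x.2 l).1) (x.2 l).2.1 with p | m
    · rw [delivered_advanceAt_inl, latest_advanceAt_inl]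
      cases (x.2 l).2.2
      · simp only [Bool.false_eq_true, if_false]
        by_cases hn : n = p.1
        · subst hn
          rw [Function.update_self]
          constructor
          · rcases le_total (s.latest p.1) (I.S p) with h | h
            · rw [max_eq_right h]
              exact Or.inr ⟨p.2, by simp, rfl⟩
            · rw [max_eq_left h]
              rcases ih.1 with h' | ⟨i, hi, h'⟩
              · exact Or.inl h'
              · refine Or.inr ⟨i, ?_, h'⟩
                by_cases hip : ((p.1, i) : Packet N) = p
                · rw [hip]; simp
                · rw [Function.update_of_ne hip, hi]
          · rintro z (rfl | ⟨i, hi, rfl⟩)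
            · exact (ih.2 (Or.inl rfl)).trans (le_max_left _ _)
            · by_cases hip : ((p.1, i) : Packet N) = p
              · rw [hip]; exact le_max_right _ _
              · rw [Function.update_of_ne hip] at hi
                exact (ih.2 (Or.inr ⟨i, hi, rfl⟩)).trans (le_max_left _ _)
        · rw [Function.update_of_ne hn]
          have : ∀ i, Function.update s.delivered p true (n, i) = s.delivered (n, i) := fun i =>
            Function.update_of_ne (fun h => hn (congrArg Prod.fst h)) _ _
          simp only [this]
          exact ih
      · simpa using ih
    · exact ih

theorem Linked.age_eq {x : Source unitInterval M} {l : ℕ}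
    (hl : Linked I π ω (sysState I π Δ₀ x l) ξ)
    (he : IsNextEvent I π ω.2.2 (sysState I π Δ₀ x l) ξ e ξ' i) {t : ℝ≥0}
    (h1 : (sysState I π Δ₀ x l).time ≤ t) (h2 : (t : ℝ) < (sysState I π Δ₀ x l).time + e.1)
    (n : Fin N) : age I π Δ₀ ω t n = t - (sysState I π Δ₀ x l).latest n := by
  simp only [age, hl.deliveredBy_iff he h1 h2]
  rw [(isGreatest_latest (I := I) (π := π) (Δ₀ := Δ₀) x l n).csSup_eq]

theorem linked_zero {x : Source unitInterval M}
    (hξ : ∀ p j, ξ (Sum.inl p) j = (ω.1 (p, j), ω.2.1 (p, j))) :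
    Linked I π ω (sysState I π Δ₀ x 0) ξ where
  snaps j hj := by
    obtain rfl : j = 0 := Nat.le_zero.1 hj
    rfl
  time_nonneg := le_rfl
  epoch_le := by simp [sysState, SysState.snaps]
  head p _ := by
    have h0 : work I π ω.2.2 (sysState I π Δ₀ x 0).hist
        (run I π ω (sysState I π Δ₀ x 0).count).2 p
        (ENNReal.ofReal (sysState I π Δ₀ x 0).time) = 0 := by
      have h1 : (sysState I π Δ₀ x 0).time = 0 := rfl
      rw [h1, ENNReal.ofReal_zero]
      simp only [work, not_lt_zero, and_false]
      simp [run, sysState, SysState.count]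
    rw [h0, add_zero, Clock.head, hξ]
    rfl
  mark p _ := by rw [hξ]; rfl
  later p _ j := by
    have : (sysState I π Δ₀ x 0).fails p = 0 := rfl
    rw [hξ, this, zero_add]
  idle p hp := by simp [sysState, SysState.delivered, SysState.snaps] at hp

/-- An outcome `ω` of the system is driven by the source `x`. -/
def DrivenBy (I : Arrivals N) (π : Policy N M) (Δ₀ : Fin N → ℝ≥0) (ω : Outcome N)
    (x : Source unitInterval M) : Prop :=
  ω.2.2 = x.1 ∧ ∀ l, ∃ ξ ξ' i, Linked I π ω (sysState I π Δ₀ x l) ξ ∧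
    IsNextEvent I π ω.2.2 (sysState I π Δ₀ x l) ξ (x.2 l) ξ' i

theorem sysState_time_succ (x : Source unitInterval M) (l : ℕ) :
    (sysState I π Δ₀ x (l + 1)).time = (sysState I π Δ₀ x l).time + (x.2 l).1 := by
  rw [sysState, nextState]
  rcases slotItem I π x.1 _ _ _ with p | m <;> rfl

theorem DrivenBy.gap_pos {x : Source unitInterval M} (h : DrivenBy I π Δ₀ ω x) (l : ℕ) :
    0 < (x.2 l).1 := by
  obtain ⟨ξ, ξ', i, _, he⟩ := h.2 l
  exact he.gap_pos

variable {x : Source unitInterval M} (h : DrivenBy I π Δ₀ ω x) {t : ℝ≥0} {l : ℕ}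
  (h1 : (sysState I π Δ₀ x l).time ≤ t) (h2 : (t : ℝ) < (sysState I π Δ₀ x (l + 1)).time)

include h h1 h2

theorem DrivenBy.age_eq (n : Fin N) :
    age I π Δ₀ ω t n = t - (sysState I π Δ₀ x l).latest n := by
  obtain ⟨ξ, ξ', i, hl, he⟩ := h.2 l
  exact hl.age_eq he h1 (by rwa [← sysState_time_succ]) n

theorem DrivenBy.deliveredBy_iff (p : Packet N) :
    DeliveredBy I π ω p t ↔ (sysState I π Δ₀ x l).delivered p = true := by
  obtain ⟨ξ, ξ', i, hl, he⟩ := h.2 l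
  exact hl.deliveredBy_iff he h1 (by rwa [← sysState_time_succ])

theorem DrivenBy.inService_iff {m : Fin M} {p : Packet N} :
    InService I π ω t m p ↔ server I π x.1 (sysState I π Δ₀ x l) t m = some p := by
  obtain ⟨ξ, ξ', i, hl, he⟩ := h.2 l
  rw [← h.1]
  exact hl.inService_iff he h1 (by rwa [← sysState_time_succ])

end Window

/-! ### Extended outcomes and their driving source -/

section Coupling

variable {N M : ℕ}

/-- Outcomes together with dummy clocks for the servers and an auxiliary sequence of events. -/
abbrev ExtOutcome (N M : ℕ) :=
  Outcome N × ((Fin M → Clock) × (ℕ → ℝ × Fin M × Bool))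

/-- The source and the clocks given by an extended outcome. -/
def ExtOutcome.clocks (z : ExtOutcome N M) :
    Source unitInterval M × (Packet N ⊕ Fin M → Clock) :=
  ((z.1.2.2, z.2.2), Sum.elim (fun p j => (z.1.1 (p, j), z.1.2.1 (p, j))) z.2.1)

variable (I : Arrivals N) (π : Policy N M) (Δ₀ : Fin N → ℝ≥0)

/-- The source that drives an extended outcome under policy `π`. -/
def drivingSource [NeZero M] (z : ExtOutcome N M) : Source unitInterval M :=
  sourceOf (sysAssignment I π Δ₀) z.clocks

variable {I π Δ₀} [NeZero M]

/-- Almost surely every event is the first completion in the current state, so `Linked` propagates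
by induction. The outcome enters only through its randomization and its packet clocks, hence the
universal quantifier over `ω`. -/
theorem ae_drivenBy {μ : ℝ} {β : Measure Bool} [Fact (0 < μ)] [IsProbabilityMeasure β]
    {ρ : Measure unitInterval} [IsProbabilityMeasure ρ] :
    ∀ᵐ z ∂(sourceLaw ρ μ β M).prod (clocksLaw (Packet N ⊕ Fin M) μ β),
      ∀ ω : Outcome N, ω.2.2 = z.1.1 →
        (∀ p j, z.2 (Sum.inl p) j = (ω.1 (p, j), ω.2.1 (p, j))) →
        DrivenBy I π Δ₀ ω (sourceOf (sysAssignment I π Δ₀) z) := by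
  filter_upwards [(isCausal_sysAssignment (I := I) (π := π) (Δ₀ := Δ₀)).ae_path (ρ := ρ)
    (μ := μ) (β := β)] with z hz ω hω hξ
  have hr : ω.2.2 = (sourceOf (sysAssignment I π Δ₀) z).1 := hω
  set x := sourceOf (sysAssignment I π Δ₀) z
  have hnext : ∀ l, ∃ i, IsNextEvent I π ω.2.2 (sysState I π Δ₀ x l)
      (iter (sysAssignment I π Δ₀) l z).2 (x.2 l)
      (iter (sysAssignment I π Δ₀) (l + 1) z).2 i := by
    intro l
    obtain ⟨_, i, h1, h2, h3, h4⟩ := hz l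
    rw [hr]
    exact ⟨i, h1, h2, h3, h4⟩
  have hlinked : ∀ l, Linked I π ω (sysState I π Δ₀ x l)
      (iter (sysAssignment I π Δ₀) l z).2 := by
    intro l
    induction l with
    | zero => exact linked_zero hξ
    | succ l ih =>
      obtain ⟨i, he⟩ := hnext l
      have := ih.next he
      rw [hr] at this
      exact this
  exact ⟨hr, fun l => by
    obtain ⟨i, he⟩ := hnext l
    exact ⟨_, _, i, hlinked l, he⟩⟩

end Coupling

/-! ### The law of the extended outcomes -/

section ExtLaw

/-- The index type is arbitrary, so only finite boxes are tested. The two factors are extended from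
boxes to measurable sets one after the other, each time by `eq_smul_infinitePi`. -/
theorem measurePreserving_unzip {ι A B : Type*} [MeasurableSpace A] [MeasurableSpace B]
    (ν : Measure A) (ν' : Measure B) [IsProbabilityMeasure ν] [IsProbabilityMeasure ν'] :
    MeasurePreserving (fun f : ι → A × B => ((fun i => (f i).1), fun i => (f i).2))
      (Measure.infinitePi fun _ => ν.prod ν')
      ((Measure.infinitePi fun _ => ν).prod (Measure.infinitePi fun _ => ν')) := by
  classical
  set U : (ι → A × B) → (ι → A) × (ι → B) := fun f => ((fun i => (f i).1), fun i => (f i).2)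
  have hU : Measurable U := by fun_prop
  refine ⟨hU, ?_⟩
  set P := (Measure.infinitePi fun _ : ι => ν.prod ν').map U with hP
  have : IsProbabilityMeasure P := Measure.isProbabilityMeasure_map hU.aemeasurable
  have h1 : ∀ (s : Finset ι) (t : ι → Set A) (s' : Finset ι) (t' : ι → Set B),
      (∀ i, MeasurableSet (t i)) → (∀ i, MeasurableSet (t' i)) →
      P ((s : Set ι).pi t ×ˢ (s' : Set ι).pi t') =
        (∏ i ∈ s', ν' (t' i)) * ∏ i ∈ s, ν (t i) := by
    intro s t s' t' ht ht'
    rw [hP, Measure.map_apply hU ((MeasurableSet.pi s.countable_toSet fun i _ => ht i).prod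
      (MeasurableSet.pi s'.countable_toSet fun i _ => ht' i))]
    have e : U ⁻¹' (s : Set ι).pi t ×ˢ (s' : Set ι).pi t' = ((s ∪ s' : Finset ι) : Set ι).pi
        fun i => (if i ∈ s then t i else Set.univ) ×ˢ (if i ∈ s' then t' i else Set.univ) := by
      ext f
      simp only [Set.mem_preimage, Set.mem_prod, Set.mem_pi, Finset.mem_coe, Finset.mem_union, U]
      constructor
      · rintro ⟨h, h'⟩ i _
        constructor
        · split_ifs with hi
          exacts [h i hi, trivial]
        · split_ifs with hi
          exacts [h' i hi, trivial]
      · intro h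
        refine ⟨fun i hi => ?_, fun i hi => ?_⟩
        · simpa [hi] using (h i (Or.inl hi)).1
        · simpa [hi] using (h i (Or.inr hi)).2
    rw [e, Measure.infinitePi_pi]
    · simp_rw [Measure.prod_prod]
      rw [Finset.prod_mul_distrib, mul_comm]
      congr 1
      · rw [← Finset.prod_subset (Finset.subset_union_right (s₁ := s) (s₂ := s'))]
        · exact Finset.prod_congr rfl fun i hi => by rw [if_pos hi]
        · intro i _ hi
          rw [if_neg hi, measure_univ]
      · rw [← Finset.prod_subset (Finset.subset_union_left (s₁ := s) (s₂ := s'))]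
        · exact Finset.prod_congr rfl fun i hi => by rw [if_pos hi]
        · intro i _ hi
          rw [if_neg hi, measure_univ]
    · intro i _
      refine MeasurableSet.prod ?_ ?_
      · split_ifs
        exacts [ht i, .univ]
      · split_ifs
        exacts [ht' i, .univ]
  have h2 : ∀ (s' : Finset ι) (t' : ι → Set B), (∀ i, MeasurableSet (t' i)) →
      ∀ A, MeasurableSet A → P (A ×ˢ (s' : Set ι).pi t') =
        (∏ i ∈ s', ν' (t' i)) * Measure.infinitePi (fun _ => ν) A := by
    intro s' t' ht' A hA
    have hB : MeasurableSet ((s' : Set ι).pi t') := .pi s'.countable_toSet fun i _ => ht' i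
    set Q := (P.restrict (Set.univ ×ˢ (s' : Set ι).pi t')).map Prod.fst with hQ
    have hQA : ∀ A, MeasurableSet A → Q A = P (A ×ˢ (s' : Set ι).pi t') := fun A hA => by
      rw [hQ, Measure.map_apply measurable_fst hA, Measure.restrict_apply (measurable_fst hA)]
      congr 1
      ext; simp
    rw [← hQA A hA]
    have : Q = (∏ i ∈ s', ν' (t' i)) • Measure.infinitePi (fun _ => ν) :=
      eq_smul_infinitePi fun s t ht => by
        rw [hQA _ (.pi s.countable_toSet fun i _ => ht i), h1 s t s' t' ht ht']
    rw [this]; simp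
  symm
  refine Measure.prod_eq fun A B hA hB => ?_
  set Q := (P.restrict (A ×ˢ Set.univ)).map Prod.snd with hQ
  have hQB : ∀ B, MeasurableSet B → Q B = P (A ×ˢ B) := fun B hB => by
    rw [hQ, Measure.map_apply measurable_snd hB, Measure.restrict_apply (measurable_snd hB)]
    congr 1
    ext; simp [and_comm]
  rw [← hQB B hB]
  have : Q = (Measure.infinitePi (fun _ => ν) A) • Measure.infinitePi (fun _ => ν') :=
    eq_smul_infinitePi fun s t ht => by
      rw [hQB _ (.pi s.countable_toSet fun i _ => ht i), h2 s t ht A hA, mul_comm]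
  rw [this]; simp

theorem measurePreserving_zip {ι A B : Type*} [MeasurableSpace A] [MeasurableSpace B]
    (ν : Measure A) (ν' : Measure B) [IsProbabilityMeasure ν] [IsProbabilityMeasure ν'] :
    MeasurePreserving (fun (z : (ι → A) × (ι → B)) i => (z.1 i, z.2 i))
      ((Measure.infinitePi fun _ => ν).prod (Measure.infinitePi fun _ => ν'))
      (Measure.infinitePi fun _ => ν.prod ν') :=
  MeasurePreserving.symm (MeasurableEquiv.arrowProdEquivProdArrow A B ι)
    (measurePreserving_unzip ν ν')

theorem measurePreserving_sumElim {ι ι' A : Type*} [MeasurableSpace A] (ν : Measure A)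
    [IsProbabilityMeasure ν] :
    MeasurePreserving (fun z : (ι → A) × (ι' → A) => Sum.elim z.1 z.2)
      ((Measure.infinitePi fun _ => ν).prod (Measure.infinitePi fun _ => ν))
      (Measure.infinitePi fun _ => ν) := by
  have hm : Measurable fun z : (ι → A) × (ι' → A) => Sum.elim z.1 z.2 := by
    refine measurable_pi_iff.2 fun i => ?_
    rcases i with i | i
    · exact (measurable_pi_apply i).comp measurable_fst
    · exact (measurable_pi_apply i).comp measurable_snd
  refine ⟨hm, Measure.eq_infinitePi _ fun s t ht => ?_⟩
  rw [Measure.map_apply hm (.pi s.countable_toSet fun i _ => ht i)]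
  have : (fun z : (ι → A) × (ι' → A) => Sum.elim z.1 z.2) ⁻¹' (s : Set (ι ⊕ ι')).pi t =
      ((s.toLeft : Set ι).pi fun i => t (Sum.inl i)) ×ˢ
        ((s.toRight : Set ι').pi fun i => t (Sum.inr i)) := by
    ext z
    simp [Set.mem_pi]
  rw [this, Measure.prod_prod, Measure.infinitePi_pi _ fun i _ => ht _,
    Measure.infinitePi_pi _ fun i _ => ht _, Finset.prod_sum_eq_prod_toLeft_mul_prod_toRight]

variable {N M : ℕ} (μ : ℝ) (hμ : 0 < μ) (q : unitInterval)

/-- The law of the error marks. -/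
abbrev errorLaw : Measure Bool := bernoulliMeasure true false q

/-- The law of the extended outcomes. -/
def extLaw (N M : ℕ) : Measure (ExtOutcome N M) :=
  (law N μ hμ q).prod ((Measure.infinitePi fun _ => clockLaw μ (errorLaw q)).prod
    (Measure.infinitePi fun _ => eventLaw μ (errorLaw q) M))

instance : IsProbabilityMeasure (law N μ hμ q) := by
  have : Fact (0 < μ) := ⟨hμ⟩
  unfold law
  infer_instance

instance [Fact (0 < μ)] [NeZero M] : IsProbabilityMeasure (extLaw μ hμ q N M) := by
  unfold extLaw
  infer_instance

/-- A rearrangement of independent factors: times `a` and marks `b` are zipped and curried into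
packet clocks and joined with the dummy clocks `d`, while the randomization `c` and the placeholder
events `f` form the source. -/
theorem measurePreserving_clocks [Fact (0 < μ)] [NeZero M] :
    MeasurePreserving (ExtOutcome.clocks (N := N) (M := M)) (extLaw μ hμ q N M)
      ((sourceLaw volume μ (errorLaw q) M).prod
        (clocksLaw (Packet N ⊕ Fin M) μ (errorLaw q))) := by
  set a : Measure (Packet N × ℕ → ℝ) := Measure.infinitePi fun _ => expMeasure μ
  set b : Measure (Packet N × ℕ → Bool) := Measure.infinitePi fun _ => errorLaw q
  set c : Measure unitInterval := volume
  set d : Measure (Fin M → Clock) := Measure.infinitePi fun _ => clockLaw μ (errorLaw q)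
  set f : Measure (ℕ → ℝ × Fin M × Bool) :=
    Measure.infinitePi fun _ => eventLaw μ (errorLaw q) M
  have hcurry : MeasurePreserving (MeasurableEquiv.curry (Packet N) ℕ (ℝ × Bool))
      (Measure.infinitePi fun _ => (expMeasure μ).prod (errorLaw q))
      (Measure.infinitePi fun _ => clockLaw μ (errorLaw q)) :=
    ⟨MeasurableEquiv.measurable _, Measure.infinitePi_map_curry
      (fun _ _ => (expMeasure μ).prod (errorLaw q))⟩
  have hzip := hcurry.comp (measurePreserving_zip (ι := Packet N × ℕ) (expMeasure μ) (errorLaw q))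
  have s1 : MeasurePreserving (MeasurableEquiv.prodAssoc.symm :
      (Packet N × ℕ → ℝ) × (Packet N × ℕ → Bool) × unitInterval ≃ᵐ _)
      (a.prod (b.prod c)) ((a.prod b).prod c) :=
    (measurePreserving_prodAssoc a b c).symm MeasurableEquiv.prodAssoc
  have s2 := (measurePreserving_prodAssoc (a.prod b) c (d.prod f)).comp
    (s1.prod (MeasurePreserving.id (d.prod f)))
  have s3 := (MeasurePreserving.id (a.prod b)).prod
    ((Measure.measurePreserving_swap (μ := c.prod f) (ν := d)).comp
      (((measurePreserving_prodAssoc c f d).symm MeasurableEquiv.prodAssoc).comp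
        ((MeasurePreserving.id c).prod (Measure.measurePreserving_swap (μ := d) (ν := f)))))
  have s4 := (Measure.measurePreserving_swap (μ := (a.prod b).prod d) (ν := c.prod f)).comp
    ((measurePreserving_prodAssoc (a.prod b) d (c.prod f)).symm MeasurableEquiv.prodAssoc)
  have s5 := (MeasurePreserving.id (c.prod f)).prod
    ((measurePreserving_sumElim (ι := Packet N) (ι' := Fin M) (clockLaw μ (errorLaw q))).comp
      (hzip.prod (MeasurePreserving.id d)))
  exact s5.comp (s4.comp (s3.comp s2))

end ExtLaw

/-! ### The common law of the driving sources -/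

section Driven

variable {N M : ℕ} [NeZero M] {I : Arrivals N} {π : Policy N M} {Δ₀ : Fin N → ℝ≥0}
  {μ : ℝ} [Fact (0 < μ)] {hμ : 0 < μ} {q : unitInterval}

/-- The law on the right does not involve the policy; this is what makes two systems comparable. -/
theorem measurePreserving_drivingSource :
    MeasurePreserving (drivingSource I π Δ₀) (extLaw μ hμ q N M)
      (sourceLaw volume μ (errorLaw q) M) :=
  isCausal_sysAssignment.measurePreserving_sourceOf.comp (measurePreserving_clocks μ hμ q)

theorem ae_drivenBy_drivingSource :
    ∀ᵐ z ∂extLaw μ hμ q N M, DrivenBy I π Δ₀ z.1 (drivingSource I π Δ₀ z) := by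
  have h := (measurePreserving_clocks (N := N) (M := M) μ hμ q).quasiMeasurePreserving.ae
    (ae_drivenBy (I := I) (π := π) (Δ₀ := Δ₀))
  filter_upwards [h] with z hz
  exact hz z.1 rfl fun p j => rfl

theorem eventLaw_le_lt_one {β : Measure Bool} [IsProbabilityMeasure β] {c : ℝ} (hc : 0 ≤ c) :
    eventLaw μ β M {e | e.1 ≤ c} < 1 := by
  have : eventLaw μ β M {e | e.1 ≤ c} = expMeasure (M * μ) (Set.Iic c) := by
    have h : {e : ℝ × Fin M × Bool | e.1 ≤ c} = Set.Iic c ×ˢ Set.univ := by ext; simp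
    rw [h, eventLaw, Measure.prod_prod, measure_univ, mul_one]
  rw [this]
  refine lt_of_le_of_ne prob_le_one fun h => ?_
  have h1 := (prob_compl_eq_zero_iff measurableSet_Iic).2 h
  rw [Set.compl_Iic, expMeasure_Ioi Fact.out hc, ENNReal.ofReal_eq_zero] at h1
  exact absurd h1 (not_le.2 (Real.exp_pos _))

/-- The probability that `m` consecutive gaps are at most `1` is the `m`-th power of a number below
one. -/
theorem ae_exists_gap {β : Measure Bool} [IsProbabilityMeasure β] {ρ : Measure unitInterval}
    [IsProbabilityMeasure ρ] :
    ∀ᵐ x ∂sourceLaw ρ μ β M, ∀ n, ∃ l ≥ n, 1 < (x.2 l).1 := by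
  rw [ae_all_iff]
  intro n
  have h2 : ∀ᵐ f ∂Measure.infinitePi fun _ : ℕ => eventLaw μ β M, ∃ l ≥ n, 1 < (f l).1 := by
    rw [ae_iff]
    set T : Set (ℝ × Fin M × Bool) := {e | e.1 ≤ 1}
    have hT : MeasurableSet T := measurableSet_le measurable_fst measurable_const
    refine le_antisymm (ge_of_tendsto' (ENNReal.tendsto_pow_atTop_nhds_zero_of_lt_one
      (eventLaw_le_lt_one (μ := μ) (β := β) (M := M) zero_le_one)) fun m => ?_) zero_le
    calc _ ≤ (Measure.infinitePi fun _ : ℕ => eventLaw μ β M)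
          ((Finset.Ico n (n + m) : Set ℕ).pi fun _ => T) := by
          refine measure_mono fun f hf j hj => ?_
          simp only [Set.mem_ofPred_eq, not_exists, not_and, not_lt] at hf
          exact hf j (Finset.mem_Ico.1 hj).1
      _ = _ := by
          rw [Measure.infinitePi_pi _ fun _ _ => hT]
          simp [T]
  exact (measurePreserving_snd (μ := ρ)).quasiMeasurePreserving.ae h2

end Driven

/-! ### Event times exhaust the half-line -/

section Window

variable {N M : ℕ} {I : Arrivals N} {π : Policy N M} {Δ₀ : Fin N → ℝ≥0}
  {x : Source unitInterval M}

theorem exists_window (hpos : ∀ l, 0 < (x.2 l).1) (hgap : ∀ n, ∃ l ≥ n, 1 < (x.2 l).1)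
    (t : ℝ≥0) : ∃ l, (sysState I π Δ₀ x l).time ≤ t ∧ (t : ℝ) < (sysState I π Δ₀ x (l + 1)).time := by
  have hmono : Monotone fun l => (sysState I π Δ₀ x l).time :=
    monotone_nat_of_le_succ fun l => by rw [sysState_time_succ]; linarith [hpos l]
  -- Each further gap above `1` gains more than one unit of time; the added `1` makes the strict
  -- inequality true at the start.
  have hunb : ∀ n : ℕ, ∃ l, (n : ℝ) < (sysState I π Δ₀ x l).time + 1 := by
    intro n
    induction n with
    | zero => exact ⟨0, by simp [sysState, SysState.time]⟩
    | succ n ih =>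
      obtain ⟨l, hl⟩ := ih
      obtain ⟨l', hl', hg⟩ := hgap l
      refine ⟨l' + 1, ?_⟩
      have := hmono hl'
      rw [sysState_time_succ]
      push_cast
      simp only at this
      linarith
  have hex : ∃ l, (t : ℝ) < (sysState I π Δ₀ x l).time := by
    obtain ⟨n, hn⟩ := exists_nat_ge ((t : ℝ) + 1)
    obtain ⟨l, hl⟩ := hunb n
    exact ⟨l, by linarith⟩
  classical
  have hf := Nat.find_spec hex
  rcases hn : Nat.find hex with _ | l
  · rw [hn] at hf
    simp only [sysState, SysState.time] at hf
    exact absurd hf (not_lt.2 t.2)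
  · rw [hn] at hf
    exact ⟨l, not_lt.1 (Nat.find_min hex (hn ▸ l.lt_succ_self)), hf⟩

end Window

/-! ### The service rule expressed through states -/

section Rule

variable {N M : ℕ}

/-- At time `t`, `p` is a most recently generated arrived packet of its flow. -/
def IsFresh (I : Arrivals N) (t : ℝ) (p : Packet N) : Prop :=
  I.A p ≤ t ∧ ∀ i, I.A (p.1, i) ≤ t → I.S (p.1, i) ≤ I.S p

/-- In state `s` at time `t`, the most recently generated packets are served in decreasing order
of the age of their flows. -/
def FreshRule (I : Arrivals N) (π : Policy N M) (r : unitInterval) (s : SysState N) (t : ℝ) :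
    Prop :=
  ∀ n i, IsFresh I t (n, i) → s.latest n < I.S (n, i) →
    (∃ m j, server I π r s t m = some (n, j) ∧ IsFresh I t (n, j)) ∨
    ∀ m, ∃ p, server I π r s t m = some p ∧ IsFresh I t p ∧ s.latest p.1 ≤ s.latest n

variable {I : Arrivals N} {π : Policy N M} {Δ₀ : Fin N → ℝ≥0}

theorem measurableSet_isFresh (p : Packet N) : MeasurableSet {t : ℝ | IsFresh I t p} := by
  have : {t : ℝ | IsFresh I t p} = Set.Ici (I.A p) ∩
      ⋂ i, ((Set.Ici (I.A (p.1, i)))ᶜ ∪ {_t | I.S (p.1, i) ≤ I.S p}) := by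
    ext t
    simp only [IsFresh, Set.mem_ofPred_eq, Set.mem_inter_iff, Set.mem_Ici, Set.mem_iInter,
      Set.mem_union, Set.mem_compl_iff, imp_iff_not_or]
  rw [this]
  exact measurableSet_Ici.inter (MeasurableSet.iInter fun i =>
    measurableSet_Ici.compl.union (.const _))

theorem measurableSet_freshRule :
    MeasurableSet {z : unitInterval × SysState N × ℝ | FreshRule I π z.1 z.2.1 z.2.2} := by
  have hl : ∀ n, Measurable fun z : unitInterval × SysState N × ℝ => z.2.1.latest n := fun n =>
    (measurable_pi_apply n).comp (SysState.measurable_latest.comp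
      (measurable_fst.comp measurable_snd))
  have hf : ∀ p, MeasurableSet {z : unitInterval × SysState N × ℝ | IsFresh I z.2.2 p} := fun p =>
    (measurable_snd.comp measurable_snd) (measurableSet_isFresh p)
  have : {z : unitInterval × SysState N × ℝ | FreshRule I π z.1 z.2.1 z.2.2} =
      ⋂ n, ⋂ i, ({z | IsFresh I z.2.2 (n, i)}ᶜ ∪ ({z | z.2.1.latest n < I.S (n, i)}ᶜ ∪
        ((⋃ m, ⋃ j, {z | server I π z.1 z.2.1 z.2.2 m = some (n, j)} ∩
            {z | IsFresh I z.2.2 (n, j)}) ∪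
          ⋂ m, ⋃ p : Packet N, {z | server I π z.1 z.2.1 z.2.2 m = some p} ∩
            ({z | IsFresh I z.2.2 p} ∩ {z | z.2.1.latest p.1 ≤ z.2.1.latest n})))) := by
    ext z
    simp only [FreshRule, Set.mem_ofPred_eq, Set.mem_inter_iff, Set.mem_iInter, Set.mem_iUnion,
      Set.mem_union, Set.mem_compl_iff, imp_iff_not_or]
  rw [this]
  refine MeasurableSet.iInter fun n => MeasurableSet.iInter fun i => (hf _).compl.union
    ((measurableSet_lt (hl n) measurable_const).compl.union (MeasurableSet.union ?_ ?_))
  · exact MeasurableSet.iUnion fun m => MeasurableSet.iUnion fun j =>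
      (measurableSet_server _ _).inter (hf _)
  · exact MeasurableSet.iInter fun m => MeasurableSet.iUnion fun p =>
      (measurableSet_server _ _).inter ((hf _).inter (measurableSet_le (hl _) (hl _)))

/-- If a freshest packet is newer than `latest`, no freshest packet of that flow has been delivered,
so the flow is `FreshPending`. At a common time, larger age means smaller `latest`. -/
theorem DrivenBy.freshRule {ω : Outcome N} {x : Source unitInterval M}
    (h : DrivenBy I π Δ₀ ω x) {t : ℝ≥0} {l : ℕ} (h1 : (sysState I π Δ₀ x l).time ≤ t)
    (h2 : (t : ℝ) < (sysState I π Δ₀ x (l + 1)).time) (hr : MAFRuleAt I π Δ₀ ω t) :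
    FreshRule I π x.1 (sysState I π Δ₀ x l) t := by
  intro n i hi hlt
  have hp : FreshPending I π ω t n := by
    refine ⟨⟨i, hi⟩, fun j hj hd => ?_⟩
    rw [h.deliveredBy_iff h1 h2] at hd
    have h3 := (isGreatest_latest (I := I) (π := π) (Δ₀ := Δ₀) x l n).2 (Or.inr ⟨j, hd, rfl⟩)
    exact absurd (hlt.trans_le (hj.2 i hi.1)) (not_lt.2 h3)
  rw [or_iff_not_imp_left]
  intro hn m
  obtain ⟨p, hp1, hp2, hp3⟩ := hr.1 n hp (by
    rintro ⟨m, j, hm, hj⟩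
    exact hn ⟨m, j, (h.inService_iff h1 h2).1 hm, hj⟩) m
  refine ⟨p, (h.inService_iff h1 h2).1 hp1, hp2, ?_⟩
  rw [h.age_eq h1 h2, h.age_eq h1 h2] at hp3
  linarith

theorem sysState_update (x : Source unitInterval M) (l : ℕ) (e : ℝ × Fin M × Bool) :
    sysState I π Δ₀ (x.1, Function.update x.2 l e) l = sysState I π Δ₀ x l :=
  sysState_congr rfl fun _ hj => Function.update_of_ne (ne_of_lt hj) _ _

theorem measurableSet_sysState_freshRule {α : Type*} [MeasurableSpace α]
    {f : α → Source unitInterval M} (hf : Measurable f) {g : α → ℝ} (hg : Measurable g) (l : ℕ) :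
    MeasurableSet {a | FreshRule I π (f a).1 (sysState I π Δ₀ (f a) l)
      ((sysState I π Δ₀ (f a) l).time + g a)} := by
  have hs : Measurable fun a => sysState I π Δ₀ (f a) l := (measurable_sysState l).comp hf
  exact ((measurable_fst.comp hf).prodMk (hs.prodMk
    ((SysState.measurable_time.comp hs).add hg))) measurableSet_freshRule

theorem sysState_time_nonneg {x : Source unitInterval M} (hx : ∀ l, 0 < (x.2 l).1) (l : ℕ) :
    0 ≤ (sysState I π Δ₀ x l).time := by
  induction l with
  | zero => exact le_rfl
  | succ l ih => rw [sysState_time_succ]; linarith [hx l]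

end Rule

/-! ### The rule right before an event -/

section EventTimes

variable {N M : ℕ} [NeZero M] {I : Arrivals N} {π : Policy N M} {Δ₀ : Fin N → ℝ≥0}
  {μ : ℝ} [Fact (0 < μ)] {hμ : 0 < μ} {q : unitInterval}

/-- While the gap exceeds `c`, the time in question lies before the next event, so the state is the
actual one and the hypothesis on the policy applies. -/
theorem ae_freshRule_of_lt (hP : IsPMAFLGFS I π (law N μ hμ q) Δ₀) (l : ℕ) {c : ℝ} (hc : 0 ≤ c) :
    ∀ᵐ x ∂sourceLaw volume μ (errorLaw q) M, c < (x.2 l).1 →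
      FreshRule I π x.1 (sysState I π Δ₀ x l) ((sysState I π Δ₀ x l).time + c) := by
  have hm : MeasurableSet {x : Source unitInterval M | c < (x.2 l).1 →
      FreshRule I π x.1 (sysState I π Δ₀ x l) ((sysState I π Δ₀ x l).time + c)} := by
    have hlt : MeasurableSet {x : Source unitInterval M | c < (x.2 l).1} :=
      measurableSet_lt measurable_const (by fun_prop)
    have h := hlt.compl.union (measurableSet_sysState_freshRule (I := I) (π := π) (Δ₀ := Δ₀)
      (measurable_id (α := Source unitInterval M)) (measurable_const (a := c)) l)
    convert h using 1
    ext x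
    simp only [Set.mem_ofPred_eq, Set.mem_union, Set.mem_compl_iff, imp_iff_not_or]
    rfl
  have hd := measurePreserving_drivingSource (I := I) (π := π) (Δ₀ := Δ₀) (hμ := hμ) (q := q)
  rw [← hd.map_eq, ae_map_iff hd.measurable.aemeasurable hm]
  have hr : ∀ᵐ z ∂extLaw μ hμ q N M, ∀ t : ℝ≥0, MAFRuleAt I π Δ₀ z.1 t :=
    (measurePreserving_fst (μ := law N μ hμ q)).quasiMeasurePreserving.ae hP
  filter_upwards [hr, ae_drivenBy_drivingSource (I := I) (π := π) (Δ₀ := Δ₀) (hμ := hμ) (q := q)]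
    with z hz hdz hlt
  set x := drivingSource I π Δ₀ z
  have h0 := sysState_time_nonneg (I := I) (π := π) (Δ₀ := Δ₀) hdz.gap_pos l
  have h := hdz.freshRule (t := ⟨_, add_nonneg h0 hc⟩) (l := l)
    (le_add_of_nonneg_right hc) (by
      rw [sysState_time_succ]; exact add_lt_add_right hlt _) (hz _)
  exact h

/-- The rule at this time is determined by the events before `l`, and the gap exceeds `c` with
positive probability independently of them. Hence the rule cannot fail with positive probability,
whatever the gap is. -/
theorem ae_freshRule_add (hP : IsPMAFLGFS I π (law N μ hμ q) Δ₀) (l : ℕ) {c : ℝ} (hc : 0 ≤ c) :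
    ∀ᵐ x ∂sourceLaw volume μ (errorLaw q) M,
      FreshRule I π x.1 (sysState I π Δ₀ x l) ((sysState I π Δ₀ x l).time + c) := by
  have h := (measurePreserving_source_update (volume : Measure unitInterval) μ (errorLaw q) (M := M)
    l).quasiMeasurePreserving.ae (ae_freshRule_of_lt hP l hc)
  filter_upwards [Measure.ae_ae_of_ae_prod h] with x hx
  -- A failure for `x` would force almost every resampled gap to be at most `c`.
  by_contra hn
  refine (eventLaw_le_lt_one (μ := μ) (β := errorLaw q) (M := M) hc).ne ?_
  refine (prob_compl_eq_zero_iff (measurableSet_le measurable_fst measurable_const)).1 ?_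
  refine measure_eq_zero_iff_ae_notMem.2 ?_
  filter_upwards [hx] with e he
  intro hlt
  refine hn ?_
  have h1 := he (by simpa using hlt)
  rwa [sysState_update] at h1

/-- The rule holds right before every event. -/
theorem ae_freshRule (hP : IsPMAFLGFS I π (law N μ hμ q) Δ₀) :
    ∀ᵐ x ∂sourceLaw volume μ (errorLaw q) M, ∀ l,
      FreshRule I π x.1 (sysState I π Δ₀ x l) ((sysState I π Δ₀ x l).time + (x.2 l).1) := by
  rw [ae_all_iff]
  intro l
  have hu := measurePreserving_source_update (volume : Measure unitInterval) μ (errorLaw q) (M := M) l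
  have hm : MeasurableSet {x : Source unitInterval M |
      FreshRule I π x.1 (sysState I π Δ₀ x l) ((sysState I π Δ₀ x l).time + (x.2 l).1)} :=
    measurableSet_sysState_freshRule measurable_id (by fun_prop) l
  rw [← hu.map_eq, ae_map_iff hu.measurable.aemeasurable hm]
  simp only [sysState_update, Function.update_self]
  have hm' : MeasurableSet {z : Source unitInterval M × (ℝ × Fin M × Bool) |
      FreshRule I π z.1.1 (sysState I π Δ₀ z.1 l) ((sysState I π Δ₀ z.1 l).time + z.2.1)} :=
    measurableSet_sysState_freshRule measurable_fst (by fun_prop) l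
  rw [ae_iff]
  change ((sourceLaw volume μ (errorLaw q) M).prod (eventLaw μ (errorLaw q) M)) {z |
    FreshRule I π z.1.1 (sysState I π Δ₀ z.1 l) ((sysState I π Δ₀ z.1 l).time + z.2.1)}ᶜ = 0
  -- After resampling, the gap is independent of the state, so by Fubini it suffices to treat each
  -- constant gap.
  rw [Measure.prod_apply_symm hm'.compl, lintegral_eq_zero_iff
    (measurable_measure_prodMk_right hm'.compl)]
  have hpos : ∀ᵐ e ∂eventLaw μ (errorLaw q) M, 0 ≤ e.1 := by
    have h1 : ∀ᵐ t ∂expMeasure (M * μ), 0 ≤ t := by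
      rw [ae_iff]
      refine measure_mono_null (fun t ht => ?_) expMeasure_Iic_zero
      exact (not_le.1 ht).le
    exact (Measure.quasiMeasurePreserving_fst).ae h1
  filter_upwards [hpos] with e he
  exact ae_freshRule_add hP l he

end EventTimes

/-! ### Dominance of counts and of sorted vectors -/

section Counting

variable {N : ℕ}

/-- The number of entries of `f` below `c`. -/
def countBelow (f : Fin N → ℝ) (c : ℝ) : ℕ := (Finset.univ.filter fun n => f n < c).card

theorem countBelow_anti {f g : Fin N → ℝ} (h : f ≤ g) (c : ℝ) : countBelow g c ≤ countBelow f c :=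
  Finset.card_le_card fun n hn => by
    simp only [Finset.mem_filter, Finset.mem_univ, true_and] at hn ⊢
    exact (h n).trans_lt hn

theorem countBelow_lt {f g : Fin N → ℝ} (h : f ≤ g) {c : ℝ} {n : Fin N} (hf : f n < c)
    (hg : c ≤ g n) : countBelow g c < countBelow f c := by
  refine Finset.card_lt_card ((Finset.ssubset_iff_of_subset fun k hk => ?_).2 ⟨n, ?_, ?_⟩)
  · simp only [Finset.mem_filter, Finset.mem_univ, true_and] at hk ⊢
    exact (h k).trans_lt hk
  · simpa using hf
  · simpa using hg

theorem countBelow_update_add_one (f : Fin N → ℝ) (c : ℝ) (n : Fin N) (y : ℝ) :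
    countBelow f c ≤ countBelow (Function.update f n y) c + 1 := by
  refine (Finset.card_le_card (t := insert n (Finset.univ.filter fun k =>
    Function.update f n y k < c)) fun k hk => ?_).trans (Finset.card_insert_le _ _)
  simp only [Finset.mem_filter, Finset.mem_univ, true_and, Finset.mem_insert] at hk ⊢
  by_cases h : k = n
  · exact Or.inl h
  · right; rwa [Function.update_of_ne h]

theorem countBelow_comp_perm (f : Fin N → ℝ) (σ : Equiv.Perm (Fin N)) (c : ℝ) :
    countBelow (f ∘ σ) c = countBelow f c := by
  refine Finset.card_bij (fun n _ => σ n) (fun n hn => by simpa using hn)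
    (fun _ _ _ _ h => σ.injective h) fun n hn => ⟨σ.symm n, by simpa using hn, by simp⟩

/-- Counting dominance gives dominance after a permutation. -/
theorem exists_perm_le {u v : Fin N → ℝ} (h : ∀ c, countBelow u c ≤ countBelow v c) :
    ∃ σ : Equiv.Perm (Fin N), v ∘ σ ≤ u := by
  -- Compare the `k`-th smallest entries. If that of `v`, called `c`, were larger, then `u` would
  -- have at least `k + 1` entries below `c` and `v` at most `k`.
  have key : v ∘ Tuple.sort v ≤ u ∘ Tuple.sort u := by
    intro k
    by_contra! hlt
    set c := (v ∘ Tuple.sort v) k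
    have h1 : (k : ℕ) + 1 ≤ countBelow (u ∘ Tuple.sort u) c := by
      rw [← Fin.card_Iic]
      refine Finset.card_le_card fun j hj => ?_
      simp only [Finset.mem_filter, Finset.mem_univ, true_and]
      exact (Tuple.monotone_sort u (Finset.mem_Iic.1 hj)).trans_lt hlt
    have h2 : countBelow (v ∘ Tuple.sort v) c ≤ k := by
      rw [← Fin.card_Iio]
      refine Finset.card_le_card fun j hj => ?_
      simp only [Finset.mem_filter, Finset.mem_univ, true_and] at hj
      rw [Finset.mem_Iio]
      by_contra! hjk
      exact (Tuple.monotone_sort v hjk).not_gt hj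
    rw [countBelow_comp_perm] at h1 h2
    have := h c
    omega
  refine ⟨(Tuple.sort u).symm.trans (Tuple.sort v), fun n => ?_⟩
  simpa using key ((Tuple.sort u).symm n)

end Counting

/-! ### Pathwise comparison on a common source -/

section Comparison

variable {N M : ℕ} {I : Arrivals N} {P π : Policy N M} {r : unitInterval} {s s' : SysState N}

theorem exists_isFresh {n : Fin N} {i : ℕ} {t : ℝ} (hi : I.A (n, i) ≤ t) :
    ∃ j, IsFresh I t (n, j) ∧ I.S (n, i) ≤ I.S (n, j) := by
  obtain ⟨j, hj, hmax⟩ := Set.exists_max_image {i | I.A (n, i) ≤ t} (fun i => I.S (n, i))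
    (I.finite_arrived n t) ⟨i, hi⟩
  exact ⟨j, ⟨hj, hmax⟩, hmax i hi⟩

theorem serverKey_eq_of_server {t : ℝ} {m : Fin M} {p : Packet N}
    (h : server I π r s t m = some p) : serverKey I π r s t m = (s.latest p.1 : EReal) := by
  unfold serverKey; rw [h]

theorem exists_server_of_serverKey_lt {t : ℝ} {m : Fin M} {c : ℝ}
    (h : serverKey I π r s t m < (c : EReal)) :
    ∃ p, server I π r s t m = some p ∧ s.latest p.1 < c := by
  unfold serverKey at h
  split at h
  · rename_i p hp
    exact ⟨p, hp, by exact_mod_cast h⟩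
  · exact absurd h not_top_lt

theorem serverKey_slotServer_mono {t : ℝ} {j k : Fin M} (h : j ≤ k) :
    serverKey I π r s t (slotServer I π r s t j) ≤ serverKey I π r s t (slotServer I π r s t k) :=
  Tuple.monotone_sort (serverKey I π r s t) h

/-- A slot that serves a flow with key below `c` is preceded by slots that serve other such
flows. -/
theorem lt_countBelow {t c : ℝ} {k : Fin M}
    (h : serverKey I π r s t (slotServer I π r s t k) < (c : EReal)) :
    (k : ℕ) < countBelow s.latest c := by
  have h1 : ∀ j : Fin M, j ≤ k → ∃ p, server I π r s t (slotServer I π r s t j) = some p ∧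
      s.latest p.1 < c := fun j hj =>
    exists_server_of_serverKey_lt ((serverKey_slotServer_mono hj).trans_lt h)
  obtain ⟨p₀, -⟩ := h1 k le_rfl
  have : Nonempty (Packet N) := ⟨p₀⟩
  choose! f hf hlt using h1
  rw [← Nat.succ_le_iff, Nat.succ_eq_add_one, ← Fin.card_Iic k]
  refine Finset.card_le_card_of_injOn (fun j => (f j).1) (fun j hj => ?_) fun j hj j' hj' hjj => ?_
  · simpa using hlt j (by simpa using hj)
  · exact (slotServer I π r s t).injective (π.flow_injective _ _ _ _ _ _ _ _
      (hf j (by simpa using hj)) (hf j' (by simpa using hj')) hjj)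

/-- Under the rule, if more flows than `k` have keys below `c` and all of them have fresher
packets, then slot `k` serves a freshest packet of such a flow. -/
theorem FreshRule.slot_fresh {t c : ℝ} {k : Fin M} (hr : FreshRule I P r s t)
    (hpend : ∀ n, s.latest n < c → ∃ i, IsFresh I t (n, i) ∧ c ≤ I.S (n, i))
    (hk : (k : ℕ) < countBelow s.latest c) :
    ∃ p, server I P r s t (slotServer I P r s t k) = some p ∧ IsFresh I t p ∧
      s.latest p.1 < c := by
  -- If the rule gives every server a freshest packet of a flow at least as old as some flow below
  -- `c`, slot `k` is settled at once. Otherwise every flow below `c` is itself served with a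
  -- freshest packet.
  by_cases hall : ∃ n, s.latest n < c ∧ ∀ m, ∃ p, server I P r s t m = some p ∧ IsFresh I t p ∧
      s.latest p.1 ≤ s.latest n
  · obtain ⟨n, hn, h⟩ := hall
    obtain ⟨p, h1, h2, h3⟩ := h (slotServer I P r s t k)
    exact ⟨p, h1, h2, h3.trans_lt hn⟩
  have hserved : ∀ n, s.latest n < c → ∃ m j, server I P r s t m = some (n, j) ∧
      IsFresh I t (n, j) := by
    intro n hn
    obtain ⟨i, hi, hc⟩ := hpend n hn
    exact (hr n i hi (hn.trans_le hc)).resolve_right fun h => hall ⟨n, hn, h⟩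
  have : Nonempty (Fin M) := ⟨k⟩
  choose! g j hg hfresh using hserved
  -- More than `k` flows occupy distinct slots, so one of them sits in slot `k` or later; sorting
  -- then puts the key of slot `k` below `c` too.
  obtain ⟨n, hn, hkn⟩ : ∃ n, s.latest n < c ∧ k ≤ (slotServer I P r s t).symm (g n) := by
    by_contra! hlt
    refine absurd hk (not_lt.2 ?_)
    rw [← Fin.card_Iio k]
    refine Finset.card_le_card_of_injOn (fun n => (slotServer I P r s t).symm (g n))
      (fun n hn => ?_) fun n hn n' hn' hnn => ?_
    · simpa using hlt n (by simpa using hn)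
    · have h1 := hg n (by simpa using hn)
      have h2 := hg n' (by simpa using hn')
      rw [← (slotServer I P r s t).symm.injective hnn, h1] at h2
      simpa using congrArg (Option.map Prod.fst) h2
  have hkey : serverKey I P r s t (slotServer I P r s t k) < (c : EReal) := by
    refine (serverKey_slotServer_mono hkn).trans_lt ?_
    rw [Equiv.apply_symm_apply, serverKey_eq_of_server (hg n hn)]
    exact_mod_cast hn
  obtain ⟨p, hp, hpc⟩ := exists_server_of_serverKey_lt hkey
  refine ⟨p, hp, ?_, hpc⟩
  -- The flow in slot `k` is served with a freshest packet by some server, and by `flow_injective`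
  -- that server is the one in slot `k`.
  have h1 := hg p.1 hpc
  have hm := P.flow_injective _ _ _ _ _ _ _ _ hp h1 rfl
  rw [← hm, hp] at h1
  rw [Option.some.inj h1]
  exact hfresh p.1 hpc

theorem latest_le_advanceAt (κ : ℕ) (t : ℝ) (b : Bool) (i : Packet N ⊕ Fin M) :
    s.latest ≤ (SysState.advanceAt I κ t b s i).latest := by
  rcases i with p | m
  · rw [latest_advanceAt_inl]
    cases b
    · simp only [Bool.false_eq_true, if_false]
      intro n
      by_cases hn : n = p.1
      · subst hn; simp
      · rw [Function.update_of_ne hn]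
    · exact le_rfl
  · exact le_rfl

/-- The heart of the comparison: whenever the event lowers the count for `π`, either there was slack
or the same slot lowers the count for `P`. The shared error mark makes both transmissions succeed
together. -/
theorem nextState_countBelow_le (hI : I.Synchronized) {e : ℝ × Fin M × Bool}
    (htime : s.time = s'.time) (hr : FreshRule I P r s (s.time + e.1))
    (h : ∀ c, countBelow s.latest c ≤ countBelow s'.latest c) (c : ℝ) :
    countBelow (nextState I P r s e).latest c ≤ countBelow (nextState I π r s' e).latest c := by
  obtain ⟨t, k, b⟩ := e
  simp only [nextState, ← htime] at hr ⊢
  set T := s.time + t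
  have hmono : s.latest ≤ (SysState.advanceAt I s.count T b s (slotItem I P r s T k)).latest :=
    latest_le_advanceAt _ _ _ _
  have hle := (countBelow_anti hmono c).trans (h c)
  rcases hitem : slotItem I π r s' T k with p | m
  swap
  · exact hle
  rw [latest_advanceAt_inl]
  cases b
  swap
  · exact hle
  simp only [Bool.false_eq_true, if_false]
  -- Only in this case does the delivery carry a flow of the second system across the level `c`.
  by_cases hc : s'.latest p.1 < c ∧ c ≤ I.S p
  swap
  · refine hle.trans (Finset.card_le_card fun n hn => ?_)
    simp only [Finset.mem_filter, Finset.mem_univ, true_and] at hn ⊢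
    by_cases hnp : n = p.1
    · subst hnp
      rw [Function.update_self]
      refine max_lt hn ?_
      by_contra! hcS
      exact hc ⟨hn, hcS⟩
    · rwa [Function.update_of_ne hnp]
  obtain ⟨hvc, hcS⟩ := hc
  have hserv := slotItem_eq_inl_iff.1 hitem
  have hA : I.A p ≤ T := by
    have hobs := π.arrived _ _ _ _ _ _ hserv
    by_contra hA
    exact hobs (by simp [Arrivals.observed, hA])
  have hk : (k : ℕ) < countBelow s'.latest c := lt_countBelow (I := I) (π := π) (r := r) (t := T)
    (by rw [serverKey_eq_of_server hserv]; exact_mod_cast hvc)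
  have hstep := countBelow_update_add_one s'.latest c p.1 (max (s'.latest p.1) (I.S p))
  -- If not, the first count is at most `k` and the second exceeds `k`, so the second can afford to
  -- lose one.
  by_cases hku : (k : ℕ) < countBelow s.latest c
  swap
  · have := countBelow_anti hmono c
    omega
  obtain ⟨S, A, hSA⟩ := hI
  have hpS : I.S p = S p.2 := (hSA p.1 p.2).1
  have hpA : I.A p = A p.2 := (hSA p.1 p.2).2
  -- Synchronization: the packets with the index of `p` have arrived in all flows and were generated
  -- at the same time, at or after `c`.
  have hpend : ∀ n, ∃ i, IsFresh I T (n, i) ∧ c ≤ I.S (n, i) := fun n => by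
    obtain ⟨j, hj, hle⟩ := exists_isFresh (I := I) (n := n) (i := p.2) (t := T)
      (by rw [(hSA n p.2).2, ← hpA]; exact hA)
    refine ⟨j, hj, hcS.trans (le_trans ?_ hle)⟩
    rw [hpS, (hSA n p.2).1]
  obtain ⟨p', hp', hfresh, hlt⟩ := hr.slot_fresh (fun n _ => hpend n) hku
  have hitem' := slotItem_eq_inl_iff.2 hp'
  have hgt : c ≤ (SysState.advanceAt I s.count T false s (slotItem I P r s T k)).latest p'.1 := by
    rw [hitem', latest_advanceAt_inl]
    simp only [Bool.false_eq_true, if_false, Function.update_self]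
    obtain ⟨i, hi, hci⟩ := hpend p'.1
    exact (hci.trans (hfresh.2 i hi.1)).trans (le_max_right _ _)
  have h1 := countBelow_lt hmono hlt hgt
  have h2 := h c
  omega

theorem sysState_time_eq {Δ₀ : Fin N → ℝ≥0} (x : Source unitInterval M) (l : ℕ) :
    (sysState I P Δ₀ x l).time = (sysState I π Δ₀ x l).time := by
  induction l with
  | zero => rfl
  | succ l ih => rw [sysState_time_succ, sysState_time_succ, ih]

theorem sysState_countBelow_le (hI : I.Synchronized) {Δ₀ : Fin N → ℝ≥0}
    {x : Source unitInterval M}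
    (hr : ∀ l, FreshRule I P x.1 (sysState I P Δ₀ x l) ((sysState I P Δ₀ x l).time + (x.2 l).1))
    (l : ℕ) (c : ℝ) :
    countBelow (sysState I P Δ₀ x l).latest c ≤ countBelow (sysState I π Δ₀ x l).latest c := by
  induction l generalizing c with
  | zero => exact le_rfl
  | succ l ih => exact nextState_countBelow_le hI (sysState_time_eq x l) (hr l) ih c

/-- Event times depend on the source only, so one window contains `t` for both systems. Counting
dominance orders the ages up to a permutation, which a symmetric penalty does not see. -/
theorem agePenalty_le_of_drivenBy (hI : I.Synchronized) {Δ₀ : Fin N → ℝ≥0}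
    {p : ℝ≥0 → (Fin N → ℝ≥0) → ℝ} (hp : ∀ t, IsSymPenalty (p t))
    {x : Source unitInterval M} {ω ω' : Outcome N}
    (hr : ∀ l, FreshRule I P x.1 (sysState I P Δ₀ x l) ((sysState I P Δ₀ x l).time + (x.2 l).1))
    (hgap : ∀ n, ∃ l ≥ n, 1 < (x.2 l).1)
    (h : DrivenBy I P Δ₀ ω x) (h' : DrivenBy I π Δ₀ ω' x) (t : ℝ≥0) :
    agePenalty I P Δ₀ p t ω ≤ agePenalty I π Δ₀ p t ω' := by
  obtain ⟨l, h1, h2⟩ := exists_window (I := I) (π := P) (Δ₀ := Δ₀) h.gap_pos hgap t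
  obtain ⟨σ, hσ⟩ := exists_perm_le (sysState_countBelow_le (π := π) hI hr l)
  rw [agePenalty, agePenalty, ← (hp t).symm σ fun n => (age I π Δ₀ ω' t n).toNNReal]
  refine (hp t).mono fun n => Real.toNNReal_le_toNNReal ?_
  have h1' : (sysState I π Δ₀ x l).time ≤ t := by rwa [sysState_time_eq (π := P)]
  have h2' : (t : ℝ) < (sysState I π Δ₀ x (l + 1)).time := by rwa [sysState_time_eq (π := P)]
  rw [h.age_eq h1 h2, h'.age_eq h1' h2']
  exact sub_le_sub_left (hσ n) _

end Comparison

/-! ### Coupling over a common factor -/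

section Gluing

/-- The kernel is the conditional law of a point given its image under `h`. -/
theorem exists_disintegration {X C : Type*} [MeasurableSpace X] [MeasurableSpace C]
    [StandardBorelSpace C] [Nonempty C] {ν : Measure X} {τ : Measure C} [IsProbabilityMeasure τ]
    {h : C → X} (hh : MeasurePreserving h τ ν) :
    ∃ κ : Kernel X C, IsMarkovKernel κ ∧ ν ⊗ₘ κ = τ.map fun c => (h c, c) := by
  have hm : Measurable fun c => (h c, c) := hh.measurable.prodMk measurable_id
  have := Measure.isProbabilityMeasure_map (μ := τ) hm.aemeasurable
  refine ⟨(τ.map fun c => (h c, c)).condKernel, inferInstance, ?_⟩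
  have hfst : (τ.map fun c => (h c, c)).fst = ν := by
    rw [Measure.fst, Measure.map_map measurable_fst hm]
    exact hh.map_eq
  have h1 := (τ.map fun c => (h c, c)).disintegrate (τ.map fun c => (h c, c)).condKernel
  rwa [hfst] at h1

/-- Two probability spaces with a common factor have a coupling over that factor. -/
theorem exists_gluing {X A B : Type*} [MeasurableSpace X] [MeasurableEq X]
    [MeasurableSpace A] [StandardBorelSpace A] [Nonempty A]
    [MeasurableSpace B] [StandardBorelSpace B] [Nonempty B]
    {ν : Measure X} {α : Measure A} {β : Measure B} [IsProbabilityMeasure α]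
    [IsProbabilityMeasure β] {f : A → X} {g : B → X}
    (hf : MeasurePreserving f α ν) (hg : MeasurePreserving g β ν) :
    ∃ γ : Measure (A × B), MeasurePreserving Prod.fst γ α ∧ MeasurePreserving Prod.snd γ β ∧
      ∀ᵐ z ∂γ, f z.1 = g z.2 := by
  have := Measure.isProbabilityMeasure_map (μ := α) hf.measurable.aemeasurable
  rw [hf.map_eq] at this
  obtain ⟨κ, hκ, hκα⟩ := exists_disintegration hf
  obtain ⟨η, hη, hηβ⟩ := exists_disintegration hg
  -- Draw the common value from `ν`, then the two points independently from their conditional laws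
  -- given that value.
  have h1 : (ν ⊗ₘ (κ ×ₖ η)).map (Prod.map id Prod.fst) = α.map fun a => (f a, a) := by
    rw [← Measure.compProd_map measurable_fst, ← Kernel.fst_eq, Kernel.fst_prod, hκα]
  have h2 : (ν ⊗ₘ (κ ×ₖ η)).map (Prod.map id Prod.snd) = β.map fun b => (g b, b) := by
    rw [← Measure.compProd_map measurable_snd, ← Kernel.snd_eq, Kernel.snd_prod, hηβ]
  have hmf : Measurable fun a => (f a, a) := hf.measurable.prodMk measurable_id
  have hmg : Measurable fun b => (g b, b) := hg.measurable.prodMk measurable_id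
  have hm1 : Measurable (Prod.map id Prod.fst : X × A × B → X × A) :=
    measurable_id.prodMap measurable_fst
  have hm2 : Measurable (Prod.map id Prod.snd : X × A × B → X × B) :=
    measurable_id.prodMap measurable_snd
  have h3 : ∀ᵐ z ∂ν ⊗ₘ (κ ×ₖ η), z.1 = f z.2.1 := by
    have : ∀ᵐ y ∂(ν ⊗ₘ (κ ×ₖ η)).map (Prod.map id Prod.fst), y.1 = f y.2 := by
      have hs : MeasurableSet {y : X × A | y.1 = f y.2} :=
        measurableSet_eq_fun measurable_fst (hf.measurable.comp measurable_snd)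
      rw [h1, ae_map_iff hmf.aemeasurable hs]
      exact .of_forall fun _ => rfl
    exact ae_of_ae_map hm1.aemeasurable this
  have h4 : ∀ᵐ z ∂ν ⊗ₘ (κ ×ₖ η), z.1 = g z.2.2 := by
    have : ∀ᵐ y ∂(ν ⊗ₘ (κ ×ₖ η)).map (Prod.map id Prod.snd), y.1 = g y.2 := by
      have hs : MeasurableSet {y : X × B | y.1 = g y.2} :=
        measurableSet_eq_fun measurable_fst (hg.measurable.comp measurable_snd)
      rw [h2, ae_map_iff hmg.aemeasurable hs]
      exact .of_forall fun _ => rfl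
    exact ae_of_ae_map hm2.aemeasurable this
  refine ⟨(ν ⊗ₘ (κ ×ₖ η)).snd, ⟨measurable_fst, ?_⟩, ⟨measurable_snd, ?_⟩, ?_⟩
  · have := congrArg (Measure.map Prod.snd) h1
    rw [Measure.map_map measurable_snd hm1, Measure.map_map measurable_snd hmf] at this
    rw [Measure.snd, Measure.map_map measurable_fst measurable_snd]
    exact this.trans Measure.map_id
  · have := congrArg (Measure.map Prod.snd) h2
    rw [Measure.map_map measurable_snd hm2, Measure.map_map measurable_snd hmg] at this
    rw [Measure.snd, Measure.map_map measurable_snd measurable_snd]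
    exact this.trans Measure.map_id
  · have hs : MeasurableSet {z : A × B | f z.1 = g z.2} :=
      measurableSet_eq_fun (hf.measurable.comp measurable_fst) (hg.measurable.comp measurable_snd)
    rw [Measure.snd, ae_map_iff measurable_snd.aemeasurable hs]
    filter_upwards [h3, h4] with z hz1 hz2
    exact hz1.symm.trans hz2

instance (N M : ℕ) : StandardBorelSpace (ExtOutcome N M) := by
  have : StandardBorelSpace (ℕ → ℝ × Fin M × Bool) := inferInstance
  have : StandardBorelSpace (Fin M → Clock) := inferInstance
  have : StandardBorelSpace ((Fin M → Clock) × (ℕ → ℝ × Fin M × Bool)) := StandardBorelSpace.prod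
  have : StandardBorelSpace (Outcome N) := inferInstance
  exact StandardBorelSpace.prod

end Gluing

/-! ### The coupling of age penalties and its consequences -/

section Penalty

variable {N M : ℕ} {I : Arrivals N} {Δ₀ : Fin N → ℝ≥0} {p : ℝ≥0 → (Fin N → ℝ≥0) → ℝ}
  {μ : ℝ} {hμ : 0 < μ} {q : unitInterval}

theorem exists_coupling [NeZero M] (hI : I.Synchronized) (hp : ∀ t, IsSymPenalty (p t))
    {P : Policy N M} (hP : IsPMAFLGFS I P (law N μ hμ q) Δ₀) (π : Policy N M) :
    ∃ (γ : Measure (ExtOutcome N M × ExtOutcome N M)),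
      MeasurePreserving (fun z => z.1.1) γ (law N μ hμ q) ∧
      MeasurePreserving (fun z => z.2.1) γ (law N μ hμ q) ∧
      ∀ᵐ z ∂γ, ∀ t, agePenalty I P Δ₀ p t z.1.1 ≤ agePenalty I π Δ₀ p t z.2.1 := by
  have : Fact (0 < μ) := ⟨hμ⟩
  have hdP := measurePreserving_drivingSource (I := I) (π := P) (Δ₀ := Δ₀) (hμ := hμ) (q := q)
  have hdπ := measurePreserving_drivingSource (I := I) (π := π) (Δ₀ := Δ₀) (hμ := hμ) (q := q)
  obtain ⟨γ, h1, h2, h3⟩ := exists_gluing hdP hdπ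
  have hfst : MeasurePreserving Prod.fst (extLaw μ hμ q N M) (law N μ hμ q) :=
    measurePreserving_fst
  refine ⟨γ, hfst.comp h1, hfst.comp h2, ?_⟩
  have ha : ∀ᵐ z ∂extLaw μ hμ q N M, DrivenBy I P Δ₀ z.1 (drivingSource I P Δ₀ z) ∧
      (∀ l, FreshRule I P (drivingSource I P Δ₀ z).1 (sysState I P Δ₀ (drivingSource I P Δ₀ z) l)
        ((sysState I P Δ₀ (drivingSource I P Δ₀ z) l).time +
          ((drivingSource I P Δ₀ z).2 l).1)) ∧
      ∀ n, ∃ l ≥ n, 1 < ((drivingSource I P Δ₀ z).2 l).1 :=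
    ae_drivenBy_drivingSource.and
      ((hdP.quasiMeasurePreserving.ae (ae_freshRule hP)).and
        (hdP.quasiMeasurePreserving.ae ae_exists_gap))
  have hb : ∀ᵐ z ∂extLaw μ hμ q N M, DrivenBy I π Δ₀ z.1 (drivingSource I π Δ₀ z) :=
    ae_drivenBy_drivingSource
  filter_upwards [h1.quasiMeasurePreserving.ae ha, h2.quasiMeasurePreserving.ae hb, h3]
    with z hz1 hz2 hz3 t
  rw [← hz3] at hz2
  exact agePenalty_le_of_drivenBy hI hp hz1.2.1 hz1.2.2 hz1.1 hz2 t

/-- Almost every section of a measurable representative is a representative of `f`. This brings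
measurability from extended outcomes back to outcomes. -/
theorem aemeasurable_of_comp_fst {A B C : Type*} [MeasurableSpace A] [MeasurableSpace B]
    [MeasurableSpace C] {α : Measure A} {β : Measure B} [SFinite α] [SFinite β] [NeZero β]
    {f : A → C} (hf : AEMeasurable (fun z : A × B => f z.1) (α.prod β)) : AEMeasurable f α := by
  obtain ⟨g, hg, hfg⟩ := hf
  have h := (Measure.measurePreserving_swap (μ := β) (ν := α)).quasiMeasurePreserving.ae hfg
  obtain ⟨b, hb⟩ := (Measure.ae_ae_of_ae_prod h).exists
  exact ⟨fun a => g (a, b), hg.comp (measurable_id.prodMk measurable_const), hb⟩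

/-- Up to null sets, the countably many windows cover the extended outcomes, and on each of them the
age is a measurable function of the driving source. -/
theorem aemeasurable_age [NeZero M] (P : Policy N M) (t : ℝ≥0) (n : Fin N) :
    AEMeasurable (fun ω => age I P Δ₀ ω t n) (law N μ hμ q) := by
  have : Fact (0 < μ) := ⟨hμ⟩
  refine aemeasurable_of_comp_fst (β := (Measure.infinitePi fun _ : Fin M =>
    clockLaw μ (errorLaw q)).prod (Measure.infinitePi fun _ : ℕ => eventLaw μ (errorLaw q) M)) ?_
  change AEMeasurable _ (extLaw μ hμ q N M)
  have hd := measurePreserving_drivingSource (I := I) (π := P) (Δ₀ := Δ₀) (hμ := hμ) (q := q)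
  set x : ExtOutcome N M → Source unitInterval M := drivingSource I P Δ₀
  have hs : ∀ l, Measurable fun z => sysState I P Δ₀ (x z) l := fun l =>
    (measurable_sysState l).comp hd.measurable
  have hτ : ∀ l, Measurable fun z => (sysState I P Δ₀ (x z) l).time := fun l =>
    SysState.measurable_time.comp (hs l)
  set W : ℕ → Set (ExtOutcome N M) := fun l =>
    {z | (sysState I P Δ₀ (x z) l).time ≤ t} ∩ {z | (t : ℝ) < (sysState I P Δ₀ (x z) (l + 1)).time}
  have hW : ∀ l, MeasurableSet (W l) := fun l =>
    (measurableSet_le (hτ l) measurable_const).inter (measurableSet_lt measurable_const (hτ _))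
  have hdriven : ∀ᵐ z ∂extLaw μ hμ q N M, DrivenBy I P Δ₀ z.1 (x z) := ae_drivenBy_drivingSource
  have hcover : ∀ᵐ z ∂extLaw μ hμ q N M, z ∈ ⋃ l, W l := by
    filter_upwards [hdriven, hd.quasiMeasurePreserving.ae ae_exists_gap] with z hz1 hz2
    exact Set.mem_iUnion.2 (exists_window hz1.gap_pos hz2 t)
  rw [← Measure.restrict_eq_self_of_ae_mem hcover, aemeasurable_iUnion_iff]
  intro l
  have hm : Measurable fun z => (t : ℝ) - (sysState I P Δ₀ (x z) l).latest n :=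
    measurable_const.sub ((measurable_pi_apply n).comp (SysState.measurable_latest.comp (hs l)))
  refine hm.aemeasurable.congr ?_
  filter_upwards [ae_restrict_of_ae hdriven, ae_restrict_mem (hW l)] with z hz hzW
  exact (hz.age_eq hzW.1 hzW.2 n).symm

theorem not_delivered_of_no_servers (π : Policy N 0) (ω : Outcome N) (k : ℕ) (i : Packet N) :
    (run I π ω k).2 i = 0 ∧ (snapshot I π ω k).2.2 i = false := by
  induction k with
  | zero => exact ⟨rfl, rfl⟩
  | succ k ih =>
    have hw : ∀ t, work I π ω.2.2 (run I π ω k).1 (run I π ω k).2 i t = 0 := fun t => by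
      simp [work, serviceTimes, ih.1]
    have hf : ∀ t, ¬ Finished I π ω (run I π ω k).1 (run I π ω k).2 i t := fun t h => by
      have := h.1
      rw [hw] at this
      exact lt_irrefl _ this
    rw [snapshot_succ]
    refine ⟨?_, ?_⟩
    · simp only [run, nextWork, hf, if_false, hw]
    · simp only [nextSnapshot, hf, false_and, if_false]
      exact ih.2

theorem age_of_no_servers (π : Policy N 0) (ω : Outcome N) (t : ℝ≥0) (n : Fin N) :
    age I π Δ₀ ω t n = t + Δ₀ n := by
  have : {s | ∃ i, DeliveredBy I π ω (n, i) t ∧ s = I.S (n, i)} = ∅ := by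
    ext s
    simp only [Set.mem_ofPred_eq, Set.mem_empty_iff_false, iff_false, not_exists, not_and]
    rintro i ⟨k, _, hk⟩
    simp [(not_delivered_of_no_servers (I := I) π ω k (n, i)).2] at hk
  simp [age, this]

theorem aemeasurable_agePenalty (hp : ∀ t, IsSymPenalty (p t)) (P : Policy N M) (t : ℝ≥0) :
    AEMeasurable (agePenalty I P Δ₀ p t) (law N μ hμ q) := by
  rcases Nat.eq_zero_or_pos M with rfl | hM
  · have : agePenalty I P Δ₀ p t = fun _ => p t fun n => (t + Δ₀ n : ℝ).toNNReal := by
      funext ω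
      simp only [agePenalty, age_of_no_servers]
    rw [this]
    exact aemeasurable_const
  · have : NeZero M := ⟨hM.ne'⟩
    exact (hp t).measurable.comp_aemeasurable
      (aemeasurable_pi_iff.2 fun n => (aemeasurable_age P t n).real_toNNReal)

/-- There is a coupling of two copies of the system under which the age penalty of the
P-MAF-LGFS policy is at all times at most that of the other policy. -/
theorem exists_coupling_law (hI : I.Synchronized) (hp : ∀ t, IsSymPenalty (p t))
    {P : Policy N M} (hP : IsPMAFLGFS I P (law N μ hμ q) Δ₀) (π : Policy N M) :
    ∃ (Ω : Type) (_ : MeasurableSpace Ω) (γ : Measure Ω) (f g : Ω → Outcome N),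
      MeasurePreserving f γ (law N μ hμ q) ∧ MeasurePreserving g γ (law N μ hμ q) ∧
      ∀ᵐ z ∂γ, ∀ t, agePenalty I P Δ₀ p t (f z) ≤ agePenalty I π Δ₀ p t (g z) := by
  rcases Nat.eq_zero_or_pos M with rfl | hM
  -- Without servers there are no events to couple along, but the ages are deterministic and the
  -- same for all policies.
  · refine ⟨_, _, law N μ hμ q, id, id, .id _, .id _, .of_forall fun ω t => le_of_eq ?_⟩
    simp only [agePenalty, age_of_no_servers]
  · have : NeZero M := ⟨hM.ne'⟩
    obtain ⟨γ, h⟩ := exists_coupling hI hp hP π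
    exact ⟨_, _, γ, _, _, h⟩

/-- Only the smaller process has to be measurable: for the larger one the bound on the measure of a
preimage under `g` holds for arbitrary sets. -/
theorem processStLE_of_coupling {Ω : Type*} [MeasurableSpace Ω] {E E' : Type*} [MeasurableSpace E]
    [MeasurableSpace E'] {γ : Measure Ω} {ν : Measure E} {ν' : Measure E'} {f : Ω → E} {g : Ω → E'}
    (hf : MeasurePreserving f γ ν) (hg : MeasurePreserving g γ ν') {X : ℝ≥0 → E → ℝ}
    {Y : ℝ≥0 → E' → ℝ} (hX : ∀ t, AEMeasurable (X t) ν)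
    (h : ∀ᵐ z ∂γ, ∀ t, X t (f z) ≤ Y t (g z)) : ProcessStLE ν X ν' Y := by
  intro n t _ U hU hUm
  have hXU : NullMeasurableSet ((fun ω j => X (t j) ω) ⁻¹' U) ν :=
    (aemeasurable_pi_iff.2 fun j => hX (t j)).nullMeasurableSet_preimage hUm
  rw [← hf.measure_preimage hXU]
  refine (measure_mono_ae ?_).trans (hg.measure_preimage_le _)
  filter_upwards [h] with z hz hzU
  exact hU (fun j => hz (t j)) hzU

theorem expectation_le_of_coupling {Ω : Type*} [MeasurableSpace Ω] {E E' : Type*}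
    [MeasurableSpace E] [MeasurableSpace E'] {γ : Measure Ω} {ν : Measure E} {ν' : Measure E'}
    {f : Ω → E} {g : Ω → E'} (hf : MeasurePreserving f γ ν) (hg : MeasurePreserving g γ ν')
    {X : E → ℝ} {Y : E' → ℝ} (hX : AEMeasurable X ν) (hY : AEMeasurable Y ν')
    (h : ∀ᵐ z ∂γ, X (f z) ≤ Y (g z)) : expectation ν X ≤ expectation ν' Y := by
  have hfl : ∀ φ : E → ℝ≥0∞, AEMeasurable φ ν → ∫⁻ ω, φ ω ∂ν = ∫⁻ z, φ (f z) ∂γ := fun φ hφ => by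
    rw [← hf.map_eq] at hφ ⊢
    exact lintegral_map' hφ hf.measurable.aemeasurable
  have hgl : ∀ φ : E' → ℝ≥0∞, AEMeasurable φ ν' → ∫⁻ ω, φ ω ∂ν' = ∫⁻ z, φ (g z) ∂γ :=
    fun φ hφ => by
      rw [← hg.map_eq] at hφ ⊢
      exact lintegral_map' hφ hg.measurable.aemeasurable
  have hX' : AEMeasurable (fun ω => -X ω) ν := hX.neg
  have hY' : AEMeasurable (fun ω => -Y ω) ν' := hY.neg
  rw [expectation, expectation, hfl _ hX.ennreal_ofReal, hfl _ hX'.ennreal_ofReal,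
    hgl _ hY.ennreal_ofReal, hgl _ hY'.ennreal_ofReal]
  refine EReal.sub_le_sub (EReal.coe_ennreal_le_coe_ennreal_iff.2 (lintegral_mono_ae ?_))
    (EReal.coe_ennreal_le_coe_ennreal_iff.2 (lintegral_mono_ae ?_))
  · filter_upwards [h] with z hz
    exact ENNReal.ofReal_le_ofReal hz
  · filter_upwards [h] with z hz
    exact ENNReal.ofReal_le_ofReal (neg_le_neg hz)

end Penalty

end StatusUpdate

end

theorem theorem1 {N M : ℕ} (μ : ℝ) (hμ : 0 < μ) (q : unitInterval) (hq : q < 1)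
    (I : StatusUpdate.Arrivals N) (hI : I.Synchronized) (Δ₀ : Fin N → ℝ≥0)
    (p : ℝ≥0 → (Fin N → ℝ≥0) → ℝ) (hp : ∀ t, StatusUpdate.IsSymPenalty (p t))
    (P : StatusUpdate.Policy N M)
    (hP : StatusUpdate.IsPMAFLGFS I P (StatusUpdate.law N μ hμ q) Δ₀) :
    (∀ π : StatusUpdate.Policy N M,
      StatusUpdate.ProcessStLE
        (StatusUpdate.law N μ hμ q) (StatusUpdate.agePenalty I P Δ₀ p)
        (StatusUpdate.law N μ hμ q) (StatusUpdate.agePenalty I π Δ₀ p)) ∧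
    (∀ φ : (ℝ≥0 → ℝ) → ℝ, Monotone φ →
      StatusUpdate.ExpectationExists (StatusUpdate.law N μ hμ q)
        (fun ω => φ fun t => StatusUpdate.agePenalty I P Δ₀ p t ω) →
      IsLeast
        {x : EReal | ∃ π : StatusUpdate.Policy N M,
          StatusUpdate.ExpectationExists (StatusUpdate.law N μ hμ q)
            (fun ω => φ fun t => StatusUpdate.agePenalty I π Δ₀ p t ω) ∧
          x = StatusUpdate.expectation (StatusUpdate.law N μ hμ q)
            (fun ω => φ fun t => StatusUpdate.agePenalty I π Δ₀ p t ω)}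
        (StatusUpdate.expectation (StatusUpdate.law N μ hμ q)
          (fun ω => φ fun t => StatusUpdate.agePenalty I P Δ₀ p t ω))) := by
  have hmeas := StatusUpdate.aemeasurable_agePenalty (I := I) (Δ₀ := Δ₀) (hμ := hμ) (q := q) hp P
  refine ⟨fun π => ?_, fun φ hφ hE => ⟨⟨P, hE, rfl⟩, ?_⟩⟩
  · obtain ⟨Ω, _, γ, f, g, hf, hg, h⟩ := StatusUpdate.exists_coupling_law hI hp hP π
    exact StatusUpdate.processStLE_of_coupling hf hg hmeas h
  · rintro _ ⟨π, hπ, rfl⟩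
    obtain ⟨Ω, _, γ, f, g, hf, hg, h⟩ := StatusUpdate.exists_coupling_law hI hp hP π
    refine StatusUpdate.expectation_le_of_coupling hf hg hE.1 hπ.1 ?_
    -- A single null set serves all times, so the monotone functional can be applied path by path.
    filter_upwards [h] with z hz
    exact hφ hz
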